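/- **Setting.** Let $\mathbf{Mf}$ be the category of smooth manifolds with corners (second countable, Hausdorff, locally modelled on open subsets of $[0,\infty)^n$, components of varying dimension allowed) and smooth maps, and let $\mathbf{Reg}_{\mathbb Z}$ be the category of regular separated schemes of finite type over $\operatorname{Spec}\mathbb Z$. The category $\mathbf{Mf}\times\mathbf{Reg}_{\mathbb Z}$, whose objects are written $M\times X$, carries the product of the open covering topology and the Zariski topology. For $X\in\mathbf{Reg}_{\mathbb Z}$ let $X(\mathbb C)$ be the complex manifold of complex points of $X$, and let $A(M\times X)$ be the complex of smooth complex valued differential forms on $M\times X(\mathbb C)$, with the exterior differential $d$. Let $A_{\mathbb R}\subseteq A$ be the real valued forms, and let $\mathcal F^pA\subseteq A$ be the forms which are locally of the form $\sum_{|J|\ge p}\omega_{I,J,K}\,dx^I\wedge dz^J\wedge d\bar z^K$, where the $x_i$ are local coordinates on $M$ and the $z_j$ are local holomorphic coordinates on $X(\mathbb C)$. The nontrivial element of $\mathrm{Gal}(\mathbb C/\mathbb R)$ acts on $A(M\times X)$ by sending $\omega$ to the complex conjugate of its pull-back along the complex conjugation on $X(\mathbb C)$. For an integer $p\ge 0$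 define presheaves of complexes of real vector spaces on $\mathbf{Mf}\times\mathbf{Reg}_{\mathbb Z}$ as follows. * $\mathbf{DR}(p)$ consists of the $\mathrm{Gal}(\mathbb C/\mathbb R)$-invariants of $$\mathrm{Cone}\bigl((2\pi i)^pA_{\mathbb R}\oplus\mathcal F^pA\xrightarrow{\ \alpha\oplus\beta\,\mapsto\,\alpha-\beta\ }A\bigr)[2p-1].$$ Thus $\mathbf{DR}(p)^n(M\times X)$ consists of the invariant triples $(\alpha\oplus\beta,\gamma)$ with $\alpha\in(2\pi i)^pA^{n+2p}_{\mathbb R}(M\times X)$, $\beta\in\mathcal F^pA^{n+2p}(M\times X)$ and $\gamma\in A^{n+2p-1}(M\times X)$, and $d(\alpha\oplus\beta,\gamma)=(d\alpha\oplus d\beta,\ \alpha-\beta-d\gamma)$. * $\mathbf{IDR}(p)^n(M\times X)$ is the space of $\mathrm{Gal}(\mathbb C/\mathbb R)$-invariant forms $\omega\in A^{n+2p}([0,1]\times M\times X)$ with $\omega|_{\{0\}\times M\times X}\in(2\pi i)^pA_{\mathbb R}(M\times X)$ and $\omega|_{\{1\}\times M\times X}\in\mathcal F^pA(M\times X)$,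 and its differential is the exterior differential. Put $\mathbf{IDR}:=\prod_{p\ge 0}\mathbf{IDR}(p)$, the product being taken object-wise in complexes. **Proposition.** For every $p\ge 0$ the formula $$q(\omega)=\Bigl(\omega|_{\{0\}\times M\times X}\oplus\omega|_{\{1\}\times M\times X},\ -\int_{[0,1]\times M\times X/M\times X}\omega\Bigr)$$ defines a morphism $q:\mathbf{IDR}(p)\to\mathbf{DR}(p)$ of presheaves of complexes which is an object-wise quasi-isomorphism: for all $M\times X$ the map $\mathbf{IDR}(p)(M\times X)\to\mathbf{DR}(p)(M\times X)$ is a quasi-isomorphism. (Here the fibre integral is normalised by $\int dt\wedge\gamma_t=\int_0^1\gamma_t\,dt$ for forms $\gamma_t$ not involving $dt$.) **Corollary.** Each $\mathbf{IDR}(p)$ and the product $\mathbf{IDR}$ are sheaves of complexes on $\mathbf{Mf}\times\mathbf{Reg}_{\mathbb Z}$. Moreover, $\mathbf{IDR}$ is a sheaf of bigraded graded commutative differential graded algebras: with the products $\wedge:\mathbf{IDR}(p)^n\times\mathbf{IDR}(q)^m\to\mathbf{IDR}(p+q)^{n+m}$ induced by the wedge product of forms, that is, $$(x\wedge y)_r=\sum_{p+q=r}x_p\wedge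 y_q\qquad\text{for }x=(x_p)_{p\ge 0}\in\mathbf{IDR}^n(M\times X),\ y=(y_q)_{q\ge 0}\in\mathbf{IDR}^m(M\times X),$$ every $\mathbf{IDR}(M\times X)$ is an associative bigraded (by the degree $n$ and the weight $p$) real algebra whose unit is the constant function $1$ in degree $0$ and weight $0$, we have $x\wedge y=(-1)^{nm}\,y\wedge x$ and $d(x\wedge y)=dx\wedge y+(-1)^n\,x\wedge dy$ for $x$, $y$ of degrees $n$, $m$, and all restriction maps of $\mathbf{IDR}$ are homomorphisms of unital algebras. -/

import Mathlib

open CategoryTheory AlgebraicGeometry Set Filter Topology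
open scoped Manifold ContDiff

noncomputable section

namespace Deligne

/-! ### The category of smooth manifolds with corners -/

/-- A smooth manifold with corners.  Its connected components may have different dimensions, so it
is given as a countable disjoint union of Hausdorff, second countable smooth manifolds `Pt i`, each
modelled on a sector `{x ∈ ℝⁿ | x_j ≥ 0 for j ∈ S}` (which is locally diffeomorphic to open subsets
of `[0,∞)ⁿ`). -/
structure CornerMfd : Type 1 where
  ι : Type
  countable : Countable ι
  E : ι → Type
  H : ι → Type
  Pt : ι → Type
  [normedE : ∀ i, NormedAddCommGroup (E i)]
  [spaceE : ∀ i, NormedSpace ℝ (E i)]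
  [topH : ∀ i, TopologicalSpace (H i)]
  model : ∀ i, ModelWithCorners ℝ (E i) (H i)
  corner : ∀ i, ∃ (n : ℕ) (S : Set (Fin n)) (L : E i ≃L[ℝ] (Fin n → ℝ)),
    range (model i) = {x | ∀ j ∈ S, 0 ≤ L x j}
  [topPt : ∀ i, TopologicalSpace (Pt i)]
  [charted : ∀ i, ChartedSpace (H i) (Pt i)]
  manifold : ∀ i, IsManifold (model i) ∞ (Pt i)
  t2 : ∀ i, T2Space (Pt i)
  secondCountable : ∀ i, SecondCountableTopology (Pt i)

attribute [instance] CornerMfd.normedE CornerMfd.spaceE CornerMfd.topH CornerMfd.topPt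
  CornerMfd.charted CornerMfd.manifold

/-- The underlying set of a manifold. -/
abbrev CornerMfd.Point (M : CornerMfd) : Type := Σ i, M.Pt i

/-- Smooth maps of manifolds with corners. -/
@[ext]
structure SmoothMap (M N : CornerMfd) : Type where
  toFun : M.Point → N.Point
  smooth : ∀ (i : M.ι) (x : M.Pt i), ∃ (j : N.ι) (g : M.Pt i → N.Pt j),
    ContMDiffAt (M.model i) (N.model j) ∞ g x ∧ ∀ᶠ y in 𝓝 x, toFun ⟨i, y⟩ = ⟨j, g y⟩

def SmoothMap.id (M : CornerMfd) : SmoothMap M M where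
  toFun := fun x => x
  smooth i _ := ⟨i, fun y => y, contMDiffAt_id, Eventually.of_forall fun _ => rfl⟩

def SmoothMap.comp {M N K : CornerMfd} (f : SmoothMap M N) (g : SmoothMap N K) :
    SmoothMap M K where
  toFun := fun x => g.toFun (f.toFun x)
  smooth i x := by
    obtain ⟨j, a, ha, hfa⟩ := f.smooth i x
    obtain ⟨k, b, hb, hgb⟩ := g.smooth j (a x)
    refine ⟨k, b ∘ a, hb.comp x ha, ?_⟩
    filter_upwards [hfa, ha.continuousAt.eventually hgb] with y h1 h2
    rw [h1, h2]; rfl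

instance : Category CornerMfd where
  Hom := SmoothMap
  id := SmoothMap.id
  comp := SmoothMap.comp

/-- Diffeomorphisms onto an open submanifold. -/
def SmoothMap.IsOpenEmbedding {M N : CornerMfd} (f : SmoothMap M N) : Prop :=
  Function.Injective f.toFun ∧ ∀ (i : M.ι) (x : M.Pt i), ∃ (j : N.ι)
    (Φ : PartialDiffeomorph (M.model i) (N.model j) (M.Pt i) (N.Pt j) ∞),
      x ∈ Φ.source ∧ ∀ y ∈ Φ.source, f.toFun ⟨i, y⟩ = ⟨j, Φ y⟩

theorem corner_prod {E : Type} [NormedAddCommGroup E] [NormedSpace ℝ E] {H : Type}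
    [TopologicalSpace H] (I : ModelWithCorners ℝ E H)
    (h : ∃ (n : ℕ) (S : Set (Fin n)) (L : E ≃L[ℝ] (Fin n → ℝ)),
      range I = {x | ∀ j ∈ S, 0 ≤ L x j}) :
    ∃ (n : ℕ) (S : Set (Fin n)) (L : (EuclideanSpace ℝ (Fin 1) × E) ≃L[ℝ] (Fin n → ℝ)),
      range ((𝓡∂ 1).prod I) = {x | ∀ j ∈ S, 0 ≤ L x j} := by
  obtain ⟨n, S, L, hL⟩ := h
  let e : (EuclideanSpace ℝ (Fin 1) × E) ≃ₗ[ℝ] (Fin (n + 1) → ℝ) :=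
    { toFun := fun x => Fin.cons (x.1 0) (L x.2)
      invFun := fun y => (WithLp.toLp 2 (fun _ => y 0), L.symm (Fin.tail y))
      map_add' := by
        intro x y; ext j; refine Fin.cases ?_ (fun j => ?_) j <;> simp
      map_smul' := by
        intro c x; ext j; refine Fin.cases ?_ (fun j => ?_) j <;> simp
      left_inv := by
        intro x
        refine Prod.ext ?_ ?_
        · ext j; fin_cases j; simp
        · simp
      right_inv := by
        intro y; ext j; refine Fin.cases ?_ (fun j => ?_) j <;> simp [Fin.tail] }
  have : FiniteDimensional ℝ E := FiniteDimensional.of_injective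
    (L.toLinearEquiv.toLinearMap) L.injective
  refine ⟨n + 1, insert 0 (Fin.succ '' S), e.toContinuousLinearEquiv, ?_⟩
  rw [ModelWithCorners.range_prod, hL]
  ext x
  have h1 : (x.1 ∈ range (𝓡∂ 1)) ↔ 0 ≤ x.1 0 := by
    rw [range_modelWithCornersEuclideanHalfSpace]; rfl
  simp only [mem_prod, h1, mem_ofPred_eq, forall_mem_insert, forall_mem_image]
  simp [e]

/-- The manifold `[0,1] × M`. -/
def cyl (M : CornerMfd) : CornerMfd where
  ι := M.ι
  countable := M.countable
  E i := EuclideanSpace ℝ (Fin 1) × M.E i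
  H i := ModelProd (EuclideanHalfSpace 1) (M.H i)
  Pt i := Icc (0 : ℝ) 1 × M.Pt i
  normedE i := inferInstanceAs (NormedAddCommGroup (EuclideanSpace ℝ (Fin 1) × M.E i))
  spaceE i := inferInstanceAs (NormedSpace ℝ (EuclideanSpace ℝ (Fin 1) × M.E i))
  topH i := inferInstanceAs (TopologicalSpace (ModelProd (EuclideanHalfSpace 1) (M.H i)))
  topPt i := inferInstanceAs (TopologicalSpace (Icc (0 : ℝ) 1 × M.Pt i))
  charted i := inferInstanceAs
    (ChartedSpace (ModelProd (EuclideanHalfSpace 1) (M.H i)) (Icc (0 : ℝ) 1 × M.Pt i))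
  model i := (𝓡∂ 1).prod (M.model i)
  corner i := corner_prod _ (M.corner i)
  manifold i := inferInstance
  t2 i := by have := M.t2 i; infer_instance
  secondCountable i := by have := M.secondCountable i; infer_instance

/-- The map `id × f : [0,1] × M → [0,1] × N`. -/
def cylMap {M N : CornerMfd} (f : SmoothMap M N) : SmoothMap (cyl M) (cyl N) where
  toFun x := ⟨(f.toFun ⟨x.1, x.2.2⟩).1, (x.2.1, (f.toFun ⟨x.1, x.2.2⟩).2)⟩
  smooth := by
    intro (i : M.ι) (x : Icc (0 : ℝ) 1 × M.Pt i)
    obtain ⟨j, g, hg, h⟩ := f.smooth i x.2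
    refine ⟨j, Prod.map (fun t => t) g, ?_, ?_⟩
    · exact ContMDiffAt.prodMap' contMDiffAt_id hg
    · filter_upwards [continuous_snd.continuousAt.eventually h] with y hy
      rw [hy]; rfl

/-- The inclusion of `{s} × M` into `[0,1] × M`. -/
def slice (s : Icc (0 : ℝ) 1) (M : CornerMfd) : SmoothMap M (cyl M) where
  toFun x := ⟨x.1, (s, x.2)⟩
  smooth i _ := ⟨i, fun y => (s, y), contMDiffAt_const.prodMk contMDiffAt_id,
    Eventually.of_forall fun _ => rfl⟩

/-! ### Arithmetic schemes and their complex points -/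

/-- Regular separated schemes of finite type over `Spec ℤ`. -/
def isArithmetic : ObjectProperty Scheme.{0} := fun X =>
  X.IsSeparated ∧ LocallyOfFiniteType (specZIsTerminal.from X) ∧
    QuasiCompact (specZIsTerminal.from X) ∧ ∀ x : X, IsRegularLocalRing (X.presheaf.stalk x)

/-- The category of regular separated schemes of finite type over `Spec ℤ`. -/
abbrev ArithScheme : Type 1 := isArithmetic.FullSubcategory

/-- The set `X(ℂ)` of complex points of `X` (equivalently, of `X ×_ℤ ℂ` over `ℂ`). -/
abbrev CPoint (X : Scheme.{0}) : Type := Spec (.of ℂ) ⟶ X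

/-- The value `f(x) ∈ ℂ` of a function `f ∈ 𝒪(W)` at a complex point `x` of `W`
(and zero if `x` does not lie in `W`). -/
def evalAt {X : Scheme.{0}} (W : X.Opens) (f : Γ(X, W)) (x : CPoint X) : ℂ :=
  open Classical in
  if h : ⊤ ≤ x ⁻¹ᵁ W then
    (Scheme.ΓSpecIso (.of ℂ)).hom ((Spec (.of ℂ)).presheaf.map (homOfLE h).op (x.app W f))
  else 0

/-- Complex conjugation on `X(ℂ)`. -/
def conjPoint {X : Scheme.{0}} (x : CPoint X) : CPoint X :=
  Spec.map (CommRingCat.ofHom (starRingEnd ℂ)) ≫ x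

theorem evalAt_comp {X Y : Scheme.{0}} (g : X ⟶ Y) (W : Y.Opens) (f : Γ(Y, W)) (x : CPoint X) :
    evalAt W f (x ≫ g) = evalAt (g ⁻¹ᵁ W) (g.app W f) x := by
  unfold evalAt
  have : (x ≫ g) ⁻¹ᵁ W = x ⁻¹ᵁ (g ⁻¹ᵁ W) := rfl
  by_cases h : ⊤ ≤ x ⁻¹ᵁ (g ⁻¹ᵁ W)
  · rw [dif_pos h, dif_pos (this ▸ h), Scheme.Hom.comp_app]
    rfl
  · rw [dif_neg h, dif_neg (this ▸ h)]

theorem top_le_conjPoint {X : Scheme.{0}} (W : X.Opens) (x : CPoint X) :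
    ⊤ ≤ (conjPoint x) ⁻¹ᵁ W ↔ ⊤ ≤ x ⁻¹ᵁ W := by
  have hc : Function.Surjective (Spec.map (CommRingCat.ofHom (starRingEnd ℂ))) := by
    have : IsIso (CommRingCat.ofHom (starRingEnd ℂ)) :=
      (starRingAut (R := ℂ)).toCommRingCatIso.isIso_hom
    exact (Spec.map (CommRingCat.ofHom (starRingEnd ℂ))).homeomorph.surjective
  constructor
  · intro h y _
    obtain ⟨y, rfl⟩ := hc y
    exact h (x := y) trivial
  · intro h y _
    exact h (x := Spec.map (CommRingCat.ofHom (starRingEnd ℂ)) y) trivial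

theorem evalAt_conjPoint {X : Scheme.{0}} (W : X.Opens) (f : Γ(X, W)) (x : CPoint X) :
    evalAt W f (conjPoint x) = star (evalAt W f x) := by
  by_cases h : ⊤ ≤ x ⁻¹ᵁ W
  · have h' := (top_le_conjPoint W x).2 h
    unfold evalAt
    rw [dif_pos h, dif_pos h']
    let c : Spec (.of ℂ) ⟶ Spec (.of ℂ) := Spec.map (CommRingCat.ofHom (starRingEnd ℂ))
    have e1 : (conjPoint x).app W f = c.app (x ⁻¹ᵁ W) (x.app W f) :=
      congrArg (fun k => k f) (Scheme.Hom.comp_app c x W)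
    have e2 : (Spec (.of ℂ)).presheaf.map (homOfLE h').op (c.app (x ⁻¹ᵁ W) (x.app W f)) =
        c.app ⊤ ((Spec (.of ℂ)).presheaf.map (homOfLE h).op (x.app W f)) :=
      congrArg (fun k => k (x.app W f)) (c.naturality (homOfLE h).op).symm
    have e3 (y : Γ(Spec (.of ℂ), ⊤)) : (Scheme.ΓSpecIso (.of ℂ)).hom (c.app ⊤ y) =
        starRingEnd ℂ ((Scheme.ΓSpecIso (.of ℂ)).hom y) :=
      congrArg (fun k => k y) (Scheme.ΓSpecIso_naturality (CommRingCat.ofHom (starRingEnd ℂ)))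
    exact ((congrArg _ (congrArg _ e1)).trans (congrArg _ e2)).trans (e3 _)
  · unfold evalAt
    rw [dif_neg h, dif_neg (mt (top_le_conjPoint W x).1 h), star_zero]

/-! ### Local parametrisations -/

/-- A smooth parametrisation of (a part of) a manifold with corners: a smooth map `φ : U → M` on a
convex set `U ⊆ ℝⁿ` with non-empty interior (for instance the inverse of a chart of `M` on a
relatively open box in `[0,∞)ⁿ`).  Only the restriction of `φ` to `U` matters. -/
structure MPlot (M : CornerMfd) : Type where
  dim : ℕ
  U : Set (Fin dim → ℝ)
  convex : Convex ℝ U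
  nonempty_interior : (interior U).Nonempty
  φ : (Fin dim → ℝ) → M.Point
  smooth : ∀ u ∈ U, ∃ (j : M.ι) (g : (Fin dim → ℝ) → M.Pt j),
    ContMDiffWithinAt 𝓘(ℝ, Fin dim → ℝ) (M.model j) ∞ g U u ∧ ∀ᶠ y in 𝓝[U] u, φ y = ⟨j, g y⟩

/-- A holomorphic parametrisation of (a part of) the complex manifold `X(ℂ)`: a holomorphic map
`ψ : V → X(ℂ)` on an open set `V ⊆ ℂᵐ` (for instance the inverse of a holomorphic chart).
Holomorphic means that for every Zariski open `W ⊆ X` the set `ψ⁻¹(W(ℂ))` is open and `f ∘ ψ` is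
holomorphic on it for every `f ∈ 𝒪(W)`.  Only the restriction of `ψ` to `V` matters. -/
structure XPlot (X : Scheme.{0}) : Type where
  dim : ℕ
  V : Set (Fin dim → ℂ)
  isOpen : IsOpen V
  ψ : (Fin dim → ℂ) → CPoint X
  isOpen_preimage : ∀ W : X.Opens, IsOpen {z | z ∈ V ∧ ⊤ ≤ ψ z ⁻¹ᵁ W}
  holomorphic : ∀ (W : X.Opens) (f : Γ(X, W)),
    DifferentiableOn ℂ (fun z => evalAt W f (ψ z)) {z | z ∈ V ∧ ⊤ ≤ ψ z ⁻¹ᵁ W}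

/-- The composite of a parametrisation with a smooth map. -/
@[reducible] def MPlot.map {M N : CornerMfd} (P : MPlot M) (f : SmoothMap M N) : MPlot N where
  dim := P.dim
  U := P.U
  convex := P.convex
  nonempty_interior := P.nonempty_interior
  φ := fun u => f.toFun (P.φ u)
  smooth u hu := by
    obtain ⟨i, a, ha, hP⟩ := P.smooth u hu
    obtain ⟨j, g, hg, hf⟩ := f.smooth i (a u)
    refine ⟨j, g ∘ a, hg.comp_contMDiffWithinAt u ha, ?_⟩
    filter_upwards [hP, ha.continuousWithinAt.eventually hf] with y h1 h2
    rw [h1, h2]; rfl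

/-- The composite of a parametrisation with the map `X(ℂ) → Y(ℂ)` given by `g : X ⟶ Y`. -/
@[reducible] def XPlot.map {X Y : Scheme.{0}} (Q : XPlot X) (g : X ⟶ Y) : XPlot Y where
  dim := Q.dim
  V := Q.V
  isOpen := Q.isOpen
  ψ := fun z => Q.ψ z ≫ g
  isOpen_preimage W := Q.isOpen_preimage (g ⁻¹ᵁ W)
  holomorphic W f := (Q.holomorphic (g ⁻¹ᵁ W) (g.app W f)).congr fun _ _ => evalAt_comp g W f _

/-- The parametrisation `z ↦ conj (ψ (conj z))` on the conjugate domain. -/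
@[reducible] def XPlot.conj {X : Scheme.{0}} (Q : XPlot X) : XPlot X where
  dim := Q.dim
  V := {z | star z ∈ Q.V}
  isOpen := Q.isOpen.preimage continuous_star
  ψ := fun z => conjPoint (Q.ψ (star z))
  isOpen_preimage W := by
    simp only [top_le_conjPoint]
    exact (Q.isOpen_preimage W).preimage continuous_star
  holomorphic W f := by
    simp only [top_le_conjPoint, evalAt_conjPoint]
    intro z hz
    have h := ((Q.holomorphic W f) (star z) hz).differentiableAt
      ((Q.isOpen_preimage W).mem_nhds hz)
    have := h.star_star
    rw [star_star] at this
    exact this.differentiableWithinAt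

/-- The parametrisation `(t, u) ↦ (t, φ u)` of `[0,1] × M` on `[0,1] × U`. -/
@[reducible] def MPlot.cyl {M : CornerMfd} (P : MPlot M) : MPlot (cyl M) where
  dim := P.dim + 1
  U := {u | u 0 ∈ Icc (0 : ℝ) 1 ∧ Fin.tail u ∈ P.U}
  convex := by
    intro u hu v hv a b ha hb hab
    exact ⟨convex_Icc (0 : ℝ) 1 hu.1 hv.1 ha hb hab, P.convex hu.2 hv.2 ha hb hab⟩
  nonempty_interior := by
    obtain ⟨u, hu⟩ := P.nonempty_interior
    have hc : Continuous (fun u : Fin (P.dim + 1) → ℝ => Fin.tail u) :=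
      continuous_pi fun j => continuous_apply _
    refine ⟨Fin.cons (1 / 2) u, mem_interior.2
      ⟨{u | u 0 ∈ Ioo (0 : ℝ) 1 ∧ Fin.tail u ∈ interior P.U}, ?_, ?_, ?_⟩⟩
    · exact fun v hv => ⟨Ioo_subset_Icc_self hv.1, interior_subset hv.2⟩
    · exact (isOpen_Ioo.preimage (continuous_apply 0)).inter (isOpen_interior.preimage hc)
    · refine ⟨?_, by simpa using hu⟩
      simp only [Fin.cons_zero, mem_Ioo]
      norm_num
  φ := fun u => ⟨(P.φ (Fin.tail u)).1,
    (projIcc (0 : ℝ) 1 zero_le_one (u 0), (P.φ (Fin.tail u)).2)⟩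
  smooth u hu := by
    obtain ⟨j, g, hg, h⟩ := P.smooth (Fin.tail u) hu.2
    have htail : ContDiff ℝ ∞ (fun u : Fin (P.dim + 1) → ℝ => Fin.tail u) :=
      contDiff_pi.2 fun j => contDiff_apply ℝ ℝ _
    have hm : MapsTo (fun u : Fin (P.dim + 1) → ℝ => Fin.tail u)
      {u | u 0 ∈ Icc (0 : ℝ) 1 ∧ Fin.tail u ∈ P.U} P.U := fun v hv => hv.2
    refine ⟨j, fun v => (projIcc (0 : ℝ) 1 zero_le_one (v 0), g (Fin.tail v)), ?_, ?_⟩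
    · refine ContMDiffWithinAt.prodMk ?_ ?_
      · have h0 : ContMDiffWithinAt 𝓘(ℝ, Fin (P.dim + 1) → ℝ) 𝓘(ℝ) ∞
            (fun v : Fin (P.dim + 1) → ℝ => v 0)
            {u | u 0 ∈ Icc (0 : ℝ) 1 ∧ Fin.tail u ∈ P.U} u :=
          ((contDiff_apply ℝ ℝ (0 : Fin (P.dim + 1))).contMDiff _).contMDiffWithinAt
        exact (contMDiffOn_projIcc (u 0) hu.1).comp u h0 fun v hv => hv.1
      · exact hg.comp u (htail.contMDiff u).contMDiffWithinAt hm
    · have ht : Tendsto (fun u : Fin (P.dim + 1) → ℝ => Fin.tail u)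
          (𝓝[{u | u 0 ∈ Icc (0 : ℝ) 1 ∧ Fin.tail u ∈ P.U}] u) (𝓝[P.U] (Fin.tail u)) :=
        htail.continuous.continuousWithinAt.tendsto_nhdsWithin hm
      filter_upwards [ht.eventually h] with v hv
      rw [hv]

/-- `a` exhibits `P'` as a smooth reparametrisation of (a part of) `P`. -/
structure MPlot.IsReparam {M : CornerMfd} (P' P : MPlot M)
    (a : (Fin P'.dim → ℝ) → (Fin P.dim → ℝ)) : Prop where
  smooth : ContDiffOn ℝ ∞ a P'.U
  mapsTo : MapsTo a P'.U P.U
  eq : ∀ u ∈ P'.U, P'.φ u = P.φ (a u)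

/-- `b` exhibits `Q'` as a holomorphic reparametrisation of (a part of) `Q`. -/
structure XPlot.IsReparam {X : Scheme.{0}} (Q' Q : XPlot X)
    (b : (Fin Q'.dim → ℂ) → (Fin Q.dim → ℂ)) : Prop where
  holomorphic : AnalyticOnNhd ℂ b Q'.V
  mapsTo : MapsTo b Q'.V Q.V
  eq : ∀ z ∈ Q'.V, Q'.ψ z = Q.ψ (b z)

/-- The space `ℝⁿ × ℂᵐ` of coordinates on products `M × X(ℂ)`. -/
abbrev Crd (n m : ℕ) : Type := (Fin n → ℝ) × (Fin m → ℂ)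

/-- The coordinate domain `U × V` of a pair of parametrisations. -/
def dom {M : CornerMfd} {X : Scheme.{0}} (P : MPlot M) (Q : XPlot X) : Set (Crd P.dim Q.dim) :=
  P.U ×ˢ Q.V

/-! ### Differential forms on `M × X(ℂ)` -/

/-- Families of (not necessarily smooth or compatible) complex valued `k`-forms, one on each
coordinate domain. For `k < 0` only the zero family will be used. -/
def RawForm (M : CornerMfd) (X : Scheme.{0}) (k : ℤ) : Type :=
  ∀ (P : MPlot M) (Q : XPlot X), Crd P.dim Q.dim → Crd P.dim Q.dim [⋀^Fin k.toNat]→L[ℝ] ℂ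

section

variable {M : CornerMfd} {X : Scheme.{0}} {k : ℤ}

instance : AddCommGroup (RawForm M X k) :=
  inferInstanceAs (AddCommGroup (∀ (P : MPlot M) (Q : XPlot X),
    Crd P.dim Q.dim → Crd P.dim Q.dim [⋀^Fin k.toNat]→L[ℝ] ℂ))

instance : Module ℝ (RawForm M X k) :=
  inferInstanceAs (Module ℝ (∀ (P : MPlot M) (Q : XPlot X),
    Crd P.dim Q.dim → Crd P.dim Q.dim [⋀^Fin k.toNat]→L[ℝ] ℂ))

theorem RawForm.add_apply (α β : RawForm M X k) (P : MPlot M) (Q : XPlot X)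
    (z : Crd P.dim Q.dim) : (α + β) P Q z = α P Q z + β P Q z := rfl

theorem RawForm.smul_apply (c : ℝ) (α : RawForm M X k) (P : MPlot M) (Q : XPlot X)
    (z : Crd P.dim Q.dim) : (c • α) P Q z = c • α P Q z := rfl

theorem RawForm.zero_apply (P : MPlot M) (Q : XPlot X) (z : Crd P.dim Q.dim) :
    (0 : RawForm M X k) P Q z = 0 := rfl

end

/-- The smooth compatible families of forms, see `Form`. -/
def formSubmodule (M : CornerMfd) (X : Scheme.{0}) (k : ℤ) : Submodule ℝ (RawForm M X k) where
  carrier := {α | (k < 0 → α = 0) ∧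
    (∀ P Q, ContDiffOn ℝ ∞ (α P Q) (dom P Q)) ∧
    (∀ P Q, ∀ z ∉ dom P Q, α P Q z = 0) ∧
    ∀ P' P a Q' Q b, MPlot.IsReparam P' P a → XPlot.IsReparam Q' Q b → ∀ z ∈ dom P' Q',
      α P' Q' z = (α P Q (Prod.map a b z)).compContinuousLinearMap
        (fderivWithin ℝ (Prod.map a b) (dom P' Q') z)}
  add_mem' := by
    rintro α η ⟨h1, h2, h3, h4⟩ ⟨g1, g2, g3, g4⟩
    refine ⟨fun hk => by rw [h1 hk, g1 hk, add_zero], fun P Q => (h2 P Q).add (g2 P Q),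
      fun P Q z hz => ?_, fun P' P a Q' Q b ha hb z hz => ?_⟩
    · rw [RawForm.add_apply, h3 P Q z hz, g3 P Q z hz, add_zero]
    · rw [RawForm.add_apply, h4 P' P a Q' Q b ha hb z hz, g4 P' P a Q' Q b ha hb z hz]
      rfl
  zero_mem' := ⟨fun _ => rfl, fun _ _ => contDiffOn_const, fun _ _ _ _ => rfl,
    fun _ _ _ _ _ _ _ _ _ _ => rfl⟩
  smul_mem' := by
    rintro c α ⟨h1, h2, h3, h4⟩
    refine ⟨fun hk => by rw [h1 hk, smul_zero], fun P Q => (h2 P Q).const_smul c,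
      fun P Q z hz => ?_, fun P' P a Q' Q b ha hb z hz => ?_⟩
    · rw [RawForm.smul_apply, h3 P Q z hz]
      ext v
      simp
    · rw [RawForm.smul_apply, h4 P' P a Q' Q b ha hb z hz]
      rfl

/-- The space `A^k(M × X)` of smooth complex valued differential forms of degree `k ∈ ℤ` on
`M × X(ℂ)`.  A form is given by its expressions in all local coordinates: for parametrisations
`φ : U → M` and `ψ : V → X(ℂ)` a smooth form on `U × V ⊆ ℝⁿ × ℂᵐ` (extended by zero), namely the
pull-back of the form along `φ × ψ`, such that these expressions are compatible with all changes of
coordinates. -/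
def Form (M : CornerMfd) (X : Scheme.{0}) (k : ℤ) : Type := formSubmodule M X k

section

variable {M : CornerMfd} {X : Scheme.{0}} {k : ℤ}

instance : AddCommGroup (Form M X k) := inferInstanceAs (AddCommGroup (formSubmodule M X k))

instance : Module ℝ (Form M X k) := inferInstanceAs (Module ℝ (formSubmodule M X k))

end

theorem uniqueDiffOn_dom {M : CornerMfd} {X : Scheme.{0}} (P : MPlot M) (Q : XPlot X) :
    UniqueDiffOn ℝ (dom P Q) :=
  (uniqueDiffOn_convex P.convex P.nonempty_interior).prod Q.isOpen.uniqueDiffOn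

theorem dom_subset {M : CornerMfd} {X : Scheme.{0}} (P : MPlot M) (Q : XPlot X) :
    dom P Q ⊆ closure (interior (dom P Q)) := by
  rw [dom, interior_prod_eq, closure_prod_eq, Q.isOpen.interior_eq,
    P.convex.closure_interior_eq_closure_of_nonempty_interior P.nonempty_interior]
  exact prod_mono subset_closure subset_closure

section

variable {E F : Type} [NormedAddCommGroup E] [NormedSpace ℝ E] [NormedAddCommGroup F]
  [NormedSpace ℝ F]

/-- Transport of alternating maps along an equality of degrees. -/
def castDeg {a b : ℕ} (h : a = b) (α : E [⋀^Fin a]→L[ℝ] ℂ) : E [⋀^Fin b]→L[ℝ] ℂ :=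
  h ▸ α

/-- The exterior derivative on `s ⊆ E` of the `a`-form `α`, regarded as a `b`-form
for `b = a + 1` (and zero if `b ≠ a + 1`). -/
def extD (s : Set E) {a : ℕ} (b : ℕ) (α : E → E [⋀^Fin a]→L[ℝ] ℂ) (z : E) :
    E [⋀^Fin b]→L[ℝ] ℂ :=
  if h : a + 1 = b then castDeg h (extDerivWithin α s z) else 0

theorem two_le_smooth : minSmoothness ℝ 2 ≤ (∞ : WithTop ℕ∞) := by
  rw [minSmoothness_of_isRCLikeNormedField]
  exact WithTop.coe_le_coe.2 le_top

theorem extD_self (s : Set E) {a : ℕ} (α : E → E [⋀^Fin a]→L[ℝ] ℂ) (z : E) :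
    extD s (a + 1) α z = extDerivWithin α s z := by
  simp [extD, castDeg]

theorem extD_congr {s : Set E} {a : ℕ} (b : ℕ) {α β : E → E [⋀^Fin a]→L[ℝ] ℂ}
    (h : EqOn α β s) {z : E} (hz : z ∈ s) : extD s b α z = extD s b β z := by
  simp only [extD, extDerivWithin_congr' h hz]

theorem extD_add {s : Set E} {a : ℕ} (b : ℕ) {α β : E → E [⋀^Fin a]→L[ℝ] ℂ} {z : E}
    (hs : UniqueDiffWithinAt ℝ s z) (hα : DifferentiableWithinAt ℝ α s z)
    (hβ : DifferentiableWithinAt ℝ β s z) :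
    extD s b (α + β) z = extD s b α z + extD s b β z := by
  by_cases h : a + 1 = b
  · subst h
    simp only [extD_self, extDerivWithin_add hs hα hβ]
  · simp [extD, h]

theorem extD_smul {s : Set E} {a : ℕ} (b : ℕ) {α : E → E [⋀^Fin a]→L[ℝ] ℂ} {z : E} (c : ℝ)
    (hs : UniqueDiffWithinAt ℝ s z) : extD s b (c • α) z = c • extD s b α z := by
  by_cases h : a + 1 = b
  · subst h
    simp only [extD_self, extDerivWithin_smul c α hs]
  · simp only [extD, h, dite_false]
    ext v; simp

theorem extD_zero {s : Set E} {a : ℕ} (b : ℕ) (z : E) :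
    extD s b (0 : E → E [⋀^Fin a]→L[ℝ] ℂ) z = 0 := by
  by_cases h : a + 1 = b
  · subst h
    rw [extD_self, extDerivWithin, show fderivWithin ℝ (0 : E → E [⋀^Fin a]→L[ℝ] ℂ) s z = 0 from
      fderivWithin_const_apply 0]
    exact (ContinuousAlternatingMap.alternatizeUncurryFinCLM ℝ E ℂ (n := a)).map_zero
  · simp [extD, h]

theorem extD_contDiffOn {s : Set E} {a : ℕ} (b : ℕ) {α : E → E [⋀^Fin a]→L[ℝ] ℂ}
    (hα : ContDiffOn ℝ ∞ α s) (hs : UniqueDiffOn ℝ s) : ContDiffOn ℝ ∞ (extD s b α) s := by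
  by_cases h : a + 1 = b
  · subst h
    have h1 : ContDiffOn ℝ ∞ (fderivWithin ℝ α s) s := hα.fderivWithin hs (by simp)
    have h2 := (ContinuousAlternatingMap.alternatizeUncurryFinCLM ℝ E ℂ
      (n := a)).contDiff.comp_contDiffOn h1
    exact h2.congr fun z _ => extD_self s α z
  · have : extD s b α = 0 := by
      funext z; simp [extD, h]
    rw [this]
    exact contDiffOn_const

theorem extD_extD {s : Set E} {a : ℕ} (b c : ℕ) {α : E → E [⋀^Fin a]→L[ℝ] ℂ}
    (hα : ContDiffOn ℝ ∞ α s) (hs : UniqueDiffOn ℝ s) (hcl : s ⊆ closure (interior s))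
    {z : E} (hz : z ∈ s) : extD s c (extD s b α) z = 0 := by
  by_cases h : a + 1 = b
  · subst h
    by_cases h : a + 1 + 1 = c
    · subst h
      rw [extD_congr (β := extDerivWithin α s) _ (fun z _ => extD_self s α z) hz, extD_self]
      exact extDerivWithin_extDerivWithin_eqOn hα two_le_smooth hs
        ⟨hz, hcl hz⟩
    · simp [extD, h]
  · have : extD s b α = 0 := by
      funext z; simp [extD, h]
    rw [this, extD_zero]

theorem extD_pullback {s : Set E} {t : Set F} {a : ℕ} (b : ℕ) {α : F → F [⋀^Fin a]→L[ℝ] ℂ}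
    {f : E → F} (hα : ContDiffOn ℝ ∞ α t) (hf : ContDiffOn ℝ ∞ f s) (hs : UniqueDiffOn ℝ s)
    (hcl : s ⊆ closure (interior s)) (hst : MapsTo f s t) {z : E} (hz : z ∈ s) :
    extD s b (fun x => (α (f x)).compContinuousLinearMap (fderivWithin ℝ f s x)) z =
      (extD t b α (f z)).compContinuousLinearMap (fderivWithin ℝ f s z) := by
  by_cases h : a + 1 = b
  · subst h
    simp only [extD_self]
    exact extDerivWithin_pullback ((hα.differentiableOn (by simp)) _ (hst hz)) (hf z hz)
      two_le_smooth hs (hcl hz) hz hst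
  · simp only [extD, h, dite_false]
    rfl

end

theorem contDiffOn_prodMap {M : CornerMfd} {X : Scheme.{0}} {P' P : MPlot M} {Q' Q : XPlot X}
    {a : (Fin P'.dim → ℝ) → (Fin P.dim → ℝ)} {b : (Fin Q'.dim → ℂ) → (Fin Q.dim → ℂ)}
    (ha : P'.IsReparam P a) (hb : Q'.IsReparam Q b) :
    ContDiffOn ℝ ∞ (Prod.map a b) (dom P' Q') :=
  ha.smooth.prodMap ((hb.holomorphic.contDiffOn (n := ∞)
    Q'.isOpen.uniqueDiffOn).restrict_scalars ℝ)

theorem mapsTo_prodMap {M : CornerMfd} {X : Scheme.{0}} {P' P : MPlot M} {Q' Q : XPlot X}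
    {a : (Fin P'.dim → ℝ) → (Fin P.dim → ℝ)} {b : (Fin Q'.dim → ℂ) → (Fin Q.dim → ℂ)}
    (ha : P'.IsReparam P a) (hb : Q'.IsReparam Q b) :
    MapsTo (Prod.map a b) (dom P' Q') (dom P Q) :=
  fun _ hz => ⟨ha.mapsTo hz.1, hb.mapsTo hz.2⟩

variable {M N : CornerMfd} {X Y : Scheme.{0}}

/-- The exterior differential `d : A^k(M × X) → A^l(M × X)` for `l = k + 1` (and zero if
`l ≠ k + 1`), computed in local coordinates. -/
def Form.d (k l : ℤ) : Form M X k →ₗ[ℝ] Form M X l where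
  toFun α := ⟨fun P Q => (dom P Q).indicator (extD (dom P Q) l.toNat (α.1 P Q)), by
    obtain ⟨-, h2, -, h4⟩ := α.2
    refine ⟨fun hl => ?_, fun P Q => ?_, fun P Q z hz => ?_, fun P' P a Q' Q b ha hb z hz => ?_⟩
    · funext P Q z
      have : k.toNat + 1 ≠ l.toNat := by omega
      change (dom P Q).indicator (extD (dom P Q) l.toNat (α.1 P Q)) z = 0
      simp [extD, this, indicator]
    · exact (extD_contDiffOn _ (h2 P Q) (uniqueDiffOn_dom P Q)).congr
        fun z hz => indicator_of_mem hz _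
    · exact indicator_of_notMem hz _
    · beta_reduce
      rw [indicator_of_mem hz, indicator_of_mem (mapsTo_prodMap ha hb hz),
        ← extD_pullback _ (h2 P Q) (contDiffOn_prodMap ha hb) (uniqueDiffOn_dom P' Q')
          (dom_subset P' Q') (mapsTo_prodMap ha hb) hz]
      exact extD_congr _ (fun z hz => h4 P' P a Q' Q b ha hb z hz) hz⟩
  map_add' α β := by
    refine Subtype.ext (funext fun P => funext fun Q => funext fun z => ?_)
    by_cases hz : z ∈ dom P Q
    · have hα := (α.2.2.1 P Q).differentiableOn (by simp) z hz
      have hβ := (β.2.2.1 P Q).differentiableOn (by simp) z hz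
      change (dom P Q).indicator (extD (dom P Q) l.toNat (α.1 P Q + β.1 P Q)) z =
        (dom P Q).indicator (extD (dom P Q) l.toNat (α.1 P Q)) z +
          (dom P Q).indicator (extD (dom P Q) l.toNat (β.1 P Q)) z
      rw [indicator_of_mem hz, indicator_of_mem hz, indicator_of_mem hz]
      exact extD_add _ (uniqueDiffOn_dom P Q z hz) hα hβ
    · change (dom P Q).indicator (extD (dom P Q) l.toNat (α.1 P Q + β.1 P Q)) z =
        (dom P Q).indicator (extD (dom P Q) l.toNat (α.1 P Q)) z +
          (dom P Q).indicator (extD (dom P Q) l.toNat (β.1 P Q)) z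
      rw [indicator_of_notMem hz, indicator_of_notMem hz, indicator_of_notMem hz, add_zero]
  map_smul' c α := by
    refine Subtype.ext (funext fun P => funext fun Q => funext fun z => ?_)
    by_cases hz : z ∈ dom P Q
    · change (dom P Q).indicator (extD (dom P Q) l.toNat (c • α.1 P Q)) z =
        c • (dom P Q).indicator (extD (dom P Q) l.toNat (α.1 P Q)) z
      rw [indicator_of_mem hz, indicator_of_mem hz]
      exact extD_smul _ c (uniqueDiffOn_dom P Q z hz)
    · change (dom P Q).indicator (extD (dom P Q) l.toNat (c • α.1 P Q)) z =
        c • (dom P Q).indicator (extD (dom P Q) l.toNat (α.1 P Q)) z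
      rw [indicator_of_notMem hz, indicator_of_notMem hz]
      ext v; simp

theorem Form.d_d (k l m : ℤ) (α : Form M X k) : Form.d l m (Form.d k l α) = 0 := by
  refine Subtype.ext (funext fun P => funext fun Q => funext fun z => ?_)
  by_cases hz : z ∈ dom P Q
  · have : EqOn ((dom P Q).indicator (extD (dom P Q) l.toNat (α.1 P Q)))
      (extD (dom P Q) l.toNat (α.1 P Q)) (dom P Q) := fun z hz => indicator_of_mem hz _
    change (dom P Q).indicator (extD (dom P Q) m.toNat
      ((dom P Q).indicator (extD (dom P Q) l.toNat (α.1 P Q)))) z = 0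
    rw [indicator_of_mem hz, extD_congr _ this hz,
      extD_extD _ _ (α.2.2.1 P Q) (uniqueDiffOn_dom P Q) (dom_subset P Q) hz]
  · exact indicator_of_notMem hz _

theorem Form.d_shape {k l : ℤ} (h : k + 1 ≠ l) : Form.d k l = (0 : Form M X k →ₗ[ℝ] _) := by
  refine LinearMap.ext fun α => Subtype.ext (funext fun P => funext fun Q => funext fun z => ?_)
  by_cases hz : z ∈ dom P Q
  · change (dom P Q).indicator (extD (dom P Q) l.toNat (α.1 P Q)) z = 0
    rw [indicator_of_mem hz]
    by_cases hk : k < 0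
    · rw [α.2.1 hk]
      exact extD_zero _ _
    · have : k.toNat + 1 ≠ l.toNat := by omega
      simp [extD, this]
  · exact indicator_of_notMem hz _

/-- The pull-back of forms along `f × g(ℂ) : M × X(ℂ) → N × Y(ℂ)`. -/
def Form.pull (f : SmoothMap M N) (g : X ⟶ Y) (k : ℤ) : Form N Y k →ₗ[ℝ] Form M X k where
  toFun α := ⟨fun P Q => α.1 (P.map f) (Q.map g),
    fun hk => by rw [α.2.1 hk]; rfl,
    fun P Q => α.2.2.1 (P.map f) (Q.map g),
    fun P Q => α.2.2.2.1 (P.map f) (Q.map g),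
    fun P' P a Q' Q b ha hb => α.2.2.2.2 (P'.map f) (P.map f) a (Q'.map g) (Q.map g) b
      ⟨ha.smooth, ha.mapsTo, fun u hu => congrArg f.toFun (ha.eq u hu)⟩
      ⟨hb.holomorphic, hb.mapsTo, fun z hz => congrArg (· ≫ g) (hb.eq z hz)⟩⟩
  map_add' _ _ := rfl
  map_smul' _ _ := rfl

theorem Form.d_pull (f : SmoothMap M N) (g : X ⟶ Y) (k l : ℤ) (α : Form N Y k) :
    Form.d k l (Form.pull f g k α) = Form.pull f g l (Form.d k l α) := rfl

/-! ### Real structure, Hodge filtration and Galois action -/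

/-- The real covectors `dx_i` and the complex valued covectors `dz_j`, `d\bar z_j` on
`ℝⁿ × ℂᵐ`, in this order. -/
def covector {n m : ℕ} : Fin n ⊕ Fin m ⊕ Fin m → Crd n m → ℂ
  | .inl i, v => (v.1 i : ℂ)
  | .inr (.inl j), v => v.2 j
  | .inr (.inr j), v => star (v.2 j)

/-- The wedge product of the `k` covectors `covector (c 0), …, covector (c (k - 1))`. -/
def monomialForm {n m k : ℕ} (c : Fin k → Fin n ⊕ Fin m ⊕ Fin m) (v : Fin k → Crd n m) : ℂ :=
  Matrix.det (Matrix.of fun i j => covector (c i) (v j))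

/-- The number of factors of the form `dz_j` in a wedge product of covectors. -/
def holDegree {n m k : ℕ} (c : Fin k → Fin n ⊕ Fin m ⊕ Fin m) : ℕ :=
  Nat.card {i : Fin k // ∃ j, c i = .inr (.inl j)}

/-- The complex span of the forms `dx^I ∧ dz^J ∧ d\bar z^K` with `|J| ≥ p` and
`|I| + |J| + |K| = k`, as functions of `k` vectors. -/
def hodgeSpan (n m p k : ℕ) : Submodule ℂ ((Fin k → Crd n m) → ℂ) :=
  Submodule.span ℂ {f | ∃ c : Fin k → Fin n ⊕ Fin m ⊕ Fin m, p ≤ holDegree c ∧ f = monomialForm c}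

/-- The alternating `k`-forms on `ℝⁿ × ℂᵐ` in the `p`-th step of the Hodge filtration. -/
def hodgeAt (n m p k : ℕ) : Submodule ℝ (Crd n m [⋀^Fin k]→L[ℝ] ℂ) where
  carrier := {α | (fun v => α v) ∈ hodgeSpan n m p k}
  add_mem' ha hb := (hodgeSpan n m p k).add_mem ha hb
  zero_mem' := (hodgeSpan n m p k).zero_mem
  smul_mem' r _ ha := (hodgeSpan n m p k).smul_mem (r : ℂ) ha

/-- The alternating `k`-forms with values in the real line `c ℝ ⊆ ℂ`. -/
def realAt (E : Type) [NormedAddCommGroup E] [NormedSpace ℝ E] (c : ℂ) (k : ℕ) :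
    Submodule ℝ (E [⋀^Fin k]→L[ℝ] ℂ) where
  carrier := {α | ∀ v, ∃ r : ℝ, α v = c * r}
  add_mem' {α β} ha hb v := by
    obtain ⟨r, hr⟩ := ha v
    obtain ⟨t, ht⟩ := hb v
    exact ⟨r + t, by simp [hr, ht]; ring⟩
  zero_mem' v := ⟨0, by simp⟩
  smul_mem' t α ha v := by
    obtain ⟨r, hr⟩ := ha v
    exact ⟨t * r, by simp [hr]; ring⟩

theorem finite_alternating (E : Type) [NormedAddCommGroup E] [NormedSpace ℝ E]
    [FiniteDimensional ℝ E] (k : ℕ) : FiniteDimensional ℝ (E [⋀^Fin k]→L[ℝ] ℂ) := by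
  let f : (E [⋀^Fin k]→L[ℝ] ℂ) →ₗ[ℝ] MultilinearMap ℝ (fun _ : Fin k => E) ℂ :=
    { toFun := fun α => α.toAlternatingMap.toMultilinearMap
      map_add' := fun _ _ => rfl
      map_smul' := fun _ _ => rfl }
  refine FiniteDimensional.of_injective f fun α β h => ?_
  ext v
  exact congrArg (fun g : MultilinearMap ℝ (fun _ : Fin k => E) ℂ => g v) h

theorem fderivWithin_mem {E F : Type} [NormedAddCommGroup E] [NormedSpace ℝ E]
    [NormedAddCommGroup F] [NormedSpace ℝ F] [FiniteDimensional ℝ F] (S : Submodule ℝ F)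
    {s : Set E} {f : E → F} {z : E} (hs : UniqueDiffWithinAt ℝ s z)
    (hf : DifferentiableWithinAt ℝ f s z) (hz : z ∈ s) (h : ∀ x ∈ s, f x ∈ S) (w : E) :
    fderivWithin ℝ f s z w ∈ S := by
  obtain ⟨T, hT⟩ := S.exists_isCompl
  let g : F →L[ℝ] T := LinearMap.toContinuousLinearMap (T.projectionOnto S hT.symm)
  have hg (x : F) : g x = 0 ↔ x ∈ S := by
    have : g x = 0 ↔ x ∈ LinearMap.ker (T.projectionOnto S hT.symm) := Iff.rfl
    rw [this, Submodule.ker_projectionOnto]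
  have h0 : fderivWithin ℝ (fun x => g (f x)) s z = 0 := by
    rw [fderivWithin_congr (f := fun _ => (0 : T)) (fun x hx => (hg _).2 (h x hx))
      ((hg _).2 (h z hz))]
    exact fderivWithin_const_apply 0
  have h1 := (g.hasFDerivAt.comp_hasFDerivWithinAt z hf.hasFDerivWithinAt).fderivWithin hs
  rw [← hg]
  exact (congrArg (fun T => T w) (h1.symm.trans h0) :)

theorem alternatize_hodge {n m p k : ℕ} (L : Crd n m →L[ℝ] Crd n m [⋀^Fin k]→L[ℝ] ℂ)
    (h : ∀ w, L w ∈ hodgeAt n m p k) :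
    ContinuousAlternatingMap.alternatizeUncurryFin L ∈ hodgeAt n m p (k + 1) := by
  classical
  let T (s : Fin n ⊕ Fin m ⊕ Fin m) :
      ((Fin k → Crd n m) → ℂ) →ₗ[ℂ] ((Fin (k + 1) → Crd n m) → ℂ) :=
    { toFun := fun f v => ∑ i : Fin (k + 1), (-1) ^ (i : ℕ) * covector s (v i) * f (i.removeNth v)
      map_add' := fun f g => by ext v; simp [mul_add, Finset.sum_add_distrib]
      map_smul' := fun c f => by ext v; simp [Finset.mul_sum]; congr; ext; ring }
  have hT (s) (f) (hf : f ∈ hodgeSpan n m p k) : T s f ∈ hodgeSpan n m p (k + 1) := by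
    have : (hodgeSpan n m p k).map (T s) ≤ hodgeSpan n m p (k + 1) := by
      rw [hodgeSpan, Submodule.map_span, Submodule.span_le]
      rintro _ ⟨_, ⟨c, hc, rfl⟩, rfl⟩
      refine Submodule.subset_span ⟨Fin.cons s c, hc.trans ?_, ?_⟩
      · refine Nat.card_le_card_of_injective
          (fun i => ⟨i.1.succ, by simpa using i.2⟩) fun i j hij => ?_
        simpa [Subtype.ext_iff] using hij
      · funext v
        simp only [T, LinearMap.coe_mk, AddHom.coe_mk, monomialForm, Matrix.det_succ_row_zero]
        rfl
    exact this ⟨f, hf, rfl⟩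
  let b (w : Crd n m) : (Fin k → Crd n m) → ℂ := fun u => L w u
  have hb (w) : b w ∈ hodgeSpan n m p k := h w
  let e (i : Fin n) : Crd n m := (Pi.single i 1, 0)
  let e₁ (j : Fin m) : Crd n m := (0, Pi.single j 1)
  let e₂ (j : Fin m) : Crd n m := (0, Pi.single j Complex.I)
  let β : Fin n ⊕ Fin m ⊕ Fin m → ((Fin k → Crd n m) → ℂ)
    | .inl i => b (e i)
    | .inr (.inl j) => (1 / 2 : ℂ) • (b (e₁ j) - Complex.I • b (e₂ j))
    | .inr (.inr j) => (1 / 2 : ℂ) • (b (e₁ j) + Complex.I • b (e₂ j))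
  have hβ (s) : β s ∈ hodgeSpan n m p k := by
    rcases s with i | j | j
    · exact hb _
    · exact Submodule.smul_mem _ _ (Submodule.sub_mem _ (hb _) (Submodule.smul_mem _ _ (hb _)))
    · exact Submodule.smul_mem _ _ (Submodule.add_mem _ (hb _) (Submodule.smul_mem _ _ (hb _)))
  have hw (w : Crd n m) : w = ∑ i, w.1 i • e i +
      ∑ j, ((w.2 j).re • e₁ j + (w.2 j).im • e₂ j) := by
    refine Prod.ext ?_ ?_
    · ext i
      simp [e, e₁, e₂, Prod.fst_sum, Finset.sum_apply, Pi.single_apply]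
    · ext j
      simp [e, e₁, e₂, Prod.snd_sum, Finset.sum_apply, Pi.single_apply, Finset.sum_add_distrib]
  have hL (w : Crd n m) (u) : L w u = ∑ s, covector s w * β s u := by
    conv_lhs => rw [hw w]
    simp only [map_add, map_sum, map_smul, Fintype.sum_sum_type, covector, β, b, Pi.smul_apply,
      Pi.sub_apply, Pi.add_apply, smul_eq_mul]
    simp only [ContinuousAlternatingMap.add_apply, ContinuousAlternatingMap.sum_apply,
      ContinuousAlternatingMap.smul_apply, Complex.real_smul]
    congr 1
    rw [← Finset.sum_add_distrib]
    refine Finset.sum_congr rfl fun j _ => ?_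
    have h1 : star (w.2 j) = (w.2 j).re - (w.2 j).im * Complex.I := by
      apply Complex.ext <;> simp
    conv_rhs => rw [h1]
    have h2 : w.2 j = (w.2 j).re + (w.2 j).im * Complex.I := (Complex.re_add_im _).symm
    set x := (w.2 j).re
    set y := (w.2 j).im
    rw [h2]
    ring_nf
    simp
  have : (fun v => ContinuousAlternatingMap.alternatizeUncurryFin L v) = ∑ s, T s (β s) := by
    funext v
    simp only [ContinuousAlternatingMap.alternatizeUncurryFin_apply, hL, Finset.sum_apply, T,
      LinearMap.coe_mk, AddHom.coe_mk]
    rw [Finset.sum_comm]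
    refine Finset.sum_congr rfl fun i _ => ?_
    rw [Finset.smul_sum]
    refine Finset.sum_congr rfl fun s _ => ?_
    simp [mul_assoc]
  change (fun v => ContinuousAlternatingMap.alternatizeUncurryFin L v) ∈ hodgeSpan n m p (k + 1)
  rw [this]
  exact Submodule.sum_mem _ fun s _ => hT s _ (hβ s)

theorem extD_hodge {n m p a : ℕ} (b : ℕ) {s : Set (Crd n m)} (hs : UniqueDiffOn ℝ s)
    {α : Crd n m → Crd n m [⋀^Fin a]→L[ℝ] ℂ} (hα : ContDiffOn ℝ ∞ α s)
    (h : ∀ z ∈ s, α z ∈ hodgeAt n m p a) {z : Crd n m} (hz : z ∈ s) :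
    extD s b α z ∈ hodgeAt n m p b := by
  by_cases hb : a + 1 = b
  · subst hb
    have := finite_alternating (Crd n m) a
    rw [extD_self]
    exact alternatize_hodge _ (fderivWithin_mem _ (hs z hz)
      (hα.differentiableOn (by simp) z hz) hz h)
  · simp only [extD, hb, dite_false]
    exact Submodule.zero_mem _

theorem extD_real {n m a : ℕ} (b : ℕ) (c : ℂ) {s : Set (Crd n m)} (hs : UniqueDiffOn ℝ s)
    {α : Crd n m → Crd n m [⋀^Fin a]→L[ℝ] ℂ} (hα : ContDiffOn ℝ ∞ α s)
    (h : ∀ z ∈ s, α z ∈ realAt _ c a) {z : Crd n m} (hz : z ∈ s) :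
    extD s b α z ∈ realAt _ c b := by
  by_cases hb : a + 1 = b
  · subst hb
    have := finite_alternating (Crd n m) a
    rw [extD_self]
    intro v
    choose r hr using fun i => fderivWithin_mem _ (hs z hz)
      (hα.differentiableOn (by simp) z hz) hz h (v i) (i.removeNth v)
    refine ⟨∑ i : Fin (a + 1), (-1) ^ (i : ℕ) * r i, ?_⟩
    rw [extDerivWithin, ContinuousAlternatingMap.alternatizeUncurryFin_apply]
    simp only [hr]
    push_cast
    rw [Finset.mul_sum]
    refine Finset.sum_congr rfl fun i _ => ?_
    simp
    ring
  · simp only [extD, hb, dite_false]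
    exact Submodule.zero_mem _

/-- Complex conjugation of the holomorphic coordinates, `(x, z) ↦ (x, \bar z)`. -/
def conjCrd (n m : ℕ) : Crd n m ≃L[ℝ] Crd n m :=
  (ContinuousLinearEquiv.refl ℝ (Fin n → ℝ)).prodCongr (starL' ℝ)

/-- The action of complex conjugation, the generator of `Gal(ℂ/ℝ)`, on forms on `M × X(ℂ)`:
the form `α` is sent to the complex conjugate of its pull-back along the conjugation
`id × conj : M × X(ℂ) → M × X(ℂ)`. -/
def galois {k : ℤ} (α : RawForm M X k) : RawForm M X k := fun P Q z =>
  (Complex.conjCLE : ℂ →L[ℝ] ℂ).compContinuousAlternatingMap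
    ((α P Q.conj (conjCrd _ _ z)).compContinuousLinearMap (conjCrd P.dim Q.dim : _ →L[ℝ] _))

theorem galois_add {k : ℤ} (α β : RawForm M X k) : galois (α + β) = galois α + galois β := by
  funext P Q z
  ext v
  exact map_add (starRingEnd ℂ) _ _

theorem galois_smul {k : ℤ} (c : ℝ) (α : RawForm M X k) : galois (c • α) = c • galois α := by
  funext P Q z
  ext v
  exact map_smul Complex.conjCLE c _

theorem extD_conj {n m a : ℕ} (b : ℕ) {s t : Set (Crd n m)} (ht : t = conjCrd n m ⁻¹' s)
    {α β : Crd n m → Crd n m [⋀^Fin a]→L[ℝ] ℂ}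
    (hαβ : ∀ z, α z = (Complex.conjCLE : ℂ →L[ℝ] ℂ).compContinuousAlternatingMap
      ((β (conjCrd n m z)).compContinuousLinearMap (conjCrd n m : _ →L[ℝ] _)))
    (hs : UniqueDiffOn ℝ s) (hu : UniqueDiffOn ℝ t)
    (hα : ContDiffOn ℝ ∞ α t) (hβ : ContDiffOn ℝ ∞ β s) {z : Crd n m} (hz : z ∈ t) :
    extD t b α z = (Complex.conjCLE : ℂ →L[ℝ] ℂ).compContinuousAlternatingMap
      ((extD s b β (conjCrd n m z)).compContinuousLinearMap (conjCrd n m : _ →L[ℝ] _)) := by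
  subst ht
  by_cases hb : a + 1 = b
  · subst hb
    rw [extD_self, extD_self]
    ext v
    rw [extDerivWithin_apply (hα.differentiableOn (by simp) z hz) (hu z hz)]
    simp only [ContinuousLinearMap.compContinuousAlternatingMap_coe, Function.comp_apply,
      ContinuousAlternatingMap.compContinuousLinearMap_apply]
    rw [extDerivWithin_apply (hβ.differentiableOn (by simp) _ hz) (hs _ hz), map_sum]
    refine Finset.sum_congr rfl fun i _ => ?_
    have e : (fun x => α x (i.removeNth v)) = Complex.conjCLE ∘
        ((fun y => β y (i.removeNth (conjCrd n m ∘ v))) ∘ conjCrd n m) := by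
      funext x
      rw [hαβ]
      rfl
    rw [e, ContinuousLinearEquiv.comp_fderivWithin _ (hu z hz),
      ContinuousLinearEquiv.comp_right_fderivWithin _ (hu z hz)]
    simp
  · simp only [extD, hb, dite_false]
    ext v
    simp

theorem dom_conj (P : MPlot M) (Q : XPlot X) : dom P Q = conjCrd P.dim Q.dim ⁻¹' dom P Q.conj := by
  ext z
  simp [dom, conjCrd]

/-- The subspace `(2πi)^p A_ℝ` of forms with values in `(2πi)^p ℝ`. -/
def Form.real (M : CornerMfd) (X : Scheme.{0}) (p : ℕ) (k : ℤ) : Submodule ℝ (Form M X k) where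
  carrier := {α | ∀ P Q z, α.1 P Q z ∈ realAt _ ((2 * Real.pi * Complex.I) ^ p) _}
  add_mem' ha hb P Q z := Submodule.add_mem _ (ha P Q z) (hb P Q z)
  zero_mem' _ _ _ := Submodule.zero_mem _
  smul_mem' c _ ha P Q z := Submodule.smul_mem _ c (ha P Q z)

/-- The `p`-th step `F^p A` of the Hodge filtration: the forms which in local coordinates are linear
combinations of forms `dx^I ∧ dz^J ∧ d\bar z^K` with `|J| ≥ p`. -/
def Form.hodge (M : CornerMfd) (X : Scheme.{0}) (p : ℕ) (k : ℤ) : Submodule ℝ (Form M X k) where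
  carrier := {α | ∀ P Q z, α.1 P Q z ∈ hodgeAt _ _ p _}
  add_mem' ha hb P Q z := Submodule.add_mem _ (ha P Q z) (hb P Q z)
  zero_mem' _ _ _ := Submodule.zero_mem _
  smul_mem' c _ ha P Q z := Submodule.smul_mem _ c (ha P Q z)

/-- The forms which are invariant under `Gal(ℂ/ℝ)`. -/
def Form.invariants (M : CornerMfd) (X : Scheme.{0}) (k : ℤ) : Submodule ℝ (Form M X k) where
  carrier := {α | galois α.1 = α.1}
  add_mem' {α β} ha hb := by
    refine Eq.trans ?_ (congrArg₂ (· + ·) (show galois α.1 = α.1 from ha)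
      (show galois β.1 = β.1 from hb))
    exact galois_add α.1 β.1
  zero_mem' := by
    funext P Q z
    ext v
    exact map_zero (starRingEnd ℂ)
  smul_mem' c α ha := by
    refine Eq.trans ?_ (congrArg (c • ·) (show galois α.1 = α.1 from ha))
    exact galois_smul c α.1

theorem Form.d_real {p : ℕ} {k : ℤ} (l : ℤ) {α : Form M X k} (h : α ∈ Form.real M X p k) :
    Form.d k l α ∈ Form.real M X p l := by
  intro P Q z
  change (dom P Q).indicator _ z ∈ _
  by_cases hz : z ∈ dom P Q
  · rw [indicator_of_mem hz]
    exact extD_real _ _ (uniqueDiffOn_dom P Q) (α.2.2.1 P Q) (fun z _ => h P Q z) hz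
  · rw [indicator_of_notMem hz]
    exact Submodule.zero_mem _

theorem Form.d_hodge {p : ℕ} {k : ℤ} (l : ℤ) {α : Form M X k} (h : α ∈ Form.hodge M X p k) :
    Form.d k l α ∈ Form.hodge M X p l := by
  intro P Q z
  change (dom P Q).indicator _ z ∈ _
  by_cases hz : z ∈ dom P Q
  · rw [indicator_of_mem hz]
    exact extD_hodge _ (uniqueDiffOn_dom P Q) (α.2.2.1 P Q) (fun z _ => h P Q z) hz
  · rw [indicator_of_notMem hz]
    exact Submodule.zero_mem _

theorem Form.d_invariants {k : ℤ} (l : ℤ) {α : Form M X k} (h : α ∈ Form.invariants M X k) :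
    Form.d k l α ∈ Form.invariants M X l := by
  funext P Q z
  change (Complex.conjCLE : ℂ →L[ℝ] ℂ).compContinuousAlternatingMap
    (((dom P Q.conj).indicator (extD (dom P Q.conj) l.toNat (α.1 P Q.conj))
      (conjCrd _ _ z)).compContinuousLinearMap (conjCrd P.dim Q.dim : _ →L[ℝ] _)) =
    (dom P Q).indicator (extD (dom P Q) l.toNat (α.1 P Q)) z
  by_cases hz : z ∈ dom P Q
  · have hz' : conjCrd _ _ z ∈ dom P Q.conj := by
      rw [dom_conj] at hz
      exact hz
    rw [indicator_of_mem hz, indicator_of_mem hz']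
    exact (extD_conj l.toNat (dom_conj P Q)
      (fun z => (congrFun (congrFun (congrFun (show galois α.1 = α.1 from h) P) Q) z).symm)
      (uniqueDiffOn_dom P Q.conj) (uniqueDiffOn_dom P Q) (α.2.2.1 P Q) (α.2.2.1 P Q.conj) hz).symm
  · have hz' : conjCrd _ _ z ∉ dom P Q.conj := by
      rw [dom_conj] at hz
      exact hz
    rw [indicator_of_notMem hz, indicator_of_notMem hz']
    ext v
    simp

theorem XPlot.congr_ψ {T : ℕ → Type} (F : ∀ Q : XPlot X, T Q.dim) {m : ℕ} {V : Set (Fin m → ℂ)}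
    {h : IsOpen V} {ψ ψ' : (Fin m → ℂ) → CPoint X} (e : ψ = ψ') {h1 h2 h1' h2'} :
    F ⟨m, V, h, ψ, h1, h2⟩ = F ⟨m, V, h, ψ', h1', h2'⟩ := by
  subst e
  rfl

theorem Form.pull_real (f : SmoothMap M N) (g : X ⟶ Y) {p : ℕ} {k : ℤ} {α : Form N Y k}
    (h : α ∈ Form.real N Y p k) : Form.pull f g k α ∈ Form.real M X p k :=
  fun P Q z => h (P.map f) (Q.map g) z

theorem Form.pull_hodge (f : SmoothMap M N) (g : X ⟶ Y) {p : ℕ} {k : ℤ} {α : Form N Y k}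
    (h : α ∈ Form.hodge N Y p k) : Form.pull f g k α ∈ Form.hodge M X p k :=
  fun P Q z => h (P.map f) (Q.map g) z

theorem Form.pull_invariants (f : SmoothMap M N) (g : X ⟶ Y) {k : ℤ} {α : Form N Y k}
    (h : α ∈ Form.invariants N Y k) : Form.pull f g k α ∈ Form.invariants M X k := by
  funext P Q z
  have h1 := congrFun (congrFun (congrFun (show galois α.1 = α.1 from h) (P.map f)) (Q.map g)) z
  refine Eq.trans ?_ h1
  have h2 : α.1 (P.map f) (Q.conj.map g) = α.1 (P.map f) (Q.map g).conj :=
    XPlot.congr_ψ (T := fun m => Crd P.dim m → Crd P.dim m [⋀^Fin k.toNat]→L[ℝ] ℂ)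
      (fun Q => α.1 (P.map f) Q) (funext fun z => Category.assoc _ _ _)
  exact congrArg (fun β : Crd P.dim Q.dim → Crd P.dim Q.dim [⋀^Fin k.toNat]→L[ℝ] ℂ =>
    (Complex.conjCLE : ℂ →L[ℝ] ℂ).compContinuousAlternatingMap
      ((β (conjCrd _ _ z)).compContinuousLinearMap
        (conjCrd P.dim Q.dim : Crd P.dim Q.dim →L[ℝ] Crd P.dim Q.dim))) h2

theorem Form.pull_id {k : ℤ} (α : Form M X k) : Form.pull (SmoothMap.id M) (𝟙 X) k α = α := by
  refine Subtype.ext (funext fun P => funext fun Q => ?_)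
  exact XPlot.congr_ψ (T := fun m => Crd P.dim m → Crd P.dim m [⋀^Fin k.toNat]→L[ℝ] ℂ)
    (fun Q => α.1 P Q) (funext fun z => Category.comp_id _)

theorem Form.pull_pull {K : CornerMfd} {Z : Scheme.{0}} (f : SmoothMap M N) (g : X ⟶ Y)
    (f' : SmoothMap N K) (g' : Y ⟶ Z) {k : ℤ} (α : Form K Z k) :
    Form.pull f g k (Form.pull f' g' k α) = Form.pull (f.comp f') (g ≫ g') k α := by
  refine Subtype.ext (funext fun P => funext fun Q => ?_)
  exact XPlot.congr_ψ (T := fun m => Crd P.dim m → Crd P.dim m [⋀^Fin k.toNat]→L[ℝ] ℂ)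
    (fun Q => α.1 ((P.map f).map f') Q) (funext fun z => Category.assoc _ _ _)

/-- The restriction `α ↦ α|_{{s} × M × X}` of forms on `[0,1] × M × X(ℂ)`. -/
def Form.restrict (s : Icc (0 : ℝ) 1) (k : ℤ) : Form (cyl M) X k →ₗ[ℝ] Form M X k where
  toFun α := ⟨fun P Q => α.1 (P.map (slice s M)) Q,
    fun hk => by rw [α.2.1 hk]; rfl,
    fun P Q => α.2.2.1 (P.map (slice s M)) Q,
    fun P Q => α.2.2.2.1 (P.map (slice s M)) Q,
    fun P' P a Q' Q b ha hb => α.2.2.2.2 (P'.map (slice s M)) (P.map (slice s M)) a Q' Q b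
      ⟨ha.smooth, ha.mapsTo, fun u hu => congrArg (slice s M).toFun (ha.eq u hu)⟩ hb⟩
  map_add' _ _ := rfl
  map_smul' _ _ := rfl

theorem Form.restrict_d (s : Icc (0 : ℝ) 1) (k l : ℤ) (α : Form (cyl M) X k) :
    Form.restrict s l (Form.d k l α) = Form.d k l (Form.restrict s k α) := rfl

theorem Form.restrict_pull (s : Icc (0 : ℝ) 1) (f : SmoothMap M N) (g : X ⟶ Y) {k : ℤ}
    (α : Form (cyl N) Y k) :
    Form.restrict s k (Form.pull (cylMap f) g k α) = Form.pull f g k (Form.restrict s k α) := rfl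

theorem Form.pull_cyl_id {k : ℤ} (α : Form (cyl M) X k) :
    Form.pull (cylMap (SmoothMap.id M)) (𝟙 X) k α = α := Form.pull_id α

theorem Form.pull_cyl_pull {K : CornerMfd} {Z : Scheme.{0}} (f : SmoothMap M N) (g : X ⟶ Y)
    (f' : SmoothMap N K) (g' : Y ⟶ Z) {k : ℤ} (α : Form (cyl K) Z k) :
    Form.pull (cylMap f) g k (Form.pull (cylMap f') g' k α) =
      Form.pull (cylMap (f.comp f')) (g ≫ g') k α := Form.pull_pull _ _ _ _ α

/-! ### The complexes `IDR(p)` and `DR(p)` -/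

/-- The category of pairs `M × X` of a smooth manifold with corners and an arithmetic scheme. -/
abbrev Pairs : Type 1 := CornerMfd × ArithScheme

/-- The space `IDR(p)^n(M × X)`: the `Gal(ℂ/ℝ)`-invariant forms of degree `n + 2p` on
`[0,1] × M × X(ℂ)` whose restriction to `{0} × M × X(ℂ)` lies in `(2πi)^p A_ℝ` and whose restriction
to `{1} × M × X(ℂ)` lies in `F^p A`. -/
def idr (p : ℕ) (M : CornerMfd) (X : Scheme.{0}) (n : ℤ) :
    Submodule ℝ (Form (cyl M) X (n + 2 * p)) :=
  (Form.real M X p _).comap (Form.restrict 0 _) ⊓ (Form.hodge M X p _).comap (Form.restrict 1 _) ⊓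
    Form.invariants (cyl M) X _

theorem idr_d {p : ℕ} {i : ℤ} (j : ℤ) {α : Form (cyl M) X (i + 2 * p)} (h : α ∈ idr p M X i) :
    Form.d (i + 2 * p) (j + 2 * p) α ∈ idr p M X j :=
  ⟨⟨Form.d_real _ h.1.1, Form.d_hodge _ h.1.2⟩, Form.d_invariants _ h.2⟩

theorem idr_pull {p : ℕ} {i : ℤ} (f : SmoothMap M N) (g : X ⟶ Y)
    {α : Form (cyl N) Y (i + 2 * p)} (h : α ∈ idr p N Y i) :
    Form.pull (cylMap f) g _ α ∈ idr p M X i :=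
  ⟨⟨Form.pull_real f g h.1.1, Form.pull_hodge f g h.1.2⟩, Form.pull_invariants _ g h.2⟩

/-- The differential of `IDR(p)`, induced by the exterior differential. -/
def idrD (p : ℕ) (M : CornerMfd) (X : Scheme.{0}) (i j : ℤ) : idr p M X i →ₗ[ℝ] idr p M X j :=
  (Form.d (i + 2 * p) (j + 2 * p)).restrict fun _ h => idr_d j h

/-- The complex `IDR(p)(M × X) ⊆ A([0,1] × M × X)[2p]`. -/
def idrComplex (p : ℕ) (M : CornerMfd) (X : Scheme.{0}) : CochainComplex (ModuleCat.{0} ℝ) ℤ where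
  X n := ModuleCat.of ℝ (idr p M X n)
  d i j := ModuleCat.ofHom (idrD p M X i j)
  shape i j h := by
    refine ModuleCat.hom_ext (LinearMap.ext fun (α : idr p M X i) => Subtype.ext ?_)
    exact congrArg (fun L => L α.1) (Form.d_shape (M := cyl M) (X := X) (k := i + 2 * p)
      (l := j + 2 * p) (fun h' => h (show i + 1 = j by omega)))
  d_comp_d' i j k _ _ := by
    refine ModuleCat.hom_ext (LinearMap.ext fun (α : idr p M X i) => Subtype.ext ?_)
    exact Form.d_d _ _ _ α.1

/-- The map `IDR(p)^n(N × Y) → IDR(p)^n(M × X)` induced by `f × g`. -/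
def idrPull (p : ℕ) (f : SmoothMap M N) (g : X ⟶ Y) (n : ℤ) : idr p N Y n →ₗ[ℝ] idr p M X n :=
  (Form.pull (cylMap f) g (n + 2 * p)).restrict fun _ h => idr_pull f g h

/-- The presheaf of complexes `IDR(p)` on pairs `M × X`. -/
def IDRp (p : ℕ) : Pairsᵒᵖ ⥤ CochainComplex (ModuleCat.{0} ℝ) ℤ where
  obj Z := idrComplex p Z.unop.1 Z.unop.2.obj
  map f :=
    { f := fun n => ModuleCat.ofHom (idrPull p f.unop.1 f.unop.2.hom n)
      comm' := fun _ _ _ => rfl }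
  map_id Z := by
    refine HomologicalComplex.hom_ext _ _ fun n => ModuleCat.hom_ext (LinearMap.ext
      fun (α : idr p Z.unop.1 Z.unop.2.obj n) => Subtype.ext ?_)
    exact Form.pull_cyl_id α.1
  map_comp {Z _ _} f g := by
    refine HomologicalComplex.hom_ext _ _ fun n => ModuleCat.hom_ext (LinearMap.ext
      fun (α : idr p Z.unop.1 Z.unop.2.obj n) => Subtype.ext ?_)
    exact (Form.pull_cyl_pull g.unop.1 g.unop.2.hom f.unop.1 f.unop.2.hom α.1).symm

/-- Transport of forms along an equality of degrees (and zero for different degrees). -/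
def Form.cast (k l : ℤ) : Form M X k →ₗ[ℝ] Form M X l :=
  if h : k = l then h ▸ LinearMap.id else 0

theorem Form.cast_self (k : ℤ) (α : Form M X k) : Form.cast k k α = α := by
  simp [Form.cast]

theorem Form.cast_invariants {k : ℤ} (l : ℤ) {α : Form M X k} (h : α ∈ Form.invariants M X k) :
    Form.cast k l α ∈ Form.invariants M X l := by
  by_cases hkl : k = l
  · subst hkl
    rwa [Form.cast_self]
  · simp only [Form.cast, hkl, dite_false]
    exact Submodule.zero_mem _

theorem Form.pull_cast (f : SmoothMap M N) (g : X ⟶ Y) (k l : ℤ) (α : Form N Y k) :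
    Form.pull f g l (Form.cast k l α) = Form.cast k l (Form.pull f g k α) := by
  by_cases hkl : k = l
  · subst hkl
    rw [Form.cast_self, Form.cast_self]
  · simp [Form.cast, hkl]

theorem Form.d_cast {k k' l l' : ℤ} (hk : k = k') (hl : l = l') (α : Form M X k) :
    Form.d k' l' (Form.cast k k' α) = Form.cast l l' (Form.d k l α) := by
  subst hk hl
  rw [Form.cast_self, Form.cast_self]

/-- The space `DR(p)^n(M × X)`: the `Gal(ℂ/ℝ)`-invariant triples `(α ⊕ β, γ)` with
`α ∈ (2πi)^p A_ℝ^{n+2p}`, `β ∈ F^p A^{n+2p}` and `γ ∈ A^{n+2p-1}`. -/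
def dr (p : ℕ) (M : CornerMfd) (X : Scheme.{0}) (n : ℤ) :
    Submodule ℝ (Form M X (n + 2 * p) × Form M X (n + 2 * p) × Form M X (n + 2 * p - 1)) :=
  (Form.real M X p _ ⊓ Form.invariants M X _).prod
    ((Form.hodge M X p _ ⊓ Form.invariants M X _).prod (Form.invariants M X _))

/-- The map `(α ⊕ β, γ) ↦ (dα ⊕ dβ, α - β - dγ)`, see `drD`. -/
def coneD (p : ℕ) (M : CornerMfd) (X : Scheme.{0}) (i j : ℤ) :
    Form M X (i + 2 * p) × Form M X (i + 2 * p) × Form M X (i + 2 * p - 1) →ₗ[ℝ]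
      Form M X (j + 2 * p) × Form M X (j + 2 * p) × Form M X (j + 2 * p - 1) where
  toFun x := (Form.d _ _ x.1, Form.d _ _ x.2.1, Form.cast _ _ (x.1 - x.2.1) - Form.d _ _ x.2.2)
  map_add' x y := by
    refine Prod.ext (map_add _ _ _) (Prod.ext (map_add _ _ _) ?_)
    simp only [Prod.fst_add, Prod.snd_add, map_add, map_sub]
    abel
  map_smul' c x := by
    refine Prod.ext (map_smul _ _ _) (Prod.ext (map_smul _ _ _) ?_)
    simp only [Prod.smul_fst, Prod.smul_snd, map_smul, map_sub, RingHom.id_apply, smul_sub]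

theorem dr_d (p : ℕ) (i j : ℤ)
    (x : Form M X (i + 2 * p) × Form M X (i + 2 * p) × Form M X (i + 2 * p - 1))
    (h : x ∈ dr p M X i) : coneD p M X i j x ∈ dr p M X j := by
  obtain ⟨⟨h1, h2⟩, ⟨h3, h4⟩, h5⟩ := h
  exact ⟨⟨Form.d_real _ h1, Form.d_invariants _ h2⟩, ⟨Form.d_hodge _ h3, Form.d_invariants _ h4⟩,
    Submodule.sub_mem _ (Form.cast_invariants _ (Submodule.sub_mem _ h2 h4))
      (Form.d_invariants _ h5)⟩

/-- The differential `d(α ⊕ β, γ) = (dα ⊕ dβ, α - β - dγ)` of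
`Cone((2πi)^p A_ℝ ⊕ F^p A → A, α ⊕ β ↦ α - β)[2p - 1]`, from degree `i` to degree `j = i + 1`
(and zero if `j ≠ i + 1`). -/
def drD (p : ℕ) (M : CornerMfd) (X : Scheme.{0}) (i j : ℤ) : dr p M X i →ₗ[ℝ] dr p M X j :=
  (coneD p M X i j).restrict (dr_d p i j)

theorem coneD_shape (p : ℕ) {i j : ℤ} (h0 : ¬ i + 1 = j)
    (x : Form M X (i + 2 * p) × Form M X (i + 2 * p) × Form M X (i + 2 * p - 1)) :
    coneD p M X i j x = 0 := by
  have h1 : i + 2 * (p : ℤ) + 1 ≠ j + 2 * p := by omega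
  have h2 : i + 2 * (p : ℤ) - 1 + 1 ≠ j + 2 * p - 1 := by omega
  have h3 : i + 2 * (p : ℤ) ≠ j + 2 * p - 1 := by omega
  change (Form.d _ _ x.1, Form.d _ _ x.2.1, Form.cast _ _ (x.1 - x.2.1) - Form.d _ _ x.2.2) = 0
  rw [Form.d_shape h1, Form.d_shape h2, Form.cast, dif_neg h3]
  simp

theorem coneD_coneD (p : ℕ) {i j k : ℤ} (hij : i + 1 = j) (hjk : j + 1 = k)
    (x : Form M X (i + 2 * p) × Form M X (i + 2 * p) × Form M X (i + 2 * p - 1)) :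
    coneD p M X j k (coneD p M X i j x) = 0 := by
  refine Prod.ext (Form.d_d _ _ _ x.1) (Prod.ext (Form.d_d _ _ _ x.2.1) ?_)
  change Form.cast (j + 2 * p) (k + 2 * p - 1)
      (Form.d (i + 2 * p) (j + 2 * p) x.1 - Form.d (i + 2 * p) (j + 2 * p) x.2.1) -
    Form.d (j + 2 * p - 1) (k + 2 * p - 1) (Form.cast (i + 2 * p) (j + 2 * p - 1) (x.1 - x.2.1) -
      Form.d (i + 2 * p - 1) (j + 2 * p - 1) x.2.2) = 0
  rw [map_sub (Form.d (j + 2 * p - 1) (k + 2 * p - 1)), Form.d_d,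
    Form.d_cast (by omega : i + 2 * (p : ℤ) = j + 2 * p - 1)
      (by omega : j + 2 * (p : ℤ) = k + 2 * p - 1), map_sub (Form.d (i + 2 * p) (j + 2 * p))]
  simp

/-- The complex `DR(p)(M × X)`. -/
def drComplex (p : ℕ) (M : CornerMfd) (X : Scheme.{0}) : CochainComplex (ModuleCat.{0} ℝ) ℤ where
  X n := ModuleCat.of ℝ (dr p M X n)
  d i j := ModuleCat.ofHom (drD p M X i j)
  shape i j h := by
    refine ModuleCat.hom_ext (LinearMap.ext fun (x : dr p M X i) => Subtype.ext ?_)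
    exact coneD_shape p h x.1
  d_comp_d' i j k hij hjk := by
    refine ModuleCat.hom_ext (LinearMap.ext fun (x : dr p M X i) => Subtype.ext ?_)
    exact coneD_coneD p hij hjk x.1

/-- The pull-back of triples of forms along `f × g(ℂ)`. -/
def conePull (p : ℕ) (f : SmoothMap M N) (g : X ⟶ Y) (n : ℤ) :
    Form N Y (n + 2 * p) × Form N Y (n + 2 * p) × Form N Y (n + 2 * p - 1) →ₗ[ℝ]
      Form M X (n + 2 * p) × Form M X (n + 2 * p) × Form M X (n + 2 * p - 1) :=
  (Form.pull f g (n + 2 * p)).prodMap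
    ((Form.pull f g (n + 2 * p)).prodMap (Form.pull f g (n + 2 * p - 1)))

theorem dr_pull (p : ℕ) (f : SmoothMap M N) (g : X ⟶ Y) (n : ℤ)
    (x : Form N Y (n + 2 * p) × Form N Y (n + 2 * p) × Form N Y (n + 2 * p - 1))
    (h : x ∈ dr p N Y n) : conePull p f g n x ∈ dr p M X n := by
  obtain ⟨⟨h1, h2⟩, ⟨h3, h4⟩, h5⟩ := h
  exact ⟨⟨Form.pull_real _ _ h1, Form.pull_invariants _ _ h2⟩,
    ⟨Form.pull_hodge _ _ h3, Form.pull_invariants _ _ h4⟩, Form.pull_invariants _ _ h5⟩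

theorem coneD_pull (p : ℕ) (f : SmoothMap M N) (g : X ⟶ Y) (i j : ℤ)
    (x : Form N Y (i + 2 * p) × Form N Y (i + 2 * p) × Form N Y (i + 2 * p - 1)) :
    coneD p M X i j (conePull p f g i x) = conePull p f g j (coneD p N Y i j x) := by
  refine Prod.ext rfl (Prod.ext rfl ?_)
  change Form.cast _ _ (Form.pull f g _ x.1 - Form.pull f g _ x.2.1) -
    Form.d _ _ (Form.pull f g _ x.2.2) =
    Form.pull f g _ (Form.cast _ _ (x.1 - x.2.1) - Form.d _ _ x.2.2)
  rw [map_sub (Form.pull f g _), Form.pull_cast, map_sub (Form.pull f g _)]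
  rfl

/-- The map `DR(p)^n(N × Y) → DR(p)^n(M × X)` induced by `f × g`. -/
def drPull (p : ℕ) (f : SmoothMap M N) (g : X ⟶ Y) (n : ℤ) : dr p N Y n →ₗ[ℝ] dr p M X n :=
  (conePull p f g n).restrict (dr_pull p f g n)

/-- The presheaf of complexes `DR(p)` on pairs `M × X`. -/
def DRp (p : ℕ) : Pairsᵒᵖ ⥤ CochainComplex (ModuleCat.{0} ℝ) ℤ where
  obj Z := drComplex p Z.unop.1 Z.unop.2.obj
  map {Z _} f :=
    { f := fun n => ModuleCat.ofHom (drPull p f.unop.1 f.unop.2.hom n)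
      comm' := fun i j _ => by
        refine ModuleCat.hom_ext (LinearMap.ext
          fun (x : dr p Z.unop.1 Z.unop.2.obj i) => Subtype.ext ?_)
        exact coneD_pull p f.unop.1 f.unop.2.hom i j x.1 }
  map_id Z := by
    refine HomologicalComplex.hom_ext _ _ fun n => ModuleCat.hom_ext (LinearMap.ext
      fun (x : dr p Z.unop.1 Z.unop.2.obj n) => Subtype.ext ?_)
    exact Prod.ext (Form.pull_id x.1.1) (Prod.ext (Form.pull_id x.1.2.1) (Form.pull_id x.1.2.2))
  map_comp {Z _ _} f g := by
    refine HomologicalComplex.hom_ext _ _ fun n => ModuleCat.hom_ext (LinearMap.ext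
      fun (x : dr p Z.unop.1 Z.unop.2.obj n) => Subtype.ext ?_)
    exact Prod.ext (Form.pull_pull _ _ _ _ x.1.1).symm
      (Prod.ext (Form.pull_pull _ _ _ _ x.1.2.1).symm (Form.pull_pull _ _ _ _ x.1.2.2).symm)

/-- The form on `[0,1] × M × X(ℂ)` underlying an element of `IDR(p)^n(M × X)`. -/
def IDRp.form {p : ℕ} {Z : Pairsᵒᵖ} {n : ℤ} (x : ((IDRp p).obj Z).X n) :
    Form (cyl Z.unop.1) Z.unop.2.obj (n + 2 * p) :=
  (show idr p Z.unop.1 Z.unop.2.obj n from x).1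

/-- The triple of forms `(α ⊕ β, γ)` underlying an element of `DR(p)^n(M × X)`. -/
def DRp.forms {p : ℕ} {Z : Pairsᵒᵖ} {n : ℤ} (x : ((DRp p).obj Z).X n) :
    Form Z.unop.1 Z.unop.2.obj (n + 2 * p) × Form Z.unop.1 Z.unop.2.obj (n + 2 * p) ×
      Form Z.unop.1 Z.unop.2.obj (n + 2 * p - 1) :=
  (show dr p Z.unop.1 Z.unop.2.obj n from x).1

/-- The product of a sequence of complexes of real vector spaces. -/
def piComplex (K : ℕ → CochainComplex (ModuleCat.{0} ℝ) ℤ) :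
    CochainComplex (ModuleCat.{0} ℝ) ℤ where
  X n := ModuleCat.of ℝ (∀ p, (K p).X n)
  d i j := ModuleCat.ofHom (LinearMap.pi fun p => ((K p).d i j).hom ∘ₗ LinearMap.proj p)
  shape i j h := by
    refine ModuleCat.hom_ext (LinearMap.ext fun x => funext fun p => ?_)
    exact congrArg (fun f => f.hom (x p)) ((K p).shape i j h)
  d_comp_d' i j k _ _ := by
    refine ModuleCat.hom_ext (LinearMap.ext fun x => funext fun p => ?_)
    exact congrArg (fun f => f.hom (x p)) ((K p).d_comp_d i j k)

/-- The map of products induced by a sequence of maps of complexes. -/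
def piComplexMap {K L : ℕ → CochainComplex (ModuleCat.{0} ℝ) ℤ} (f : ∀ p, K p ⟶ L p) :
    piComplex K ⟶ piComplex L where
  f n := ModuleCat.ofHom (LinearMap.pi fun p => ((f p).f n).hom ∘ₗ LinearMap.proj p)
  comm' i j _ := by
    refine ModuleCat.hom_ext (LinearMap.ext fun x => funext fun p => ?_)
    exact congrArg (fun g => g.hom (x p)) ((f p).comm i j)

/-- The presheaf of complexes `IDR = ∏_p IDR(p)` on pairs `M × X`. -/
def IDR : Pairsᵒᵖ ⥤ CochainComplex (ModuleCat.{0} ℝ) ℤ where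
  obj Z := piComplex fun p => (IDRp p).obj Z
  map f := piComplexMap fun p => (IDRp p).map f
  map_id Z := by
    refine HomologicalComplex.hom_ext _ _ fun n =>
      ModuleCat.hom_ext (LinearMap.ext fun x => funext fun p => ?_)
    exact congrArg (fun g => (g.f n).hom (x p)) ((IDRp p).map_id Z)
  map_comp f g := by
    refine HomologicalComplex.hom_ext _ _ fun n =>
      ModuleCat.hom_ext (LinearMap.ext fun x => funext fun p => ?_)
    exact congrArg (fun h => (h.f n).hom (x p)) ((IDRp p).map_comp f g)

/-- The component of weight `p` of an element of `IDR^n(M × X)`, a form of degree `n + 2p` on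
`[0,1] × M × X(ℂ)`. -/
def IDR.form {Z : Pairsᵒᵖ} {n : ℤ} (x : (IDR.obj Z).X n) (p : ℕ) :
    Form (cyl Z.unop.1) Z.unop.2.obj (n + 2 * p) :=
  ((show ∀ p, idr p Z.unop.1 Z.unop.2.obj n from x) p).1

/-! ### Fibre integration and products -/

/-- The value on the vectors `v` of the fibre integral `∫_{[0,1]} α` of the `k`-form `α` on
`[0,1] × M × X(ℂ)` in the local coordinates given by `P` and `Q`: the form `dt ∧ γ` is sent to
`∫_0^1 γ(t) dt`, and forms without `dt` are sent to zero. -/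
def fibreIntegral {k : ℤ} (α : Form (cyl M) X k) (P : MPlot M) (Q : XPlot X)
    (z : Crd P.dim Q.dim) {m : ℕ} (v : Fin m → Crd P.dim Q.dim) : ℂ :=
  if h : k.toNat = m + 1 then
    ∫ t in (0 : ℝ)..1, castDeg h (α.1 P.cyl Q ((Fin.cons t z.1 : Fin (P.dim + 1) → ℝ), z.2))
      (Fin.cons ((Fin.cons 1 0 : Fin (P.dim + 1) → ℝ), 0)
        fun i => ((Fin.cons 0 (v i).1 : Fin (P.dim + 1) → ℝ), (v i).2))
  else 0

/-- The value on the vectors `v` of the wedge product of an alternating `a`-form and an alternating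
`b`-form, considered as a `c`-form for `c = a + b` (and zero if `c ≠ a + b`). -/
def wedge {E : Type} [NormedAddCommGroup E] [NormedSpace ℝ E] {a b c : ℕ}
    (α : E [⋀^Fin a]→L[ℝ] ℂ) (β : E [⋀^Fin b]→L[ℝ] ℂ) (v : Fin c → E) : ℂ :=
  if h : a + b = c then
    LinearMap.mul' ℝ ℂ (α.toAlternatingMap.domCoprod β.toAlternatingMap
      fun i => v (Fin.cast h (finSumFinEquiv i)))
  else 0

/-! ### The site and the algebraic structure -/

/-- The families `(M_i × X_i → M × X)_i` of products of open embeddings `M_i → M` and open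
immersions `X_i → X` such that the subsets `M_i × X_i` cover `M × X`. -/
def openCovers : Precoverage Pairs where
  coverings Z := {R |
    (∀ ⦃W : Pairs⦄ (f : W ⟶ Z), R f → SmoothMap.IsOpenEmbedding f.1 ∧ IsOpenImmersion f.2.hom) ∧
    ∀ (m : Z.1.Point) (x : Z.2.obj), ∃ (W : Pairs) (f : W ⟶ Z), R f ∧
      m ∈ range (SmoothMap.toFun f.1) ∧ x ∈ range f.2.hom}

/-- The product of the open covering topology on manifolds and of the Zariski topology. -/
def site : GrothendieckTopology Pairs := openCovers.toGrothendieck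

/-- The structure of a bigraded graded commutative differential graded algebra on the product
`∏_p K(p)` of a sequence of complexes of real vector spaces.  The degree is denoted by `n`, `m`, `l`
and the weight by `p`, `q`; signs are determined by the degree. -/
structure BigradedCDGA (K : ℕ → CochainComplex (ModuleCat.{0} ℝ) ℤ) where
  one : (piComplex K).X 0
  mul : ∀ n m k : ℤ, n + m = k →
    ((piComplex K).X n →ₗ[ℝ] (piComplex K).X m →ₗ[ℝ] (piComplex K).X k)
  one_mul : ∀ n (h : 0 + n = n) x, mul 0 n n h one x = x
  mul_one : ∀ n (h : n + 0 = n) x, mul n 0 n h x one = x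
  mul_assoc : ∀ n m l nm ml k (h₁ : n + m = nm) (h₂ : nm + l = k) (h₃ : m + l = ml)
    (h₄ : n + ml = k) x y z,
    mul nm l k h₂ (mul n m nm h₁ x y) z = mul n ml k h₄ x (mul m l ml h₃ y z)
  mul_comm : ∀ n m k (h : n + m = k) (h' : m + n = k) x y,
    mul n m k h x y = (n * m).negOnePow • mul m n k h' y x
  leibniz : ∀ n n' m m' k k' (_ : n + 1 = n') (_ : m + 1 = m') (_ : k + 1 = k')
    (h : n + m = k) (h₁ : n' + m = k') (h₂ : n + m' = k') x y,
    (piComplex K).d k k' (mul n m k h x y) =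
      mul n' m k' h₁ ((piComplex K).d n n' x) y +
        n.negOnePow • mul n m' k' h₂ x ((piComplex K).d m m' y)
  one_weight : ∀ r ≠ 0, (show ∀ p, (K p).X 0 from one) r = 0
  mul_weight : ∀ n m k (h : n + m = k) p q (x : ∀ p, (K p).X n) (y : ∀ p, (K p).X m),
    (∀ r ≠ p, x r = 0) → (∀ r ≠ q, y r = 0) →
      ∀ r ≠ p + q, (show ∀ p, (K p).X k from mul n m k h x y) r = 0

end Deligne

end

/-!
# The cylinder model `IDR(p)` of the Deligne complex `DR(p)`

**The comparison map.**  Fibre integration along `[0,1]` satisfies Stokes' theorem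
`∫ dω = ω|₁ - ω|₀ - d ∫ ω` (`Form.fibre_d`), which says that `q` commutes with the differentials.
A section of `q` sends `(α ⊕ β, γ)` to `(1 - t) α + t β - dt ∧ γ`.  Written as
`α - d(tγ) - t (α - β - dγ)` (`Form.ofCone`), this visibly commutes with the differentials, has the
right restrictions to `t = 0` and `t = 1`, and has fibre integral `-γ` (`Form.toCone_ofCone`).  The
other composite differs from the identity by the projection `Form.toKer` to the kernel of `q`.  On
that kernel the contraction `(s, t, m) ↦ (s t, m)` of the cylinder provides a homotopy operator
(`Form.cone`): forms which vanish at `t = 0` are preserved, and the restriction to `t = 1` of the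
result is the fibre integral, which is zero on the kernel.  Hence the boundary conditions of
`IDR(p)` are respected, and `q` is a homotopy equivalence (`qHomotopyEquiv`).

The coordinate domains `U × V` are neither open nor locally compact, since `U` is an arbitrary
convex set with non-empty interior.  Smoothness of fibre integrals therefore rests on
differentiation under the integral sign on locally convex sets (`contDiffOn_integral`), which only
uses the compactness of `[0,1]` and the mean value inequality.

**The algebra.**  Up to the factor `a! b!`, the wedge product of alternating forms is the
antisymmetrisation of the tensor product (`factorial_mul_wedge`).  Associativity, graded
commutativity, the Leibniz rule and compatibility with the Hodge filtration follow from how the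
antisymmetrisation `asym` absorbs permutations of blocks.  The algebra structure on `∏_p IDR(p)` is
inherited from forms because `(2πi)^p ℝ` and `F^p` are multiplicative in `p` (`wedge_mem_idr`).  The
signs only see the degree `n`, as the form degree `n + 2p` has the same parity.

**The sheaf property.**  The topology is generated by pull-backs of open covers, and these contain,
locally around every point, a product of an open embedding and an open immersion
(`isLocallyOpen_pullback`).  Parametrisations lift locally along such maps (`LiftAt`), and two
members of a compatible family of forms agree in all coordinates where both are defined, by
compatibility on their fibre product (`FormFamily.IsCompatible.val_eq`).  So compatible families of
forms glue uniquely (`glue`, `pull_glue`, `IsLocallyOpen.form_ext`).  Reality, the Hodge condition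
and Galois invariance are pointwise conditions in coordinates, hence local.  Gluing elements in each
degree suffices for a sheaf of complexes (`HasUniqueGluing.isSheafFor`), and products of
sheaves are glued componentwise.
-/

noncomputable section

namespace Deligne

variable {M N : CornerMfd} {X Y : Scheme.{0}}

/-! ### Integrals depending smoothly on a parameter -/

section

variable {E G : Type} [NormedAddCommGroup E] [NormedSpace ℝ E] [NormedAddCommGroup G]
  [NormedSpace ℝ G]

/-- Differentiation under the integral sign, within a set which is convex near the given point.
No local compactness of `s` is needed: the derivative is uniformly continuous in `t ∈ [0,1]` by
compactness of `[0,1]`, and the mean value inequality holds on convex sets. -/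
theorem hasFDerivWithinAt_integral_of_continuousOn [CompleteSpace G] {s : Set E} {x : E}
    (hx : x ∈ s) {r : ℝ} (hr : 0 < r) (hconv : Convex ℝ (s ∩ Metric.ball x r))
    {F : ℝ × E → G} {F' : ℝ × E → E →L[ℝ] G}
    (hF : ContinuousOn F (Icc 0 1 ×ˢ s)) (hF' : ContinuousOn F' (Icc 0 1 ×ˢ s))
    (hd : ∀ t ∈ Icc (0 : ℝ) 1, ∀ y ∈ s,
      HasFDerivWithinAt (fun y => F (t, y)) (F' (t, y)) s y) :
    HasFDerivWithinAt (fun y => ∫ t in (0 : ℝ)..1, F (t, y))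
      (∫ t in (0 : ℝ)..1, F' (t, x)) s x := by
  have hpath {y : E} (hy : y ∈ s) :
      ContinuousOn (fun t : ℝ => (t, y)) (Icc 0 1) ∧
        MapsTo (fun t : ℝ => (t, y)) (Icc 0 1) (Icc 0 1 ×ˢ s) :=
    ⟨by fun_prop, fun t ht => ⟨ht, hy⟩⟩
  have hint {y : E} (hy : y ∈ s) :
      IntervalIntegrable (fun t => F (t, y)) MeasureTheory.volume 0 1 :=
    ContinuousOn.intervalIntegrable_of_Icc zero_le_one (hF.comp (hpath hy).1 (hpath hy).2)
  have hint' : IntervalIntegrable (fun t => F' (t, x)) MeasureTheory.volume 0 1 :=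
    ContinuousOn.intervalIntegrable_of_Icc zero_le_one (hF'.comp (hpath hx).1 (hpath hx).2)
  refine HasFDerivWithinAt.of_isLittleO (Asymptotics.isLittleO_iff.2 fun c hc => ?_)
  -- The second membership of `t` makes the condition local in a full neighbourhood of `(x, t)`.
  have key : ∀ᶠ y in 𝓝 x, ∀ t ∈ Icc (0 : ℝ) 1, t ∈ Icc (0 : ℝ) 1 → y ∈ s →
      ‖F' (t, y) - F' (t, x)‖ ≤ c := by
    refine isCompact_Icc.eventually_forall_of_forall_eventually fun t ht => ?_
    have h1 := Metric.continuousWithinAt_iff'.1 (hF' (t, x) ⟨ht, hx⟩) (c / 2) (half_pos hc)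
    rw [eventually_nhdsWithin_iff] at h1
    have t1 : Tendsto (fun z : E × ℝ => (z.2, z.1)) (𝓝 (x, t)) (𝓝 (t, x)) :=
      continuous_swap.tendsto (x, t)
    have t2 : Tendsto (fun z : E × ℝ => (z.2, x)) (𝓝 (x, t)) (𝓝 (t, x)) :=
      (continuous_snd.prodMk continuous_const).tendsto (x, t)
    filter_upwards [t1.eventually h1, t2.eventually h1] with z h1 h2 hz2 hz
    have a1 := h1 ⟨hz2, hz⟩
    have a2 := h2 ⟨hz2, hx⟩
    rw [← dist_eq_norm]
    have := dist_triangle_right (F' (z.2, z.1)) (F' (z.2, x)) (F' (t, x))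
    linarith
  obtain ⟨ε, hε, hball⟩ := Metric.eventually_nhds_iff_ball.1 key
  filter_upwards [inter_mem_nhdsWithin s (Metric.ball_mem_nhds x (lt_min hr hε))] with y hy
  have hc' : Convex ℝ (s ∩ Metric.ball x (min r ε)) := by
    have : s ∩ Metric.ball x (min r ε) = (s ∩ Metric.ball x r) ∩ Metric.ball x (min r ε) := by
      rw [inter_assoc, inter_eq_right.2 (Metric.ball_subset_ball (min_le_left r ε))]
    rw [this]
    exact hconv.inter (convex_ball _ _)
  have hmv (t : ℝ) (ht : t ∈ Icc (0 : ℝ) 1) :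
      ‖F (t, y) - F (t, x) - F' (t, x) (y - x)‖ ≤ c * ‖y - x‖ := by
    refine hc'.norm_image_sub_le_of_norm_hasFDerivWithin_le' (f := fun y => F (t, y))
      (f' := fun y => F' (t, y)) (fun z hz => (hd t ht z hz.1).mono inter_subset_left)
      (fun z hz => ?_) ⟨hx, Metric.mem_ball_self (lt_min hr hε)⟩ hy
    exact hball z (Metric.ball_subset_ball (min_le_right _ _) hz.2) t ht ht hz.1
  have e : (∫ t in (0 : ℝ)..1, F (t, y)) - (∫ t in (0 : ℝ)..1, F (t, x)) -
      (∫ t in (0 : ℝ)..1, F' (t, x)) (y - x) =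
      ∫ t in (0 : ℝ)..1, (F (t, y) - F (t, x) - F' (t, x) (y - x)) := by
    rw [ContinuousLinearMap.intervalIntegral_apply hint', ← intervalIntegral.integral_sub
      (hint hy.1) (hint hx), ← intervalIntegral.integral_sub ((hint hy.1).sub (hint hx))]
    exact ContinuousOn.intervalIntegrable_of_Icc zero_le_one
      ((hF'.comp (hpath hx).1 (hpath hx).2).clm_apply continuousOn_const)
  rw [e]
  have := intervalIntegral.norm_integral_le_of_norm_le_const (a := (0 : ℝ)) (b := 1)
    (f := fun t => F (t, y) - F (t, x) - F' (t, x) (y - x)) (C := c * ‖y - x‖)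
    (fun t ht => hmv t (by rw [uIoc_of_le zero_le_one] at ht; exact Ioc_subset_Icc_self ht))
  simpa using this

theorem fderivWithin_integral_of_continuousOn [CompleteSpace G] {s : Set E} {x : E}
    (hs : UniqueDiffWithinAt ℝ s x) (hx : x ∈ s) {r : ℝ} (hr : 0 < r)
    (hconv : Convex ℝ (s ∩ Metric.ball x r)) {F : ℝ × E → G} {F' : ℝ × E → E →L[ℝ] G}
    (hF : ContinuousOn F (Icc 0 1 ×ˢ s)) (hF' : ContinuousOn F' (Icc 0 1 ×ˢ s))
    (hd : ∀ t ∈ Icc (0 : ℝ) 1, ∀ y ∈ s,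
      HasFDerivWithinAt (fun y => F (t, y)) (F' (t, y)) s y) (u : E) :
    fderivWithin ℝ (fun y => ∫ t in (0 : ℝ)..1, F (t, y)) s x u =
      ∫ t in (0 : ℝ)..1, F' (t, x) u := by
  rw [(hasFDerivWithinAt_integral_of_continuousOn hx hr hconv hF hF' hd).fderivWithin hs]
  refine ContinuousLinearMap.intervalIntegral_apply ?_ u
  refine ContinuousOn.intervalIntegrable_of_Icc zero_le_one ?_
  exact hF'.comp (f := fun t : ℝ => (t, x)) (s := Icc 0 1) (by fun_prop) fun t ht => ⟨ht, hx⟩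

/-- The fundamental theorem of calculus along a path with constant velocity. -/
theorem integral_fderivWithin_path [CompleteSpace G] {S : Set E} (hS : UniqueDiffOn ℝ S)
    {f : E → G} (hf : ContDiffOn ℝ 1 f S) {γ : ℝ → E} {v : E} (hγ : ∀ t, HasDerivAt γ v t)
    (hm : MapsTo γ (Icc 0 1) S) :
    (∫ t in (0 : ℝ)..1, fderivWithin ℝ f S (γ t) v) = f (γ 1) - f (γ 0) := by
  have hc : ContinuousOn γ (Icc 0 1) := fun t _ => (hγ t).continuousAt.continuousWithinAt
  have hcont : ContinuousOn (fderivWithin ℝ f S) S := hf.continuousOn_fderivWithin hS le_rfl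
  refine intervalIntegral.integral_eq_sub_of_hasDeriv_right_of_le zero_le_one
    (f := fun t => f (γ t)) (hf.continuousOn.comp hc hm) (fun t ht => ?_)
    (ContinuousOn.intervalIntegrable_of_Icc zero_le_one
      ((hcont.comp hc hm).clm_apply continuousOn_const))
  have h1 := (hf.differentiableOn (by simp) _ (hm (Ioo_subset_Icc_self
    ht))).hasFDerivWithinAt.comp_hasDerivWithinAt (s := Icc (0 : ℝ) 1) t (hγ t).hasDerivWithinAt hm
  exact (h1.hasDerivAt (Icc_mem_nhds ht.1 ht.2)).hasDerivWithinAt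

theorem hasFDerivWithinAt_snd {s : Set E} {F : ℝ × E → G}
    (hF : ContDiffOn ℝ 1 F (Icc 0 1 ×ˢ s)) {t : ℝ} (ht : t ∈ Icc (0 : ℝ) 1) {x : E} (hx : x ∈ s) :
    HasFDerivWithinAt (fun y => F (t, y))
      ((fderivWithin ℝ F (Icc 0 1 ×ˢ s) (t, x)).comp (ContinuousLinearMap.inr ℝ ℝ E)) s x :=
  ((hF.differentiableOn (by simp)) (t, x) ⟨ht, hx⟩).hasFDerivWithinAt.comp x
    (hasFDerivAt_prodMk_right t x).hasFDerivWithinAt fun _ hy => ⟨ht, hy⟩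

/-- Every point of `s` has small balls in which `s` is convex. -/
def LocallyConvexSet (s : Set E) : Prop :=
  ∀ x ∈ s, ∃ r > 0, Convex ℝ (s ∩ Metric.ball x r)

theorem hasFDerivWithinAt_integral [CompleteSpace G] {s : Set E} (hs : UniqueDiffOn ℝ s)
    (hc : LocallyConvexSet s) {F : ℝ × E → G} (hF : ContDiffOn ℝ 1 F (Icc 0 1 ×ˢ s))
    {x : E} (hx : x ∈ s) :
    HasFDerivWithinAt (fun y => ∫ t in (0 : ℝ)..1, F (t, y))
      (∫ t in (0 : ℝ)..1, (fderivWithin ℝ F (Icc 0 1 ×ˢ s) (t, x)).comp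
        (ContinuousLinearMap.inr ℝ ℝ E)) s x := by
  obtain ⟨r, hr, hrc⟩ := hc x hx
  have hu : UniqueDiffOn ℝ (Icc (0 : ℝ) 1 ×ˢ s) := (uniqueDiffOn_Icc zero_lt_one).prod hs
  refine hasFDerivWithinAt_integral_of_continuousOn hx hr hrc (F' := fun p =>
    (fderivWithin ℝ F (Icc 0 1 ×ˢ s) p).comp (ContinuousLinearMap.inr ℝ ℝ E)) hF.continuousOn ?_
    fun t ht y hy => hasFDerivWithinAt_snd hF ht hy
  exact (hF.continuousOn_fderivWithin hu le_rfl).clm_comp continuousOn_const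

theorem contDiffOn_integral_nat [CompleteSpace G] {s : Set E} (hs : UniqueDiffOn ℝ s)
    (hc : LocallyConvexSet s) (n : ℕ) {F : ℝ × E → G}
    (hF : ContDiffOn ℝ ∞ F (Icc 0 1 ×ˢ s)) :
    ContDiffOn ℝ n (fun y => ∫ t in (0 : ℝ)..1, F (t, y)) s := by
  have hu : UniqueDiffOn ℝ (Icc (0 : ℝ) 1 ×ˢ s) := (uniqueDiffOn_Icc zero_lt_one).prod hs
  induction n generalizing G with
  | zero =>
    exact contDiffOn_zero.2 fun x hx =>
      (hasFDerivWithinAt_integral hs hc (hF.of_le (by simp)) hx).continuousWithinAt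
  | succ n ih =>
    have hd (x) (hx : x ∈ s) := hasFDerivWithinAt_integral hs hc (hF.of_le (by simp)) hx
    rw [Nat.cast_add, Nat.cast_one]
    refine contDiffOn_succ_of_fderivWithin (fun x hx => (hd x hx).differentiableWithinAt)
      (by simp) ?_
    refine ContDiffOn.congr (ih (F := fun p => (fderivWithin ℝ F (Icc 0 1 ×ˢ s) p).comp
      (ContinuousLinearMap.inr ℝ ℝ E)) ?_) fun x hx => (hd x hx).fderivWithin (hs x hx)
    exact (hF.fderivWithin hu (by simp)).clm_comp contDiffOn_const

theorem contDiffOn_integral [CompleteSpace G] {s : Set E} (hs : UniqueDiffOn ℝ s)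
    (hc : LocallyConvexSet s) {F : ℝ × E → G} (hF : ContDiffOn ℝ ∞ F (Icc 0 1 ×ˢ s)) :
    ContDiffOn ℝ ∞ (fun y => ∫ t in (0 : ℝ)..1, F (t, y)) s :=
  contDiffOn_infty.2 fun n => contDiffOn_integral_nat hs hc n hF

end

theorem locallyConvexSet_dom {M : CornerMfd} {X : Scheme.{0}} (P : MPlot M) (Q : XPlot X) :
    LocallyConvexSet (dom P Q) := by
  rintro ⟨u, z⟩ ⟨hu, hz⟩
  obtain ⟨r, hr, hV⟩ := Metric.isOpen_iff.1 Q.isOpen z hz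
  refine ⟨r, hr, ?_⟩
  rw [dom, ← ball_prod_same, prod_inter_prod, inter_eq_right.2 hV]
  exact (P.convex.inter (convex_ball _ _)).prod (convex_ball _ _)

/-! ### Fibre integration in local coordinates -/

section

variable {n m : ℕ}

/-- The vector `∂_t` on `[0,1] × ℝⁿ × ℂᵐ`. -/
def vert (n m : ℕ) : Crd (n + 1) m := (Fin.cons 1 0, 0)

/-- The inclusion `v ↦ (0, v)` of the horizontal vectors. -/
def horiz (n m : ℕ) : Crd n m →L[ℝ] Crd (n + 1) m :=
  LinearMap.toContinuousLinearMap
    { toFun := fun v => (Fin.cons 0 v.1, v.2)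
      map_add' := fun v w => by
        refine Prod.ext (funext fun j => ?_) rfl
        refine Fin.cases ?_ (fun j => ?_) j <;> simp
      map_smul' := fun c v => by
        refine Prod.ext (funext fun j => ?_) rfl
        refine Fin.cases ?_ (fun j => ?_) j <;> simp }

/-- The point `(t, z)` of `[0,1] × ℝⁿ × ℂᵐ`. -/
def cylPt (t : ℝ) (z : Crd n m) : Crd (n + 1) m := (Fin.cons t z.1, z.2)

theorem horiz_apply (v : Crd n m) : horiz n m v = (Fin.cons 0 v.1, v.2) := rfl

theorem cylPt_eq (t : ℝ) (z : Crd n m) : cylPt t z = t • vert n m + horiz n m z := by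
  refine Prod.ext (funext fun j => ?_) ?_
  · refine Fin.cases ?_ (fun j => ?_) j <;> simp [cylPt, vert, horiz_apply]
  · simp [cylPt, vert, horiz_apply]

/-- Contraction with `∂_t` followed by restriction to the horizontal vectors, as a map from
`a`-forms to `b`-forms for `a = b + 1` (and zero if `a ≠ b + 1`). -/
def contr (n m a b : ℕ) :
    (Crd (n + 1) m [⋀^Fin a]→L[ℝ] ℂ) →L[ℝ] (Crd n m [⋀^Fin b]→L[ℝ] ℂ) :=
  if h : a = b + 1 then
    h ▸ (ContinuousAlternatingMap.compContinuousLinearMapCLM (horiz n m)).comp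
      ((ContinuousLinearMap.apply ℝ _ (vert n m)).comp
        (ContinuousAlternatingMap.curryLeftLI (𝕜 := ℝ) (E := Crd (n + 1) m) (F := ℂ)
          (n := b)).toContinuousLinearMap)
  else 0

theorem contr_succ_apply {b : ℕ} (α : Crd (n + 1) m [⋀^Fin (b + 1)]→L[ℝ] ℂ)
    (v : Fin b → Crd n m) :
    contr n m (b + 1) b α v = α (Matrix.vecCons (vert n m) fun i => horiz n m (v i)) := by
  simp only [contr, dite_true]
  rfl

theorem contr_of_ne {a b : ℕ} (h : a ≠ b + 1) : contr n m a b = 0 := dif_neg h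

/-- The cylinder `[0,1] × s`. -/
def cylSet (s : Set (Crd n m)) : Set (Crd (n + 1) m) :=
  {p | p.1 0 ∈ Icc (0 : ℝ) 1 ∧ (Fin.tail p.1, p.2) ∈ s}

theorem cylPt_mem {s : Set (Crd n m)} {t : ℝ} (ht : t ∈ Icc (0 : ℝ) 1) {z : Crd n m}
    (hz : z ∈ s) : cylPt t z ∈ cylSet s := by
  simpa [cylPt, cylSet] using ⟨ht, hz⟩

theorem contDiff_cylPt : ContDiff ℝ ∞ (fun p : ℝ × Crd n m => cylPt p.1 p.2) := by
  simp only [cylPt_eq]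
  fun_prop

theorem hasFDerivAt_cylPt (t : ℝ) (z : Crd n m) :
    HasFDerivAt (fun z : Crd n m => cylPt t z) (horiz n m) z := by
  simp only [cylPt_eq]
  exact (horiz n m).hasFDerivAt.const_add _

theorem hasDerivAt_cylPt (t : ℝ) (z : Crd n m) :
    HasDerivAt (fun t : ℝ => cylPt t z) (vert n m) t := by
  simp only [cylPt_eq]
  simpa using ((hasDerivAt_id t).smul_const (vert n m)).add_const (horiz n m z)

variable {a b : ℕ} {s : Set (Crd n m)} {η : Crd (n + 1) m → Crd (n + 1) m [⋀^Fin a]→L[ℝ] ℂ}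

theorem contDiffOn_comp_cylPt {G : Type} [NormedAddCommGroup G] [NormedSpace ℝ G]
    {f : Crd (n + 1) m → G} (hf : ContDiffOn ℝ ∞ f (cylSet s)) :
    ContDiffOn ℝ ∞ (fun p : ℝ × Crd n m => f (cylPt p.1 p.2)) (Icc 0 1 ×ˢ s) :=
  hf.comp contDiff_cylPt.contDiffOn fun _ hp => cylPt_mem hp.1 hp.2

theorem continuousOn_comp_cylPt {G : Type} [TopologicalSpace G]
    {f : Crd (n + 1) m → G} (hf : ContinuousOn f (cylSet s)) {z : Crd n m} (hz : z ∈ s) :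
    ContinuousOn (fun t : ℝ => f (cylPt t z)) (Icc 0 1) :=
  hf.comp (fun t _ => (hasDerivAt_cylPt t z).continuousAt.continuousWithinAt)
    fun _ ht => cylPt_mem ht hz

/-- The fibre integral of the form `η` on `[0,1] × s`. -/
def fibreInt (b : ℕ) (η : Crd (n + 1) m → Crd (n + 1) m [⋀^Fin a]→L[ℝ] ℂ) (z : Crd n m) :
    Crd n m [⋀^Fin b]→L[ℝ] ℂ :=
  ∫ t in (0 : ℝ)..1, contr n m a b (η (cylPt t z))

theorem intervalIntegrable_contr (hη : ContinuousOn η (cylSet s)) {z : Crd n m} (hz : z ∈ s) :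
    IntervalIntegrable (fun t => contr n m a b (η (cylPt t z))) MeasureTheory.volume 0 1 :=
  ContinuousOn.intervalIntegrable_of_Icc zero_le_one
    ((contr n m a b).continuous.comp_continuousOn (continuousOn_comp_cylPt hη hz))

instance completeSpace_alternating (E : Type) [NormedAddCommGroup E] [NormedSpace ℝ E]
    [FiniteDimensional ℝ E] (k : ℕ) : CompleteSpace (E [⋀^Fin k]→L[ℝ] ℂ) :=
  have := finite_alternating E k
  FiniteDimensional.complete ℝ _

theorem intervalIntegral_alternating_apply {E : Type} [NormedAddCommGroup E] [NormedSpace ℝ E]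
    [FiniteDimensional ℝ E] {k : ℕ} {f : ℝ → E [⋀^Fin k]→L[ℝ] ℂ}
    (hf : IntervalIntegrable f MeasureTheory.volume 0 1) (v : Fin k → E) :
    (∫ t in (0 : ℝ)..1, f t) v = ∫ t in (0 : ℝ)..1, f t v :=
  ((ContinuousAlternatingMap.apply ℝ E ℂ v).intervalIntegral_comp_comm hf).symm

theorem fibreInt_apply (hη : ContinuousOn η (cylSet s)) {z : Crd n m} (hz : z ∈ s)
    (v : Fin b → Crd n m) :
    fibreInt b η z v = ∫ t in (0 : ℝ)..1, contr n m a b (η (cylPt t z)) v :=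
  intervalIntegral_alternating_apply (intervalIntegrable_contr hη hz) v

theorem contDiffOn_fibreInt (hs : UniqueDiffOn ℝ s) (hc : LocallyConvexSet s)
    (hη : ContDiffOn ℝ ∞ η (cylSet s)) : ContDiffOn ℝ ∞ (fibreInt b η) s :=
  contDiffOn_integral hs hc (F := fun p => contr n m a b (η (cylPt p.1 p.2)))
    ((contr n m a b).contDiff.comp_contDiffOn (contDiffOn_comp_cylPt hη))

theorem fderivWithin_fibreInt (hs : UniqueDiffOn ℝ s) (hc : LocallyConvexSet s)
    (hS : UniqueDiffOn ℝ (cylSet s)) (hη : ContDiffOn ℝ ∞ η (cylSet s)) {z : Crd n m}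
    (hz : z ∈ s) (u : Crd n m) (v : Fin b → Crd n m) :
    fderivWithin ℝ (fibreInt b η) s z u v =
      ∫ t in (0 : ℝ)..1,
        contr n m a b (fderivWithin ℝ η (cylSet s) (cylPt t z) (horiz n m u)) v := by
  obtain ⟨r, hr, hrc⟩ := hc z hz
  have hcont : ContinuousOn (fderivWithin ℝ η (cylSet s)) (cylSet s) :=
    hη.continuousOn_fderivWithin hS (by simp)
  have hF' : ContinuousOn (fun p : ℝ × Crd n m => (contr n m a b).comp
      ((fderivWithin ℝ η (cylSet s) (cylPt p.1 p.2)).comp (horiz n m))) (Icc 0 1 ×ˢ s) :=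
    continuousOn_const.clm_comp ((hcont.comp contDiff_cylPt.continuous.continuousOn
      fun p hp => cylPt_mem hp.1 hp.2).clm_comp continuousOn_const)
  have h := fderivWithin_integral_of_continuousOn (hs z hz) hz hr hrc
    (F := fun p => contr n m a b (η (cylPt p.1 p.2)))
    ((contr n m a b).continuous.comp_continuousOn (contDiffOn_comp_cylPt hη).continuousOn) hF'
    (fun t ht y hy => (contr n m a b).hasFDerivAt.comp_hasFDerivWithinAt y
      ((hη.differentiableOn (by simp) _ (cylPt_mem ht hy)).hasFDerivWithinAt.comp y
        (hasFDerivAt_cylPt t y).hasFDerivWithinAt fun _ hx => cylPt_mem ht hx)) u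
  refine (congrArg (fun β => β v) h).trans (intervalIntegral_alternating_apply ?_ v)
  refine ContinuousOn.intervalIntegrable_of_Icc zero_le_one ?_
  exact (hF'.comp (f := fun t : ℝ => (t, z)) (s := Icc 0 1) (by fun_prop)
    fun t ht => ⟨ht, hz⟩).clm_apply continuousOn_const

/-- Stokes' theorem for the fibre integral along `[0,1]`, in local coordinates.  Among the terms of
`dη(∂_t, v_1, …, v_a)`, the derivative in the direction of `t` integrates to the boundary terms, and
the derivatives in the directions `v_i` integrate to `-d ∫ η`.  For `a = 0` the latter is absent,
and `extD` is zero because `0` is not of the form `b + 1`. -/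
theorem fibreInt_extDerivWithin (hs : UniqueDiffOn ℝ s) (hc : LocallyConvexSet s)
    (hS : UniqueDiffOn ℝ (cylSet s)) (hη : ContDiffOn ℝ ∞ η (cylSet s)) {z : Crd n m}
    (hz : z ∈ s) (hb : b + 1 = a ∨ a = 0) :
    fibreInt a (extDerivWithin η (cylSet s)) z =
      (η (cylPt 1 z)).compContinuousLinearMap (horiz n m) -
        (η (cylPt 0 z)).compContinuousLinearMap (horiz n m) - extD s a (fibreInt b η) z := by
  have hcont : ContinuousOn (fderivWithin ℝ η (cylSet s)) (cylSet s) :=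
    hη.continuousOn_fderivWithin hS (by simp)
  have hext : ContinuousOn (extDerivWithin η (cylSet s)) (cylSet s) :=
    (ContinuousAlternatingMap.alternatizeUncurryFinCLM ℝ _ ℂ).continuous.comp_continuousOn hcont
  have hcontD := continuousOn_comp_cylPt hcont hz
  generalize hDef : (fun t => fderivWithin ℝ η (cylSet s) (cylPt t z)) = D at hcontD
  have hD (u : Crd (n + 1) m) (w : Fin a → Crd (n + 1) m) :
      IntervalIntegrable (fun t => D t u w) MeasureTheory.volume 0 1 :=
    ContinuousOn.intervalIntegrable_of_Icc zero_le_one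
      ((ContinuousAlternatingMap.apply ℝ _ ℂ w).continuous.comp_continuousOn
        (hcontD.clm_apply continuousOn_const))
  ext v
  have ftc : (∫ t in (0 : ℝ)..1, D t (vert n m) fun i => horiz n m (v i)) =
      η (cylPt 1 z) (fun i => horiz n m (v i)) - η (cylPt 0 z) (fun i => horiz n m (v i)) := by
    have h1 := integral_fderivWithin_path hS (hη.of_le (by simp))
      (fun t => hasDerivAt_cylPt t z) (fun t ht => cylPt_mem ht hz)
    rw [← intervalIntegral_alternating_apply, ← hDef, h1]
    · rfl
    · exact ContinuousOn.intervalIntegrable_of_Icc zero_le_one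
        (hcontD.clm_apply continuousOn_const)
  have hint (t : ℝ) : contr n m (a + 1) a (extDerivWithin η (cylSet s) (cylPt t z)) v =
      D t (vert n m) (fun i => horiz n m (v i)) + ∑ i : Fin a, (-1 : ℤ) ^ (i.succ : ℕ) •
        D t (horiz n m (v i)) (i.succ.removeNth
          (Matrix.vecCons (vert n m) fun i => horiz n m (v i))) := by
    rw [contr_succ_apply, extDerivWithin,
      ContinuousAlternatingMap.alternatizeUncurryFin_apply, Fin.sum_univ_succ, ← hDef]
    simp only [Fin.val_zero, pow_zero, one_smul, Matrix.cons_val_zero, Matrix.cons_val_succ]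
    rfl
  have hsum : (∑ i : Fin a, ∫ t in (0 : ℝ)..1, (-1 : ℤ) ^ (i.succ : ℕ) •
      D t (horiz n m (v i)) (i.succ.removeNth
        (Matrix.vecCons (vert n m) fun i => horiz n m (v i)))) = - extD s a (fibreInt b η) z v := by
    rcases hb with rfl | rfl
    · rw [extD_self, extDerivWithin, ContinuousAlternatingMap.alternatizeUncurryFin_apply,
        ← Finset.sum_neg_distrib]
      refine Finset.sum_congr rfl fun i _ => ?_
      rw [fderivWithin_fibreInt hs hc hS hη hz, ← hDef]
      simp only [zsmul_eq_mul]
      rw [intervalIntegral.integral_const_mul, ← zsmul_eq_mul, ← zsmul_eq_mul, Fin.val_succ,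
        pow_succ, mul_neg_one, neg_smul]
      congr 2
      refine intervalIntegral.integral_congr fun t _ => ?_
      simp only [contr_succ_apply]
      congr 1
      funext j
      refine Fin.cases ?_ (fun j => ?_) j
      · simp [Fin.removeNth]
      · simp [Fin.removeNth, Fin.succ_succAbove_succ]
    · simp [extD]
  rw [fibreInt_apply hext hz]
  simp only [hint]
  rw [intervalIntegral.integral_add (hD _ _), intervalIntegral.integral_finsetSum, ftc, hsum]
  · simp only [ContinuousAlternatingMap.sub_apply,
      ContinuousAlternatingMap.compContinuousLinearMap_apply]
    rw [sub_eq_add_neg _ (extD s a (fibreInt b η) z v)]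
    rfl
  · exact fun i _ => (hD _ _).smul _
  · refine (IntervalIntegrable.sum Finset.univ (f := fun i t => (-1 : ℤ) ^ (i.succ : ℕ) •
      D t (horiz n m (v i)) (i.succ.removeNth (Matrix.vecCons (vert n m)
        fun i => horiz n m (v i)))) fun i _ => (hD _ _).smul _).congr fun t _ => ?_
    simp only [Finset.sum_apply]

end

/-! ### Fibre integration of forms on `[0,1] × M × X(ℂ)` -/

/-- The projection `[0,1] × ℝⁿ × ℂᵐ → ℝⁿ × ℂᵐ`. -/
def projCrd (n m : ℕ) : Crd (n + 1) m →L[ℝ] Crd n m :=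
  LinearMap.toContinuousLinearMap
    { toFun := fun p => (Fin.tail p.1, p.2)
      map_add' := fun _ _ => rfl
      map_smul' := fun _ _ => rfl }

theorem projCrd_apply {n m : ℕ} (p : Crd (n + 1) m) : projCrd n m p = (Fin.tail p.1, p.2) := rfl

theorem projCrd_vert (n m : ℕ) : projCrd n m (vert n m) = 0 := by
  refine Prod.ext (funext fun j => ?_) rfl
  simp [projCrd_apply, vert]

theorem projCrd_horiz {n m : ℕ} (v : Crd n m) : projCrd n m (horiz n m v) = v := by
  simp [projCrd_apply, horiz_apply]

theorem dom_cyl (P : MPlot M) (Q : XPlot X) : dom P.cyl Q = cylSet (dom P Q) := by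
  ext p
  simp [dom, cylSet, and_assoc]

/-- The map `id × a` of coordinates on cylinders. -/
def cylReparam {n n' : ℕ} (a : (Fin n' → ℝ) → (Fin n → ℝ)) (u : Fin (n' + 1) → ℝ) :
    Fin (n + 1) → ℝ :=
  Fin.cons (u 0) (a (Fin.tail u))

theorem prodMap_cylReparam {n n' m m' : ℕ} (a : (Fin n' → ℝ) → (Fin n → ℝ))
    (b : (Fin m' → ℂ) → (Fin m → ℂ)) (p : Crd (n' + 1) m') :
    Prod.map (cylReparam a) b p = cylPt (p.1 0) (Prod.map a b (projCrd n' m' p)) := rfl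

theorem MPlot.IsReparam.cyl {P' P : MPlot M} {a : (Fin P'.dim → ℝ) → (Fin P.dim → ℝ)}
    (h : P'.IsReparam P a) : P'.cyl.IsReparam P.cyl (cylReparam a) where
  smooth := by
    have htail : ContDiff ℝ ∞ (fun u : Fin (P'.dim + 1) → ℝ => Fin.tail u) :=
      contDiff_pi.2 fun j => contDiff_apply ℝ ℝ _
    have h1 : ContDiffOn ℝ ∞ (fun u : Fin (P'.dim + 1) → ℝ => a (Fin.tail u)) P'.cyl.U :=
      h.smooth.comp htail.contDiffOn fun u hu => hu.2
    refine contDiffOn_pi.2 fun j => ?_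
    refine Fin.cases ?_ (fun j => ?_) j
    · exact (contDiff_apply ℝ ℝ (0 : Fin (P'.dim + 1))).contDiffOn
    · exact contDiffOn_pi.1 h1 j
  mapsTo u hu := ⟨hu.1, h.mapsTo hu.2⟩
  eq u hu := by
    have := h.eq (Fin.tail u) hu.2
    change (⟨(P'.φ (Fin.tail u)).1, _⟩ : (Deligne.cyl M).Point) = ⟨(P.φ (a (Fin.tail u))).1, _⟩
    rw [this]
    rfl

theorem hasFDerivWithinAt_prodMap_cylReparam {n n' m m' : ℕ} {a : (Fin n' → ℝ) → (Fin n → ℝ)}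
    {b : (Fin m' → ℂ) → (Fin m → ℂ)} {s : Set (Crd n' m')} {p : Crd (n' + 1) m'}
    (h : DifferentiableWithinAt ℝ (Prod.map a b) s (projCrd n' m' p)) :
    HasFDerivWithinAt (Prod.map (cylReparam a) b)
      (((ContinuousLinearMap.proj 0).comp (ContinuousLinearMap.fst ℝ (Fin (n' + 1) → ℝ)
        (Fin m' → ℂ))).smulRight (vert n m) + (horiz n m).comp
          ((fderivWithin ℝ (Prod.map a b) s (projCrd n' m' p)).comp (projCrd n' m')))
      (cylSet s) p := by
  have h1 := (horiz n m).hasFDerivAt.comp_hasFDerivWithinAt p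
    (h.hasFDerivWithinAt.comp p (projCrd n' m').hasFDerivWithinAt
      (fun _ hq => hq.2 : MapsTo _ (cylSet s) s))
  have h2 := ((((ContinuousLinearMap.proj 0).comp (ContinuousLinearMap.fst ℝ (Fin (n' + 1) → ℝ)
        (Fin m' → ℂ))).smulRight (vert n m)).hasFDerivWithinAt (x := p) (s := cylSet s)).add h1
  have e : Prod.map (cylReparam a) b = fun q : Crd (n' + 1) m' =>
      q.1 0 • vert n m + horiz n m (Prod.map a b (projCrd n' m' q)) :=
    funext fun q => (prodMap_cylReparam a b q).trans (cylPt_eq _ _)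
  rw [e]
  exact h2

theorem contr_compContinuousLinearMap {n m n' m' a b : ℕ} (α : Crd (n + 1) m [⋀^Fin a]→L[ℝ] ℂ)
    {A : Crd (n' + 1) m' →L[ℝ] Crd (n + 1) m} {B : Crd n' m' →L[ℝ] Crd n m}
    (h1 : A (vert n' m') = vert n m) (h2 : ∀ v, A (horiz n' m' v) = horiz n m (B v)) :
    contr n' m' a b (α.compContinuousLinearMap A) =
      (contr n m a b α).compContinuousLinearMap B := by
  by_cases h : a = b + 1
  · subst h
    ext v
    simp only [contr_succ_apply, ContinuousAlternatingMap.compContinuousLinearMap_apply]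
    congr 1
    funext j
    refine Fin.cases ?_ (fun j => ?_) j
    · simp [h1]
    · simp [h2]
  · simp only [contr_of_ne h]
    rfl

theorem contr_conj {n m a b : ℕ} (α : Crd (n + 1) m [⋀^Fin a]→L[ℝ] ℂ) :
    contr n m a b ((Complex.conjCLE : ℂ →L[ℝ] ℂ).compContinuousAlternatingMap α) =
      (Complex.conjCLE : ℂ →L[ℝ] ℂ).compContinuousAlternatingMap (contr n m a b α) := by
  by_cases h : a = b + 1
  · subst h
    ext v
    simp [contr_succ_apply]
  · simp only [contr_of_ne h]
    ext v
    simp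

theorem Form.continuousOn_cyl {k : ℤ} (α : Form (cyl M) X k) (P : MPlot M) (Q : XPlot X) :
    ContinuousOn (α.1 P.cyl Q) (cylSet (dom P Q)) := by
  rw [← dom_cyl]
  exact (α.2.2.1 P.cyl Q).continuousOn

theorem Form.ext {k : ℤ} {α β : Form M X k}
    (h : ∀ P Q, ∀ z ∈ dom P Q, α.1 P Q z = β.1 P Q z) : α = β := by
  refine Subtype.ext (funext fun P => funext fun Q => funext fun z => ?_)
  by_cases hz : z ∈ dom P Q
  · exact h P Q z hz
  · rw [α.2.2.2.1 P Q z hz, β.2.2.2.1 P Q z hz]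

/-- The fibre integral `A^k([0,1] × M × X) → A^l(M × X)`, `l = k - 1`, along `[0,1]`. -/
def Form.fibre {k l : ℤ} (h : l + 1 = k) : Form (cyl M) X k →ₗ[ℝ] Form M X l where
  toFun α := ⟨fun P Q => (dom P Q).indicator (fibreInt l.toNat (α.1 P.cyl Q)), by
    refine ⟨fun hl => ?_, fun P Q => ?_, fun P Q z hz => indicator_of_notMem hz _,
      fun P' P a Q' Q b ha hb z hz => ?_⟩
    · funext P Q z
      have h0 : k.toNat ≠ l.toNat + 1 := by omega
      change (dom P Q).indicator (fibreInt l.toNat (α.1 P.cyl Q)) z = 0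
      simp [fibreInt, contr_of_ne h0, indicator]
    · refine (contDiffOn_fibreInt (uniqueDiffOn_dom P Q) (locallyConvexSet_dom P Q) ?_).congr
        fun z hz => indicator_of_mem hz _
      rw [← dom_cyl]
      exact α.2.2.1 P.cyl Q
    · beta_reduce
      have hz' := mapsTo_prodMap ha hb hz
      rw [indicator_of_mem hz, indicator_of_mem hz']
      ext v
      rw [ContinuousAlternatingMap.compContinuousLinearMap_apply,
        fibreInt_apply (α.continuousOn_cyl P' Q') hz, fibreInt_apply (α.continuousOn_cyl P Q) hz']
      refine intervalIntegral.integral_congr fun t ht => ?_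
      rw [uIcc_of_le zero_le_one] at ht
      have hd := (contDiffOn_prodMap ha hb).differentiableOn (by simp) z hz
      have hp : projCrd _ _ (cylPt t z) = z := rfl
      have hD := (hasFDerivWithinAt_prodMap_cylReparam (a := a) (b := b) (p := cylPt t z)
        hd).fderivWithin (dom_cyl P' Q' ▸ uniqueDiffOn_dom P'.cyl Q' _
          (dom_cyl P' Q' ▸ cylPt_mem ht hz))
      rw [α.2.2.2.2 P'.cyl P.cyl _ Q' Q b ha.cyl hb (cylPt t z) (dom_cyl P' Q' ▸ cylPt_mem ht hz),
        dom_cyl, hD, contr_compContinuousLinearMap (B := fderivWithin ℝ (Prod.map a b)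
          (dom P' Q') z)]
      · rfl
      · have h0 : (vert P'.dim Q'.dim).1 0 = 1 := rfl
        simp [projCrd_vert, h0]
      · intro v
        simp [projCrd_horiz, hp]
        simp [horiz_apply]⟩
  map_add' α β := by
    refine Form.ext fun P Q z hz => ?_
    change (dom P Q).indicator (fibreInt l.toNat ((α + β).1 P.cyl Q)) z =
      (dom P Q).indicator (fibreInt l.toNat (α.1 P.cyl Q)) z +
        (dom P Q).indicator (fibreInt l.toNat (β.1 P.cyl Q)) z
    simp only [indicator_of_mem hz]
    refine Eq.trans ?_ (intervalIntegral.integral_add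
      (intervalIntegrable_contr (α.continuousOn_cyl P Q) hz)
      (intervalIntegrable_contr (β.continuousOn_cyl P Q) hz))
    exact intervalIntegral.integral_congr fun t _ => map_add _ _ _
  map_smul' c α := by
    refine Form.ext fun P Q z hz => ?_
    change (dom P Q).indicator (fibreInt l.toNat ((c • α).1 P.cyl Q)) z =
      c • (dom P Q).indicator (fibreInt l.toNat (α.1 P.cyl Q)) z
    simp only [indicator_of_mem hz]
    refine Eq.trans ?_ (intervalIntegral.integral_smul c _)
    exact intervalIntegral.integral_congr fun t _ =>
      (contr P.dim Q.dim k.toNat l.toNat).map_smul c (α.1 P.cyl Q (cylPt t z))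

theorem Form.fibre_apply {k l : ℤ} (h : l + 1 = k) (α : Form (cyl M) X k) (P : MPlot M)
    (Q : XPlot X) {z : Crd P.dim Q.dim} (hz : z ∈ dom P Q) (v) :
    (Form.fibre h α).1 P Q z v =
      ∫ t in (0 : ℝ)..1, contr _ _ k.toNat l.toNat (α.1 P.cyl Q (cylPt t z)) v := by
  change (dom P Q).indicator (fibreInt l.toNat (α.1 P.cyl Q)) z v = _
  rw [indicator_of_mem hz, fibreInt_apply (α.continuousOn_cyl P Q) hz]

theorem Form.fibre_eq_fibreIntegral {k l : ℤ} (h : l + 1 = k) (α : Form (cyl M) X k) (P : MPlot M)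
    (Q : XPlot X) {z : Crd P.dim Q.dim} (hz : z ∈ dom P Q) (v) :
    (Form.fibre h α).1 P Q z v = fibreIntegral α P Q z v := by
  rw [Form.fibre_apply h α P Q hz, fibreIntegral]
  by_cases hk : k.toNat = l.toNat + 1
  · rw [dif_pos hk]
    refine intervalIntegral.integral_congr fun t _ => ?_
    generalize α.1 P.cyl Q = η
    revert η
    generalize k.toNat = a at hk
    subst hk
    intro η
    exact contr_succ_apply _ v
  · simp [dif_neg hk, contr_of_ne hk]

theorem Form.restrict_apply (s : Icc (0 : ℝ) 1) {k : ℤ} (α : Form (cyl M) X k) (P : MPlot M)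
    (Q : XPlot X) {z : Crd P.dim Q.dim} (hz : z ∈ dom P Q) :
    (Form.restrict s k α).1 P Q z =
      (α.1 P.cyl Q (cylPt s z)).compContinuousLinearMap (horiz _ _) := by
  have ha : (P.map (slice s M)).IsReparam P.cyl (fun u => Fin.cons (s : ℝ) u) :=
    { smooth := contDiffOn_pi.2 fun j => by
        refine Fin.cases ?_ (fun j => ?_) j
        · exact contDiffOn_const
        · exact (contDiff_apply ℝ ℝ j).contDiffOn
      mapsTo := fun u hu => ⟨s.2, hu⟩
      eq := fun u hu => by
        have : s = projIcc (0 : ℝ) 1 zero_le_one s := (projIcc_val zero_le_one s).symm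
        change (⟨(P.φ u).1, (s, (P.φ u).2)⟩ : (cyl M).Point) =
          ⟨(P.φ u).1, (projIcc (0 : ℝ) 1 zero_le_one s, (P.φ u).2)⟩
        rw [← this] }
  have hb : Q.IsReparam Q id := ⟨analyticOnNhd_id, fun _ h => h, fun _ _ => rfl⟩
  refine (α.2.2.2.2 (P.map (slice s M)) P.cyl _ Q Q id ha hb z hz).trans ?_
  have hD : fderivWithin ℝ (Prod.map (fun u : Fin P.dim → ℝ => (Fin.cons (s : ℝ) u :
      Fin (P.dim + 1) → ℝ)) (id : (Fin Q.dim → ℂ) → Fin Q.dim → ℂ)) (dom P Q) z =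
      horiz P.dim Q.dim :=
    (hasFDerivAt_cylPt (s : ℝ) z).hasFDerivWithinAt.fderivWithin (uniqueDiffOn_dom P Q z hz)
  exact congrArg (fun L => (α.1 P.cyl Q (cylPt s z)).compContinuousLinearMap L) hD

/-- Stokes' theorem: `∫ dα = α|_{t = 1} - α|_{t = 0} - d ∫ α`. -/
theorem Form.fibre_d {k k' l : ℤ} (h : l + 1 = k) (h' : k + 1 = k') (α : Form (cyl M) X k) :
    Form.fibre h' (Form.d k k' α) =
      Form.restrict 1 k α - Form.restrict 0 k α - Form.d l k (Form.fibre h α) := by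
  by_cases hk : k < 0
  · have : α = 0 := Subtype.ext (α.2.1 hk)
    rw [this]
    simp
  · obtain ⟨a, rfl⟩ := Int.eq_ofNat_of_zero_le (not_lt.1 hk)
    obtain rfl : k' = (a + 1 : ℕ) := by omega
    refine Form.ext fun P Q z hz => ?_
    change (dom P Q).indicator (fibreInt (a : ℤ).toNat ((dom P.cyl Q).indicator
      (extD (dom P.cyl Q) ((a + 1 : ℕ) : ℤ).toNat (α.1 P.cyl Q)))) z =
      (Form.restrict 1 _ α).1 P Q z - (Form.restrict 0 _ α).1 P Q z -
        (dom P Q).indicator (extD (dom P Q) (a : ℤ).toNat ((dom P Q).indicator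
          (fibreInt l.toNat (α.1 P.cyl Q)))) z
    have e : EqOn ((dom P Q).indicator (fibreInt l.toNat (α.1 P.cyl Q)))
      (fibreInt l.toNat (α.1 P.cyl Q)) (dom P Q) := fun z hz => indicator_of_mem hz _
    have hu := uniqueDiffOn_dom P.cyl Q
    have hs := α.2.2.1 P.cyl Q
    rw [indicator_of_mem hz, indicator_of_mem hz, extD_congr _ e hz, dom_cyl,
      Form.restrict_apply _ _ _ _ hz, Form.restrict_apply _ _ _ _ hz]
    rw [dom_cyl] at hu hs
    refine Eq.trans ?_ (fibreInt_extDerivWithin (uniqueDiffOn_dom P Q) (locallyConvexSet_dom P Q)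
      hu hs hz (by omega))
    refine intervalIntegral.integral_congr fun t ht => ?_
    rw [uIcc_of_le zero_le_one] at ht
    rw [indicator_of_mem (cylPt_mem ht hz)]
    exact congrArg _ (extD_self _ _ _)

theorem Form.fibre_pull (f : SmoothMap M N) (g : X ⟶ Y) {k l : ℤ} (h : l + 1 = k)
    (α : Form (cyl N) Y k) :
    Form.fibre h (Form.pull (cylMap f) g k α) = Form.pull f g l (Form.fibre h α) := rfl

theorem Form.fibre_invariants {k l : ℤ} (h : l + 1 = k) {α : Form (cyl M) X k}
    (hα : α ∈ Form.invariants (cyl M) X k) : Form.fibre h α ∈ Form.invariants M X l := by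
  funext P Q z
  change (Complex.conjCLE : ℂ →L[ℝ] ℂ).compContinuousAlternatingMap
    (((Form.fibre h α).1 P Q.conj (conjCrd _ _ z)).compContinuousLinearMap
      (conjCrd P.dim Q.dim : _ →L[ℝ] _)) = (Form.fibre h α).1 P Q z
  by_cases hz : z ∈ dom P Q
  · have hz' : conjCrd _ _ z ∈ dom P Q.conj := by
      rw [dom_conj] at hz
      exact hz
    ext v
    rw [Form.fibre_apply h α P Q hz]
    refine Eq.trans (congrArg (starRingEnd ℂ) (Form.fibre_apply h α P Q.conj hz' _)) ?_
    rw [intervalIntegral.integral_of_le zero_le_one, intervalIntegral.integral_of_le zero_le_one,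
      ← integral_conj]
    refine MeasureTheory.integral_congr_ae (Eventually.of_forall fun t => ?_)
    have h1 := congrFun (congrFun (congrFun (show galois α.1 = α.1 from hα) P.cyl) Q) (cylPt t z)
    have h2 : conjCrd (P.dim + 1) Q.dim (cylPt t z) = cylPt t (conjCrd P.dim Q.dim z) := rfl
    have h3 : contr P.dim Q.dim k.toNat l.toNat (α.1 P.cyl Q (cylPt t z)) =
        (Complex.conjCLE : ℂ →L[ℝ] ℂ).compContinuousAlternatingMap
          ((contr P.dim Q.dim k.toNat l.toNat (α.1 P.cyl Q.conj
            (cylPt t (conjCrd P.dim Q.dim z)))).compContinuousLinearMap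
              (conjCrd P.dim Q.dim : _ →L[ℝ] _)) := by
      rw [← h1, galois, contr_conj, h2]
      congr 1
      refine contr_compContinuousLinearMap _ ?_ fun v => rfl
      simp [conjCrd, vert]
    exact (congrArg (fun β => β v) h3).symm
  · have hz' : conjCrd _ _ z ∉ dom P Q.conj := by
      rw [dom_conj] at hz
      exact hz
    rw [(Form.fibre h α).2.2.2.1 _ _ _ hz, (Form.fibre h α).2.2.2.1 _ _ _ hz']
    ext v
    simp

/-! ### The comparison map and its homotopy inverse -/

/-- The projection `[0,1] × M → M`. -/
def cylProj (M : CornerMfd) : SmoothMap (cyl M) M where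
  toFun x := ⟨x.1, x.2.2⟩
  smooth := by
    intro (i : M.ι) (x : Icc (0 : ℝ) 1 × M.Pt i)
    exact ⟨i, Prod.snd, contMDiffAt_snd (I := 𝓡∂ 1) (J := M.model i),
      Eventually.of_forall fun _ => rfl⟩

/-- The map `(s, (t, m)) ↦ (s t, m)`, which contracts `[0,1] × M` to `{0} × M`. -/
def cylMul (M : CornerMfd) : SmoothMap (cyl (cyl M)) (cyl M) where
  toFun x := ⟨x.1, (x.2.1 * x.2.2.1, x.2.2.2)⟩
  smooth := by
    intro (i : M.ι) (x : Icc (0 : ℝ) 1 × Icc (0 : ℝ) 1 × M.Pt i)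
    have h1 : ContMDiffAt ((𝓡∂ 1).prod ((𝓡∂ 1).prod (M.model i))) 𝓘(ℝ) ∞
        (fun y : Icc (0 : ℝ) 1 × Icc (0 : ℝ) 1 × M.Pt i => (y.1 : ℝ) * (y.2.1 : ℝ)) x :=
      (contMDiff_subtypeVal_Icc.contMDiffAt.comp x contMDiffAt_fst).mul
        (contMDiff_subtypeVal_Icc.contMDiffAt.comp x (contMDiffAt_fst.comp x contMDiffAt_snd))
    have h2 : ContMDiffAt ((𝓡∂ 1).prod ((𝓡∂ 1).prod (M.model i))) (𝓡∂ 1) ∞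
        (fun y : Icc (0 : ℝ) 1 × Icc (0 : ℝ) 1 × M.Pt i =>
          projIcc (0 : ℝ) 1 zero_le_one ((y.1 : ℝ) * (y.2.1 : ℝ))) x :=
      contMDiffWithinAt_univ.1 ((contMDiffOn_projIcc _ (x.1 * x.2.1).2).comp x
        h1.contMDiffWithinAt fun y _ => (y.1 * y.2.1).2)
    have h3 : ContMDiffAt ((𝓡∂ 1).prod ((𝓡∂ 1).prod (M.model i))) (M.model i) ∞
        (fun y : Icc (0 : ℝ) 1 × Icc (0 : ℝ) 1 × M.Pt i => y.2.2) x :=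
      contMDiffAt_snd.comp x contMDiffAt_snd
    refine ⟨i, _, h2.prodMk h3, Eventually.of_forall fun y : Icc (0 : ℝ) 1 × Icc (0 : ℝ) 1 × M.Pt i
      => ?_⟩
    exact congrArg (fun t => (⟨i, (t, y.2.2)⟩ : (cyl M).Point))
      (projIcc_val zero_le_one (y.1 * y.2.1)).symm

/-- The coordinate `t` on `[0,1] × M`. -/
def time (x : (cyl M).Point) : ℝ := (show Icc (0 : ℝ) 1 × M.Pt x.1 from x.2).1

theorem Form.pull_one_apply (f : SmoothMap M N) {k : ℤ} (α : Form N X k) (P : MPlot M)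
    (Q : XPlot X) : (Form.pull f (𝟙 X) k α).1 P Q = α.1 (P.map f) Q :=
  XPlot.congr_ψ (T := fun m => Crd P.dim m → Crd P.dim m [⋀^Fin k.toNat]→L[ℝ] ℂ)
    (fun Q => α.1 (P.map f) Q) (funext fun _ => Category.comp_id _)

theorem Form.restrict_eq_pull (s : Icc (0 : ℝ) 1) {k : ℤ} (α : Form (cyl M) X k) :
    Form.restrict s k α = Form.pull (slice s M) (𝟙 X) k α :=
  Form.ext fun P Q z _ => (congrFun (Form.pull_one_apply (slice s M) α P Q) z).symm

theorem Form.pull_one_pull_one {K : CornerMfd} (f : SmoothMap M N) (f' : SmoothMap N K) {k : ℤ}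
    (α : Form K X k) :
    Form.pull f (𝟙 X) k (Form.pull f' (𝟙 X) k α) = Form.pull (f.comp f') (𝟙 X) k α := by
  rw [Form.pull_pull, Category.comp_id]

theorem contDiffOn_time (P : MPlot (cyl M)) :
    ContDiffOn ℝ ∞ (fun u => time (P.φ u)) P.U := by
  intro u hu
  obtain ⟨(j : M.ι), g, hg, h⟩ := P.smooth u hu
  have h1 : ContMDiffWithinAt 𝓘(ℝ, Fin P.dim → ℝ) 𝓘(ℝ) ∞
      (fun y => time (⟨j, g y⟩ : (cyl M).Point)) P.U u := by
    have h2 : ContMDiffAt ((𝓡∂ 1).prod (M.model j)) 𝓘(ℝ) ∞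
        (fun y : Icc (0 : ℝ) 1 × M.Pt j => (y.1 : ℝ)) (g u) :=
      contMDiff_subtypeVal_Icc.contMDiffAt.comp _ contMDiffAt_fst
    exact h2.comp_contMDiffWithinAt u hg
  refine (contMDiffWithinAt_iff_contDiffWithinAt.1 h1).congr_of_eventuallyEq ?_ ?_
  · filter_upwards [h] with y hy
    exact congrArg time hy
  · exact congrArg time (h.self_of_nhdsWithin hu)

/-- Multiplication of forms on `[0,1] × M × X(ℂ)` by the coordinate `t` of `[0,1]`. -/
def Form.tmul (k : ℤ) : Form (cyl M) X k →ₗ[ℝ] Form (cyl M) X k where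
  toFun α := ⟨fun P Q z => time (P.φ z.1) • α.1 P Q z, by
    refine ⟨fun hk => ?_, fun P Q => ?_, fun P Q z hz => ?_, fun P' P a Q' Q b ha hb z hz => ?_⟩
    · rw [α.2.1 hk]
      funext P Q z
      exact smul_zero (M := ℝ) (A := Crd P.dim Q.dim [⋀^Fin k.toNat]→L[ℝ] ℂ) _
    · exact ((contDiffOn_time P).comp contDiff_fst.contDiffOn fun _ hz => hz.1).smul (α.2.2.1 P Q)
    · beta_reduce
      rw [α.2.2.2.1 P Q z hz]
      exact smul_zero (M := ℝ) (A := Crd P.dim Q.dim [⋀^Fin k.toNat]→L[ℝ] ℂ) _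
    · beta_reduce
      rw [α.2.2.2.2 P' P a Q' Q b ha hb z hz, ha.eq z.1 hz.1]
      rfl⟩
  map_add' α β := Form.ext fun P Q z _ => smul_add _ (α.1 P Q z) (β.1 P Q z)
  map_smul' c α := Form.ext fun P Q z _ => smul_comm _ c (α.1 P Q z)

theorem Form.restrict_tmul (s : Icc (0 : ℝ) 1) {k : ℤ} (α : Form (cyl M) X k) :
    Form.restrict s k (Form.tmul k α) = (s : ℝ) • Form.restrict s k α := rfl

theorem Form.tmul_invariants {k : ℤ} {α : Form (cyl M) X k}
    (h : α ∈ Form.invariants (cyl M) X k) : Form.tmul k α ∈ Form.invariants (cyl M) X k := by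
  funext P Q z
  have h1 := congrFun (congrFun (congrFun (show galois α.1 = α.1 from h) P) Q) z
  change _ = time (P.φ z.1) • α.1 P Q z
  rw [← h1]
  ext v
  exact map_smul Complex.conjCLE _ _

theorem Form.restrict_pull_cylProj (s : Icc (0 : ℝ) 1) {k : ℤ} (α : Form M X k) :
    Form.restrict s k (Form.pull (cylProj M) (𝟙 X) k α) = α := by
  rw [Form.restrict_eq_pull, Form.pull_one_pull_one]
  exact Form.pull_id α

/-- Forms pulled back from `M × X(ℂ)` do not involve `dt`. -/
theorem Form.contr_pull_cylProj {k : ℤ} (b : ℕ) (α : Form M X k) (P : MPlot M) (Q : XPlot X)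
    {z : Crd P.dim Q.dim} (hz : z ∈ dom P Q) {t : ℝ} (ht : t ∈ Icc (0 : ℝ) 1) :
    contr _ _ k.toNat b ((Form.pull (cylProj M) (𝟙 X) k α).1 P.cyl Q (cylPt t z)) = 0 := by
  by_cases hk : k.toNat = b + 1
  · have ha : (P.cyl.map (cylProj M)).IsReparam P Fin.tail :=
      { smooth := (contDiff_pi.2 fun j => contDiff_apply ℝ ℝ _).contDiffOn
        mapsTo := fun u hu => hu.2
        eq := fun u hu => rfl }
    have hb : Q.IsReparam Q id := ⟨analyticOnNhd_id, fun _ h => h, fun _ _ => rfl⟩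
    have hz' : cylPt t z ∈ dom P.cyl Q := dom_cyl P Q ▸ cylPt_mem ht hz
    have hD : fderivWithin ℝ (Prod.map (Fin.tail : (Fin (P.dim + 1) → ℝ) → Fin P.dim → ℝ)
        (id : (Fin Q.dim → ℂ) → Fin Q.dim → ℂ)) (dom P.cyl Q) (cylPt t z) =
        projCrd P.dim Q.dim :=
      (projCrd P.dim Q.dim).hasFDerivWithinAt.fderivWithin (uniqueDiffOn_dom P.cyl Q _ hz')
    have h1 := α.2.2.2.2 (P.cyl.map (cylProj M)) P _ Q Q id ha hb (cylPt t z) hz'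
    rw [Form.pull_one_apply]
    refine (congrArg (contr _ _ k.toNat b) (h1.trans
      (congrArg (fun L => (α.1 P Q z).compContinuousLinearMap L) hD))).trans ?_
    generalize α.1 P Q z = η
    revert η
    generalize k.toNat = a at hk
    subst hk
    intro η
    ext v
    rw [contr_succ_apply, ContinuousAlternatingMap.compContinuousLinearMap_apply]
    exact η.map_coord_zero 0 (by simp [projCrd_vert])
  · rw [contr_of_ne hk]
    rfl

theorem Form.fibre_pull_cylProj {k l : ℤ} (h : l + 1 = k) (α : Form M X k) :
    Form.fibre h (Form.pull (cylProj M) (𝟙 X) k α) = 0 := by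
  refine Form.ext fun P Q z hz => ?_
  ext v
  rw [Form.fibre_apply h _ P Q hz]
  refine Eq.trans (intervalIntegral.integral_congr (g := fun _ => 0) fun t ht => ?_)
    intervalIntegral.integral_zero
  rw [uIcc_of_le zero_le_one] at ht
  beta_reduce
  rw [Form.contr_pull_cylProj _ α P Q hz ht]
  rfl

theorem Form.fibre_tmul_pull_cylProj {k l : ℤ} (h : l + 1 = k) (α : Form M X k) :
    Form.fibre h (Form.tmul k (Form.pull (cylProj M) (𝟙 X) k α)) = 0 := by
  refine Form.ext fun P Q z hz => ?_
  ext v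
  rw [Form.fibre_apply h _ P Q hz]
  refine Eq.trans (intervalIntegral.integral_congr (g := fun _ => 0) fun t ht => ?_)
    intervalIntegral.integral_zero
  rw [uIcc_of_le zero_le_one] at ht
  have h1 := (contr P.dim Q.dim k.toNat l.toNat).map_smul
    (time (P.cyl.φ (cylPt t z).1)) ((Form.pull (cylProj M) (𝟙 X) k α).1 P.cyl Q (cylPt t z))
  rw [Form.contr_pull_cylProj _ α P Q hz ht, smul_zero] at h1
  exact congrArg (fun β => β v) h1

/-- The triple `(ω|_{t = 0} ⊕ ω|_{t = 1}, -∫ ω)`. -/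
def Form.toCone {k l : ℤ} (h : l + 1 = k) :
    Form (cyl M) X k →ₗ[ℝ] Form M X k × Form M X k × Form M X l :=
  (Form.restrict 0 k).prod ((Form.restrict 1 k).prod (-Form.fibre h))

/-- The form `α - d(tγ) - t (α - β - dγ)`, where forms on `M × X(ℂ)` are pulled back to
`[0,1] × M × X(ℂ)`.  It equals `(1 - t) α + t β - dt ∧ γ`, but in the given shape
it visibly commutes with the differentials. -/
def Form.ofCone (k l : ℤ) :
    Form M X k × Form M X k × Form M X l →ₗ[ℝ] Form (cyl M) X k where
  toFun x := Form.pull (cylProj M) (𝟙 X) k x.1 -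
    Form.d l k (Form.tmul l (Form.pull (cylProj M) (𝟙 X) l x.2.2)) -
    Form.tmul k (Form.pull (cylProj M) (𝟙 X) k (x.1 - x.2.1 - Form.d l k x.2.2))
  map_add' x y := by
    simp only [Prod.fst_add, Prod.snd_add, map_add, map_sub]
    abel
  map_smul' c x := by
    simp only [Prod.smul_fst, Prod.smul_snd, map_smul, map_sub, RingHom.id_apply, smul_sub]

theorem Form.toCone_ofCone {k l l' : ℤ} (h : l + 1 = k) (h' : l' + 1 = l)
    (x : Form M X k × Form M X k × Form M X l) : Form.toCone h (Form.ofCone k l x) = x := by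
  have hr (s : Icc (0 : ℝ) 1) : Form.restrict s k (Form.ofCone k l x) =
      x.1 - (s : ℝ) • Form.d l k x.2.2 - (s : ℝ) • (x.1 - x.2.1 - Form.d l k x.2.2) := by
    change Form.restrict s k (_ - _ - _) = _
    rw [map_sub, map_sub, Form.restrict_tmul, Form.restrict_d, Form.restrict_tmul,
      Form.restrict_pull_cylProj, Form.restrict_pull_cylProj, Form.restrict_pull_cylProj, map_smul]
  refine Prod.ext ?_ (Prod.ext ?_ ?_)
  · change Form.restrict 0 k (Form.ofCone k l x) = _
    rw [hr]
    simp
  · change Form.restrict 1 k (Form.ofCone k l x) = _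
    rw [hr]
    simp
  · change -Form.fibre h (_ - _ - _) = _
    rw [map_sub, map_sub, Form.fibre_pull_cylProj, Form.fibre_tmul_pull_cylProj,
      Form.fibre_d h', Form.restrict_tmul, Form.restrict_tmul, Form.restrict_pull_cylProj,
      Form.restrict_pull_cylProj, Form.fibre_tmul_pull_cylProj]
    simp

theorem Form.d_ofCone {k k' l : ℤ}
    (x : Form M X k × Form M X k × Form M X l) :
    Form.d k k' (Form.ofCone k l x) =
      Form.ofCone k' k (Form.d k k' x.1, Form.d k k' x.2.1, x.1 - x.2.1 - Form.d l k x.2.2) := by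
  change Form.d k k' (_ - _ - _) = Form.pull _ _ _ _ - Form.d _ _ _ - Form.tmul _ _
  rw [map_sub, map_sub, Form.d_d, Form.d_pull]
  simp [Form.d_d]

theorem Form.restrict_invariants (s : Icc (0 : ℝ) 1) {k : ℤ} {α : Form (cyl M) X k}
    (h : α ∈ Form.invariants (cyl M) X k) : Form.restrict s k α ∈ Form.invariants M X k := by
  rw [Form.restrict_eq_pull]
  exact Form.pull_invariants _ _ h

theorem Form.toCone_pull (f : SmoothMap M N) (g : X ⟶ Y) {k l : ℤ} (h : l + 1 = k)
    (α : Form (cyl N) Y k) :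
    Form.toCone h (Form.pull (cylMap f) g k α) =
      ((Form.pull f g k).prodMap ((Form.pull f g k).prodMap (Form.pull f g l)))
        (Form.toCone h α) := by
  refine Prod.ext rfl (Prod.ext rfl ?_)
  exact (map_neg (Form.pull f g l) (Form.fibre h α)).symm

theorem Form.ofCone_invariants {k l : ℤ} {x : Form M X k × Form M X k × Form M X l}
    (h1 : x.1 ∈ Form.invariants M X k) (h2 : x.2.1 ∈ Form.invariants M X k)
    (h3 : x.2.2 ∈ Form.invariants M X l) :
    Form.ofCone k l x ∈ Form.invariants (cyl M) X k :=
  Submodule.sub_mem _ (Submodule.sub_mem _ (Form.pull_invariants _ _ h1)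
    (Form.d_invariants _ (Form.tmul_invariants (Form.pull_invariants _ _ h3))))
    (Form.tmul_invariants (Form.pull_invariants _ _ (Submodule.sub_mem _
      (Submodule.sub_mem _ h1 h2) (Form.d_invariants _ h3))))

/-- The projection `ω ↦ ω - s (q ω)` onto the kernel of `q = Form.toCone`, where
`s = Form.ofCone`. -/
def Form.toKer {k l : ℤ} (h : l + 1 = k) : Form (cyl M) X k →ₗ[ℝ] Form (cyl M) X k :=
  LinearMap.id - (Form.ofCone k l).comp (Form.toCone h)

theorem Form.toCone_toKer {k l : ℤ} (h : l + 1 = k) (α : Form (cyl M) X k) :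
    Form.toCone h (Form.toKer h α) = 0 := by
  change Form.toCone h (α - Form.ofCone k l (Form.toCone h α)) = 0
  rw [map_sub, Form.toCone_ofCone h (l' := l - 1) (by omega), sub_self]

theorem Form.toKer_d {k k' l : ℤ} (h : l + 1 = k) (h' : k + 1 = k') (α : Form (cyl M) X k) :
    Form.toKer h' (Form.d k k' α) = Form.d k k' (Form.toKer h α) := by
  change Form.d k k' α - Form.ofCone k' k (Form.toCone h' (Form.d k k' α)) =
    Form.d k k' (α - Form.ofCone k l (Form.toCone h α))
  rw [map_sub, Form.d_ofCone]
  congr 2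
  refine Prod.ext rfl (Prod.ext rfl ?_)
  change -Form.fibre h' (Form.d k k' α) = Form.restrict 0 k α - Form.restrict 1 k α -
    Form.d l k (-Form.fibre h α)
  rw [Form.fibre_d h, map_neg]
  abel

theorem Form.toKer_invariants {k l : ℤ} (h : l + 1 = k) {α : Form (cyl M) X k}
    (hα : α ∈ Form.invariants (cyl M) X k) : Form.toKer h α ∈ Form.invariants (cyl M) X k :=
  Submodule.sub_mem _ hα (Form.ofCone_invariants (Form.restrict_invariants 0 hα)
    (Form.restrict_invariants 1 hα)
    (Submodule.neg_mem _ (Form.fibre_invariants h hα)))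

/-- The homotopy operator of the contraction of `[0,1] × M` to `{0} × M`: the integral over
`s ∈ [0,1]` of the pull-back along `(s, t, m) ↦ (s t, m)`. -/
def Form.cone {k l : ℤ} (h : l + 1 = k) : Form (cyl M) X k →ₗ[ℝ] Form (cyl M) X l :=
  (Form.fibre h).comp (Form.pull (cylMul M) (𝟙 X) k)

theorem Form.cone_invariants {k l : ℤ} (h : l + 1 = k) {α : Form (cyl M) X k}
    (hα : α ∈ Form.invariants (cyl M) X k) : Form.cone h α ∈ Form.invariants (cyl M) X l :=
  Form.fibre_invariants h (Form.pull_invariants _ _ hα)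

theorem slice_zero_comp_cylMul :
    (slice 0 (cyl M)).comp (cylMul M) = (cylProj M).comp (slice 0 M) := by
  refine SmoothMap.ext (funext fun (x : (cyl M).Point) => ?_)
  exact congrArg (fun t => (⟨x.1, (t, x.2.2)⟩ : (cyl M).Point)) (zero_mul _)

theorem slice_one_comp_cylMul :
    (slice 1 (cyl M)).comp (cylMul M) = SmoothMap.id (cyl M) := by
  refine SmoothMap.ext (funext fun (x : (cyl M).Point) => ?_)
  exact congrArg (fun t => (⟨x.1, (t, x.2.2)⟩ : (cyl M).Point)) (one_mul _)

theorem cylMap_slice_zero_comp_cylMul :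
    (cylMap (slice 0 M)).comp (cylMul M) = (cylProj M).comp (slice 0 M) := by
  refine SmoothMap.ext (funext fun (x : (cyl M).Point) => ?_)
  exact congrArg (fun t => (⟨x.1, (t, x.2.2)⟩ : (cyl M).Point)) (mul_zero _)

theorem cylMap_slice_one_comp_cylMul :
    (cylMap (slice 1 M)).comp (cylMul M) = SmoothMap.id (cyl M) := by
  refine SmoothMap.ext (funext fun (x : (cyl M).Point) => ?_)
  exact congrArg (fun t => (⟨x.1, (t, x.2.2)⟩ : (cyl M).Point)) (mul_one _)

/-- The homotopy formula for the contraction, on forms which vanish at `t = 0`. -/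
theorem Form.cone_d {k k' l : ℤ} (h : l + 1 = k) (h' : k + 1 = k') {α : Form (cyl M) X k}
    (hα : Form.restrict 0 k α = 0) :
    Form.cone h' (Form.d k k' α) = α - Form.d l k (Form.cone h α) := by
  change Form.fibre h' (Form.pull (cylMul M) (𝟙 X) k' (Form.d k k' α)) = _
  rw [← Form.d_pull, Form.fibre_d h, Form.restrict_eq_pull, Form.restrict_eq_pull,
    Form.pull_one_pull_one, Form.pull_one_pull_one, slice_one_comp_cylMul, Form.pull_id,
    slice_zero_comp_cylMul, ← Form.pull_one_pull_one, ← Form.restrict_eq_pull, hα, map_zero,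
    sub_zero]
  rfl

theorem Form.restrict_zero_cone {k l : ℤ} (h : l + 1 = k) {α : Form (cyl M) X k}
    (hα : Form.restrict 0 k α = 0) : Form.restrict 0 l (Form.cone h α) = 0 := by
  rw [Form.restrict_eq_pull]
  change Form.pull _ _ _ (Form.fibre h _) = 0
  rw [← Form.fibre_pull, Form.pull_one_pull_one, cylMap_slice_zero_comp_cylMul,
    ← Form.pull_one_pull_one, ← Form.restrict_eq_pull, hα, map_zero, map_zero]

theorem Form.restrict_one_cone {k l : ℤ} (h : l + 1 = k) (α : Form (cyl M) X k) :
    Form.restrict 1 l (Form.cone h α) = Form.fibre h α := by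
  rw [Form.restrict_eq_pull]
  change Form.pull _ _ _ (Form.fibre h _) = _
  rw [← Form.fibre_pull, Form.pull_one_pull_one, cylMap_slice_one_comp_cylMul, Form.pull_id]

/-- The map `q : IDR(p)^n(M × X) → DR(p)^n(M × X)`. -/
def toDR (p : ℕ) (M : CornerMfd) (X : Scheme.{0}) (n : ℤ) : idr p M X n →ₗ[ℝ] dr p M X n :=
  (Form.toCone (sub_add_cancel (n + 2 * (p : ℤ)) 1)).restrict fun _ h =>
    ⟨⟨h.1.1, Form.restrict_invariants 0 h.2⟩, ⟨h.1.2, Form.restrict_invariants 1 h.2⟩,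
      Submodule.neg_mem _ (Form.fibre_invariants _ h.2)⟩

/-- The section `s : DR(p)^n(M × X) → IDR(p)^n(M × X)` of `q`. -/
def ofDR (p : ℕ) (M : CornerMfd) (X : Scheme.{0}) (n : ℤ) : dr p M X n →ₗ[ℝ] idr p M X n :=
  (Form.ofCone (n + 2 * (p : ℤ)) (n + 2 * (p : ℤ) - 1)).restrict fun x hx => by
    have e := Form.toCone_ofCone (sub_add_cancel (n + 2 * (p : ℤ)) 1)
      (sub_add_cancel (n + 2 * (p : ℤ) - 1) 1) x
    obtain ⟨⟨h1, h2⟩, ⟨h3, h4⟩, h5⟩ := hx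
    refine ⟨⟨?_, ?_⟩, Form.ofCone_invariants h2 h4 h5⟩
    · change Form.restrict 0 _ (Form.ofCone _ _ x) ∈ Form.real M X p _
      rw [show Form.restrict 0 _ (Form.ofCone _ _ x) = x.1 from congrArg Prod.fst e]
      exact h1
    · change Form.restrict 1 _ (Form.ofCone _ _ x) ∈ Form.hodge M X p _
      rw [show Form.restrict 1 _ (Form.ofCone _ _ x) = x.2.1 from
        congrArg (fun y => y.2.1) e]
      exact h3

theorem coneD_toCone (p : ℕ) {i j : ℤ} (h : i + 1 = j) (α : Form (cyl M) X (i + 2 * p)) :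
    coneD p M X i j (Form.toCone (sub_add_cancel (i + 2 * (p : ℤ)) 1) α) =
      Form.toCone (sub_add_cancel (j + 2 * (p : ℤ)) 1) (Form.d (i + 2 * p) (j + 2 * p) α) := by
  subst h
  refine Prod.ext rfl (Prod.ext rfl ?_)
  change Form.cast (i + 2 * p) (i + 1 + 2 * p - 1) (Form.restrict 0 _ α - Form.restrict 1 _ α) -
    Form.d (i + 2 * p - 1) (i + 1 + 2 * p - 1) (-Form.fibre _ α) = -Form.fibre _ (Form.d _ _ α)
  have e : i + 1 + 2 * (p : ℤ) - 1 = i + 2 * p := by omega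
  generalize_proofs h1 h2
  revert h2
  generalize i + 1 + 2 * (p : ℤ) - 1 = l at e
  subst e
  intro h2
  rw [Form.cast_self, Form.fibre_d h1, map_neg]
  abel

theorem ofCone_coneD (p : ℕ) {i j : ℤ} (h : i + 1 = j)
    (x : Form M X (i + 2 * p) × Form M X (i + 2 * p) × Form M X (i + 2 * p - 1)) :
    Form.ofCone (j + 2 * p) (j + 2 * p - 1) (coneD p M X i j x) =
      Form.d (i + 2 * p) (j + 2 * p) (Form.ofCone (i + 2 * p) (i + 2 * p - 1) x) := by
  subst h
  rw [Form.d_ofCone]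
  change Form.ofCone (i + 1 + 2 * p) (i + 1 + 2 * p - 1) (Form.d _ _ x.1, Form.d _ _ x.2.1,
    Form.cast (i + 2 * p) (i + 1 + 2 * p - 1) (x.1 - x.2.1) -
      Form.d (i + 2 * p - 1) (i + 1 + 2 * p - 1) x.2.2) = _
  have e : i + 1 + 2 * (p : ℤ) - 1 = i + 2 * p := by omega
  generalize i + 1 + 2 * (p : ℤ) - 1 = l at e
  subst e
  rw [Form.cast_self]

/-- The morphism `q : IDR(p) → DR(p)`. -/
def qMap (p : ℕ) : IDRp p ⟶ DRp p where
  app Z :=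
    { f := fun n => ModuleCat.ofHom (toDR p Z.unop.1 Z.unop.2.obj n)
      comm' := fun i j h => by
        refine ModuleCat.hom_ext (LinearMap.ext
          fun (x : idr p Z.unop.1 Z.unop.2.obj i) => Subtype.ext ?_)
        exact coneD_toCone p h x.1 }
  naturality Z W f := by
    refine HomologicalComplex.hom_ext _ _ fun n => ModuleCat.hom_ext (LinearMap.ext
      fun (x : idr p Z.unop.1 Z.unop.2.obj n) => Subtype.ext ?_)
    exact Form.toCone_pull f.unop.1 f.unop.2.hom _ x.1

/-- The section `s` of `q` on `M × X`, as a map of complexes. -/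
def sMap (p : ℕ) (Z : Pairsᵒᵖ) : (DRp p).obj Z ⟶ (IDRp p).obj Z where
  f n := ModuleCat.ofHom (ofDR p Z.unop.1 Z.unop.2.obj n)
  comm' i j h := by
    refine ModuleCat.hom_ext (LinearMap.ext
      fun (x : dr p Z.unop.1 Z.unop.2.obj i) => Subtype.ext ?_)
    exact (ofCone_coneD p h x.1).symm

/-- The homotopy operator `IDR(p)^i → IDR(p)^j`, `j = i - 1`, between `s ∘ q` and the identity.  The
boundary conditions hold because a form in the kernel of `q` vanishes at `t = 0` and has vanishing
fibre integral, and the latter is the restriction to `t = 1` of its image under `Form.cone`. -/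
def idrHomotopy (p : ℕ) (M : CornerMfd) (X : Scheme.{0}) {i j : ℤ} (h : j + 1 = i) :
    idr p M X i →ₗ[ℝ] idr p M X j :=
  (-(Form.cone (by omega : j + 2 * (p : ℤ) + 1 = i + 2 * p)).comp
    (Form.toKer (by omega : j + 2 * (p : ℤ) + 1 = i + 2 * p))).restrict fun α hα => by
    have h' : j + 2 * (p : ℤ) + 1 = i + 2 * p := by omega
    have e := Form.toCone_toKer h' α
    have e0 : Form.restrict 0 _ (Form.toKer h' α) = 0 := congrArg Prod.fst e
    have e2 : Form.fibre h' (Form.toKer h' α) = 0 := neg_eq_zero.1 (congrArg (fun y => y.2.2) e)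
    refine Submodule.neg_mem _ ⟨⟨?_, ?_⟩, Form.cone_invariants h' (Form.toKer_invariants h' hα.2)⟩
    · change Form.restrict 0 _ (Form.cone h' (Form.toKer h' α)) ∈ Form.real M X p _
      rw [Form.restrict_zero_cone h' e0]
      exact Submodule.zero_mem _
    · change Form.restrict 1 _ (Form.cone h' (Form.toKer h' α)) ∈ Form.hodge M X p _
      rw [Form.restrict_one_cone, e2]
      exact Submodule.zero_mem _

/-- The homotopy `s q - 1 = d h + h d` with `h` the negative of the homotopy operator of the
contraction, applied after the projection to the kernel of `q`. -/
theorem ofCone_toCone_eq {i j k l : ℤ} (hl : l + 1 = j) (hij : i + 1 = j) (hjk : j + 1 = k)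
    (α : Form (cyl M) X j) :
    Form.ofCone j l (Form.toCone hl α) =
      -Form.cone hjk (Form.toKer hjk (Form.d j k α)) +
        Form.d i j (-Form.cone hij (Form.toKer hij α)) + α := by
  obtain rfl : l = i := by omega
  have e0 : Form.restrict 0 _ (Form.toKer hij α) = 0 :=
    congrArg Prod.fst (Form.toCone_toKer hij α)
  rw [Form.toKer_d hij, Form.cone_d hij hjk e0, map_neg]
  change _ = -(α - Form.ofCone j l (Form.toCone hij α) - _) + _ + _
  abel

/-- The operator `idrHomotopy`, extended by zero to all pairs of degrees. -/
def idrH (p : ℕ) (M : CornerMfd) (X : Scheme.{0}) (i j : ℤ) : idr p M X i →ₗ[ℝ] idr p M X j :=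
  if h : j + 1 = i then idrHomotopy p M X h else 0

theorem idrH_apply (p : ℕ) {i j : ℤ} (h : j + 1 = i) (x : idr p M X i) :
    (idrH p M X i j x).1 = -Form.cone (by omega : j + 2 * (p : ℤ) + 1 = i + 2 * p)
      (Form.toKer (by omega : j + 2 * (p : ℤ) + 1 = i + 2 * p) x.1) := by
  rw [idrH, dif_pos h]
  rfl

theorem ofDR_toDR (p : ℕ) (i : ℤ) (x : idr p M X i) :
    ofDR p M X i (toDR p M X i x) =
      idrH p M X (i + 1) i (idrD p M X i (i + 1) x) +
        idrD p M X (i - 1) i (idrH p M X i (i - 1) x) + x := by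
  refine Subtype.ext ?_
  change Form.ofCone _ _ (Form.toCone _ x.1) = (idrH p M X (i + 1) i _).1 +
    Form.d _ _ (idrH p M X i (i - 1) x).1 + x.1
  rw [idrH_apply p rfl, idrH_apply p (sub_add_cancel i 1)]
  exact ofCone_toCone_eq _ _ _ x.1

/-- The homotopy operators on `IDR(p)(M × X)`, as morphisms of vector spaces. -/
def idrHom (p : ℕ) (Z : Pairsᵒᵖ) (i j : ℤ) : ((IDRp p).obj Z).X i ⟶ ((IDRp p).obj Z).X j :=
  ModuleCat.ofHom (idrH p Z.unop.1 Z.unop.2.obj i j)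

/-- `q` and `s` are homotopy inverse to each other. -/
def qHomotopyEquiv (p : ℕ) (Z : Pairsᵒᵖ) : HomotopyEquiv ((IDRp p).obj Z) ((DRp p).obj Z) where
  hom := (qMap p).app Z
  inv := sMap p Z
  homotopyHomInvId :=
    { hom := idrHom p Z
      zero := fun i j h => by
        have : idrH p Z.unop.1 Z.unop.2.obj i j = 0 := dif_neg h
        rw [idrHom, this]
        rfl
      comm := fun i => by
        rw [dNext_eq _ (show (ComplexShape.up ℤ).Rel i (i + 1) from rfl),
          prevD_eq _ (show (ComplexShape.up ℤ).Rel (i - 1) i from sub_add_cancel i 1)]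
        refine ModuleCat.hom_ext (LinearMap.ext fun (x : idr p Z.unop.1 Z.unop.2.obj i) => ?_)
        exact ofDR_toDR p i x }
  homotopyInvHomId := Homotopy.ofEq (by
    refine HomologicalComplex.hom_ext _ _ fun n => ModuleCat.hom_ext (LinearMap.ext
      fun (x : dr p Z.unop.1 Z.unop.2.obj n) => Subtype.ext ?_)
    exact Form.toCone_ofCone _ (sub_add_cancel _ 1) x.1)

theorem quasiIso_qMap (p : ℕ) (Z : Pairsᵒᵖ) : QuasiIso ((qMap p).app Z) :=
  (qHomotopyEquiv p Z).quasiIso_hom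

/-! ### Antisymmetrisation of functions of several vectors -/

section

variable {E F : Type}

/-- The antisymmetrisation `∑_σ sign(σ) f(v ∘ σ)` of a function `f` of `k` vectors. -/
def asym {k : ℕ} (f : (Fin k → E) → ℂ) (v : Fin k → E) : ℂ :=
  ∑ σ : Equiv.Perm (Fin k), ((Equiv.Perm.sign σ : ℤ) : ℂ) * f (v ∘ σ)

/-- The product `f(v_0, …, v_{a-1}) g(v_a, …, v_{c-1})` for `c = a + b`. -/
def tens {a b c : ℕ} (h : a + b = c) (f : (Fin a → E) → ℂ) (g : (Fin b → E) → ℂ)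
    (v : Fin c → E) : ℂ :=
  f (fun i => v (Fin.cast h (Fin.castAdd b i))) * g (fun j => v (Fin.cast h (Fin.natAdd a j)))

theorem sign_mul_self_cast {k : ℕ} (σ : Equiv.Perm (Fin k)) :
    ((Equiv.Perm.sign σ : ℤ) : ℂ) * ((Equiv.Perm.sign σ : ℤ) : ℂ) = 1 := by
  rw [← Int.cast_mul, ← Units.val_mul, Int.units_mul_self]
  simp

theorem asym_comp_perm {k : ℕ} (f : (Fin k → E) → ℂ) (τ : Equiv.Perm (Fin k)) (v : Fin k → E) :
    asym (fun u => f (u ∘ τ)) v = ((Equiv.Perm.sign τ : ℤ) : ℂ) * asym f v := by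
  rw [asym, asym, Finset.mul_sum, ← Equiv.sum_comp (Equiv.mulRight τ)
    (fun σ => ((Equiv.Perm.sign τ : ℤ) : ℂ) * (((Equiv.Perm.sign σ : ℤ) : ℂ) * f (v ∘ σ)))]
  refine Finset.sum_congr rfl fun σ _ => ?_
  simp only [Equiv.coe_mulRight, Equiv.Perm.sign_mul, Units.val_mul, Int.cast_mul]
  have e : f ((v ∘ σ) ∘ τ) = f (v ∘ ⇑(σ * τ)) := rfl
  rw [e]
  linear_combination (-((Equiv.Perm.sign σ : ℤ) : ℂ) * f (v ∘ ⇑(σ * τ))) * sign_mul_self_cast τ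

theorem asym_of_antisymmetric {k : ℕ} {f : (Fin k → E) → ℂ}
    (hf : ∀ (σ : Equiv.Perm (Fin k)) v, f (v ∘ σ) = ((Equiv.Perm.sign σ : ℤ) : ℂ) * f v)
    (v : Fin k → E) : asym f v = k.factorial * f v := by
  simp only [asym, hf, ← mul_assoc, sign_mul_self_cast, one_mul, Finset.sum_const,
    Finset.card_univ, Fintype.card_perm, Fintype.card_fin, nsmul_eq_mul]

theorem asym_sum {k : ℕ} {ι : Type*} (s : Finset ι) (f : ι → (Fin k → E) → ℂ) (v : Fin k → E) :
    asym (fun u => ∑ i ∈ s, f i u) v = ∑ i ∈ s, asym (f i) v := by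
  simp only [asym, Finset.mul_sum]
  exact Finset.sum_comm

theorem asym_const_mul {k : ℕ} (c : ℂ) (f : (Fin k → E) → ℂ) (v : Fin k → E) :
    asym (fun u => c * f u) v = c * asym f v := by
  simp only [asym, Finset.mul_sum]
  exact Finset.sum_congr rfl fun σ _ => by ring

/-- The permutation of `Fin c`, where `c = a + b`, given by permutations of the two blocks. -/
def blockPerm {a b c : ℕ} (h : a + b = c) (σ : Equiv.Perm (Fin a)) (τ : Equiv.Perm (Fin b)) :
    Equiv.Perm (Fin c) :=
  (finSumFinEquiv.trans (finCongr h)).permCongr (Equiv.Perm.sumCongr σ τ)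

theorem blockPerm_castAdd {a b c : ℕ} (h : a + b = c) (σ : Equiv.Perm (Fin a))
    (τ : Equiv.Perm (Fin b)) (i : Fin a) :
    blockPerm h σ τ (Fin.cast h (Fin.castAdd b i)) = Fin.cast h (Fin.castAdd b (σ i)) := by
  subst h
  simp [blockPerm, Equiv.permCongr_apply]

theorem blockPerm_natAdd {a b c : ℕ} (h : a + b = c) (σ : Equiv.Perm (Fin a))
    (τ : Equiv.Perm (Fin b)) (j : Fin b) :
    blockPerm h σ τ (Fin.cast h (Fin.natAdd a j)) = Fin.cast h (Fin.natAdd a (τ j)) := by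
  subst h
  simp [blockPerm, Equiv.permCongr_apply]

theorem sign_blockPerm {a b c : ℕ} (h : a + b = c) (σ : Equiv.Perm (Fin a))
    (τ : Equiv.Perm (Fin b)) :
    Equiv.Perm.sign (blockPerm h σ τ) = Equiv.Perm.sign σ * Equiv.Perm.sign τ := by
  rw [blockPerm, Equiv.Perm.sign_permCongr, Equiv.Perm.sign_sumCongr]

theorem tens_comp_blockPerm {a b c : ℕ} (h : a + b = c) (f : (Fin a → E) → ℂ)
    (g : (Fin b → E) → ℂ) (σ : Equiv.Perm (Fin a)) (τ : Equiv.Perm (Fin b)) (v : Fin c → E) :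
    tens h f g (v ∘ blockPerm h σ τ) = tens h (fun u => f (u ∘ σ)) (fun u => g (u ∘ τ)) v := by
  simp only [tens, Function.comp_apply, blockPerm_castAdd, blockPerm_natAdd]
  rfl

/-- A permutation of the first block extends to a permutation of all arguments with the same sign,
so it is absorbed by the outer antisymmetrisation. -/
theorem asym_tens_asym_left {a b c : ℕ} (h : a + b = c) (f : (Fin a → E) → ℂ)
    (g : (Fin b → E) → ℂ) (v : Fin c → E) :
    asym (tens h (asym f) g) v = a.factorial * asym (tens h f g) v := by
  have e : tens h (asym f) g = fun u => ∑ σ : Equiv.Perm (Fin a),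
      ((Equiv.Perm.sign σ : ℤ) : ℂ) * tens h f g (u ∘ blockPerm h σ 1) := by
    funext u
    simp only [tens_comp_blockPerm]
    simp only [tens, asym, Finset.sum_mul, mul_assoc]
    rfl
  rw [e, asym_sum]
  simp only [asym_const_mul, asym_comp_perm (tens h f g), sign_blockPerm, map_one, mul_one,
    ← mul_assoc, sign_mul_self_cast, one_mul, Finset.sum_const,
    Finset.card_univ, Fintype.card_perm, Fintype.card_fin, nsmul_eq_mul]

theorem asym_tens_asym_right {a b c : ℕ} (h : a + b = c) (f : (Fin a → E) → ℂ)
    (g : (Fin b → E) → ℂ) (v : Fin c → E) :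
    asym (tens h f (asym g)) v = b.factorial * asym (tens h f g) v := by
  have e : tens h f (asym g) = fun u => ∑ σ : Equiv.Perm (Fin b),
      ((Equiv.Perm.sign σ : ℤ) : ℂ) * tens h f g (u ∘ blockPerm h 1 σ) := by
    funext u
    simp only [tens_comp_blockPerm]
    simp only [tens, asym, Finset.mul_sum]
    exact Finset.sum_congr rfl fun σ _ => mul_left_comm _ _ _
  rw [e, asym_sum]
  simp only [asym_const_mul, asym_comp_perm (tens h f g), sign_blockPerm, map_one, one_mul,
    ← mul_assoc, sign_mul_self_cast, Finset.sum_const,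
    Finset.card_univ, Fintype.card_perm, Fintype.card_fin, nsmul_eq_mul]

theorem tens_assoc {a b c ab bc k : ℕ} (h₁ : a + b = ab) (h₂ : ab + c = k) (h₃ : b + c = bc)
    (h₄ : a + bc = k) (f : (Fin a → E) → ℂ) (g : (Fin b → E) → ℂ) (l : (Fin c → E) → ℂ) :
    tens h₂ (tens h₁ f g) l = tens h₄ f (tens h₃ g l) := by
  subst h₁ h₃ h₂
  funext v
  simp only [tens, mul_assoc]
  refine congrArg₂ _ (congrArg f (funext fun i => congrArg v (Fin.ext rfl)))
    (congrArg₂ _ (congrArg g (funext fun i => congrArg v (Fin.ext rfl)))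
      (congrArg l (funext fun i => congrArg v (Fin.ext ?_))))
  simp [add_assoc]

theorem finRotate_pow_val {c : ℕ} (b : ℕ) (x : Fin c) :
    (((finRotate c) ^ b) x : ℕ) = (x + b) % c := by
  obtain _ | c := c
  · exact x.elim0
  induction b with
  | zero => exact (Nat.mod_eq_of_lt x.2).symm
  | succ b ih =>
    rw [pow_succ', Equiv.Perm.mul_apply, finRotate_apply, Fin.val_add, ih, Fin.val_one']
    simp [add_assoc]

theorem sign_finRotate_pow {a b c : ℕ} (h : a + b = c) :
    (((Equiv.Perm.sign ((finRotate c) ^ b)) : ℤ) : ℂ) = (-1) ^ (a * b) := by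
  rw [map_pow, sign_finRotate, ← pow_mul]
  push_cast
  obtain _ | b := b
  · simp
  · subst h
    have e : (a + (b + 1) - 1) * (b + 1) = a * (b + 1) + b * (b + 1) := by
      rw [show a + (b + 1) - 1 = a + b from rfl, add_mul]
    rw [e, pow_add, (Nat.even_mul_succ_self b).neg_one_pow, mul_one]

/-- Interchanging the two blocks of arguments is the `b`-th power of a cyclic rotation, of
sign `(-1)^{ab}`. -/
theorem asym_tens_comm {a b c : ℕ} (h : a + b = c) (h' : b + a = c) (f : (Fin a → E) → ℂ)
    (g : (Fin b → E) → ℂ) (v : Fin c → E) :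
    asym (tens h' g f) v = (-1) ^ (a * b) * asym (tens h f g) v := by
  have e : tens h' g f = fun u : Fin c → E => tens h f g (u ∘ ⇑((finRotate c) ^ b)) := by
    funext u
    simp only [tens, Function.comp_apply]
    rw [mul_comm]
    refine congrArg₂ _ (congrArg f (funext fun i => congrArg u (Fin.ext ?_)))
      (congrArg g (funext fun i => congrArg u (Fin.ext ?_)))
    · rw [finRotate_pow_val]
      simp only [Fin.val_cast, Fin.val_natAdd, Fin.val_castAdd]
      rw [Nat.mod_eq_of_lt (by omega), add_comm]
    · rw [finRotate_pow_val]
      simp only [Fin.val_cast, Fin.val_natAdd, Fin.val_castAdd]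
      rw [show a + (i : ℕ) + b = i + c by omega, Nat.add_mod_right, Nat.mod_eq_of_lt (by omega)]
  rw [e, asym_comp_perm (tens h f g), sign_finRotate_pow h]

/-- Antisymmetrising first in the last `k` of `k + 1` arguments and then by the signed sum over
the first argument is the same as antisymmetrising in all arguments. -/
theorem sum_asym_removeNth {k : ℕ} (f : E → (Fin k → E) → ℂ) (v : Fin (k + 1) → E) :
    ∑ p : Fin (k + 1), (-1) ^ (p : ℕ) * asym (f (v p)) (p.removeNth v) =
      asym (fun u => f (u 0) (Fin.tail u)) v := by
  have e : ∀ σ : Equiv.Perm (Fin k), Function.Injective (Fin.cons 0 (Fin.succ ∘ σ) :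
      Fin (k + 1) → Fin (k + 1)) := fun σ => Fin.cons_injective_iff.2
    ⟨by rintro ⟨i, hi⟩; exact Fin.succ_ne_zero _ hi, (Fin.succ_injective _).comp σ.injective⟩
  -- A permutation of `k + 1` elements is given by the image of `0` and a permutation of the others.
  let T : Fin (k + 1) × Equiv.Perm (Fin k) → Equiv.Perm (Fin (k + 1)) := fun x =>
    x.1.cycleRange.symm * Equiv.Perm.decomposeFin.symm (0, x.2)
  have T0 (x) : T x 0 = x.1 := by
    simp only [T, Equiv.Perm.mul_apply, Equiv.Perm.decomposeFin_symm_apply_zero]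
    exact Fin.cycleRange_symm_zero _
  have Ts (x) (i : Fin k) : T x i.succ = x.1.succAbove (x.2 i) := by
    simp only [T, Equiv.Perm.mul_apply, Equiv.Perm.decomposeFin_symm_apply_succ,
      Equiv.swap_self, Equiv.refl_apply]
    exact Fin.cycleRange_symm_succ _ _
  have Tinj : Function.Injective T := by
    intro x y hxy
    have h0 : x.1 = y.1 := by rw [← T0, hxy, T0]
    refine Prod.ext h0 (Equiv.ext fun i => ?_)
    have := Ts x i
    rw [hxy, Ts, h0] at this
    exact (Fin.succAbove_right_injective this).symm
  have Tbij : Function.Bijective T := by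
    refine (Fintype.bijective_iff_injective_and_card T).2 ⟨Tinj, ?_⟩
    simp [Fintype.card_perm, Nat.factorial_succ]
  rw [asym, ← Equiv.sum_comp (Equiv.ofBijective T Tbij), Fintype.sum_prod_type]
  refine Finset.sum_congr rfl fun p _ => ?_
  rw [asym, Finset.mul_sum]
  refine Finset.sum_congr rfl fun σ _ => ?_
  have hs : Equiv.Perm.sign (T (p, σ)) = (-1) ^ (p : ℕ) * Equiv.Perm.sign σ := by
    simp only [T, Equiv.Perm.sign_mul, Equiv.Perm.sign_symm, Fin.sign_cycleRange,
      Equiv.Perm.decomposeFin.symm_sign, if_true, one_mul]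
  simp only [Equiv.ofBijective_apply, Function.comp_apply, T0, hs]
  push_cast
  rw [mul_assoc]
  congr 3
  funext i
  simp [Fin.tail, Ts, Fin.removeNth]

end

/-! ### The wedge product of alternating forms -/

section

variable {E F : Type} [NormedAddCommGroup E] [NormedSpace ℝ E] [NormedAddCommGroup F]
  [NormedSpace ℝ F]

/-- The shuffle product `wedge`, multiplied by `a! b!`, is the antisymmetrisation of the tensor
product.  All algebraic properties of the wedge product are deduced from those of `asym`. -/
theorem factorial_mul_wedge {a b c : ℕ} (h : a + b = c) (α : E [⋀^Fin a]→L[ℝ] ℂ)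
    (β : E [⋀^Fin b]→L[ℝ] ℂ) (v : Fin c → E) :
    ((a.factorial : ℂ) * b.factorial) * wedge α β v = asym (tens h α β) v := by
  subst h
  have h1 := congrArg (fun A => LinearMap.mul' ℝ ℂ (A fun i => v (finSumFinEquiv i)))
    (MultilinearMap.domCoprod_alternization_eq α.toAlternatingMap β.toAlternatingMap)
  simp only [MultilinearMap.alternatization_apply, map_sum, AlternatingMap.smul_apply,
    Fintype.card_fin, map_nsmul] at h1
  rw [wedge, dif_pos rfl]
  refine Eq.trans ?_ (h1.symm.trans ?_)
  · rw [nsmul_eq_mul]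
    push_cast
    rfl
  · rw [asym, ← Equiv.sum_comp (finSumFinEquiv (m := a) (n := b)).permCongr]
    refine Finset.sum_congr rfl fun σ _ => ?_
    rw [Equiv.Perm.sign_permCongr]
    obtain h | h := Int.units_eq_one_or (Equiv.Perm.sign σ) <;>
    · rw [h]
      simp [tens, Equiv.permCongr_apply, MultilinearMap.domCoprod_apply]

theorem wedge_eq {a b c : ℕ} (h : a + b = c) (α : E [⋀^Fin a]→L[ℝ] ℂ)
    (β : E [⋀^Fin b]→L[ℝ] ℂ) (v : Fin c → E) :
    wedge α β v = ((a.factorial : ℂ) * b.factorial)⁻¹ * asym (tens h α β) v := by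
  rw [← factorial_mul_wedge h, inv_mul_cancel_left₀]
  exact mul_ne_zero (Nat.cast_ne_zero.2 a.factorial_ne_zero)
    (Nat.cast_ne_zero.2 b.factorial_ne_zero)

theorem continuous_asym_tens {a b c : ℕ} (h : a + b = c) (α : E [⋀^Fin a]→L[ℝ] ℂ)
    (β : E [⋀^Fin b]→L[ℝ] ℂ) : Continuous (asym (tens h α β)) := by
  unfold asym tens
  refine continuous_finsetSum _ fun σ _ => continuous_const.mul (Continuous.mul ?_ ?_)
  · exact α.cont.comp (by fun_prop)
  · exact β.cont.comp (by fun_prop)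

/-- The wedge product of two alternating forms as an alternating `c`-form (and zero if `c` is not
the sum of the degrees). -/
def wedgeForm {a b : ℕ} (c : ℕ) (α : E [⋀^Fin a]→L[ℝ] ℂ) (β : E [⋀^Fin b]→L[ℝ] ℂ) :
    E [⋀^Fin c]→L[ℝ] ℂ :=
  if h : a + b = c then
    let A : E [⋀^Fin c]→ₗ[ℝ] ℂ := ((LinearMap.mul' ℝ ℂ).compAlternatingMap
      (α.toAlternatingMap.domCoprod β.toAlternatingMap)).domDomCongr
        (finSumFinEquiv.trans (finCongr h))
    ⟨⟨A.toMultilinearMap, by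
      have e : ⇑A = fun v => ((a.factorial : ℂ) * b.factorial)⁻¹ * asym (tens h α β) v := by
        funext v
        rw [← wedge_eq h, wedge, dif_pos h]
        rfl
      exact (continuous_const.mul (continuous_asym_tens h α β)).congr fun v => (congrFun e v).symm⟩,
      A.map_eq_zero_of_eq'⟩
  else 0

theorem wedgeForm_apply {a b c : ℕ} (α : E [⋀^Fin a]→L[ℝ] ℂ) (β : E [⋀^Fin b]→L[ℝ] ℂ)
    (v : Fin c → E) : wedgeForm c α β v = wedge α β v := by
  by_cases h : a + b = c
  · simp only [wedgeForm, wedge, dif_pos h]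
    rfl
  · simp only [wedgeForm, wedge, dif_neg h]
    rfl

theorem wedgeForm_of_ne {a b c : ℕ} (h : a + b ≠ c) (α : E [⋀^Fin a]→L[ℝ] ℂ)
    (β : E [⋀^Fin b]→L[ℝ] ℂ) : wedgeForm c α β = 0 := dif_neg h

theorem wedgeForm_eq {a b c : ℕ} (h : a + b = c) (α : E [⋀^Fin a]→L[ℝ] ℂ)
    (β : E [⋀^Fin b]→L[ℝ] ℂ) (v : Fin c → E) :
    wedgeForm c α β v = ((a.factorial : ℂ) * b.factorial)⁻¹ * asym (tens h α β) v := by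
  rw [wedgeForm_apply, wedge_eq h]

theorem asym_alternating {k : ℕ} (α : E [⋀^Fin k]→L[ℝ] ℂ) (v : Fin k → E) :
    asym α v = k.factorial * α v := by
  refine asym_of_antisymmetric (fun σ u => ?_) v
  refine (α.map_perm u σ).trans ?_
  obtain h | h := Int.units_eq_one_or (Equiv.Perm.sign σ) <;> simp [h]

theorem wedgeForm_assoc {a b c ab bc k : ℕ} (h₁ : a + b = ab) (h₂ : ab + c = k) (h₃ : b + c = bc)
    (h₄ : a + bc = k) (α : E [⋀^Fin a]→L[ℝ] ℂ) (β : E [⋀^Fin b]→L[ℝ] ℂ)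
    (γ : E [⋀^Fin c]→L[ℝ] ℂ) :
    wedgeForm k (wedgeForm ab α β) γ = wedgeForm k α (wedgeForm bc β γ) := by
  ext v
  have ha : (a.factorial : ℂ) ≠ 0 := Nat.cast_ne_zero.2 a.factorial_ne_zero
  have hb : (b.factorial : ℂ) ≠ 0 := Nat.cast_ne_zero.2 b.factorial_ne_zero
  have hc : (c.factorial : ℂ) ≠ 0 := Nat.cast_ne_zero.2 c.factorial_ne_zero
  have hab : (ab.factorial : ℂ) ≠ 0 := Nat.cast_ne_zero.2 ab.factorial_ne_zero
  have hbc : (bc.factorial : ℂ) ≠ 0 := Nat.cast_ne_zero.2 bc.factorial_ne_zero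
  rw [wedgeForm_eq h₂, wedgeForm_eq h₄]
  have e1 : tens h₂ (wedgeForm ab α β) γ = fun u => ((a.factorial : ℂ) * b.factorial)⁻¹ *
      tens h₂ (asym (tens h₁ α β)) γ u := by
    funext u
    simp only [tens, wedgeForm_eq h₁, mul_assoc]
  have e2 : tens h₄ α (wedgeForm bc β γ) = fun u => ((b.factorial : ℂ) * c.factorial)⁻¹ *
      tens h₄ α (asym (tens h₃ β γ)) u := by
    funext u
    simp only [tens, wedgeForm_eq h₃]
    exact mul_left_comm _ _ _
  rw [e1, e2, asym_const_mul, asym_const_mul, asym_tens_asym_left, asym_tens_asym_right,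
    tens_assoc h₁ h₂ h₃ h₄]
  field_simp

theorem wedgeForm_comm {a b : ℕ} (c : ℕ) (α : E [⋀^Fin a]→L[ℝ] ℂ) (β : E [⋀^Fin b]→L[ℝ] ℂ) :
    wedgeForm c α β = (-1 : ℝ) ^ (a * b) • wedgeForm c β α := by
  by_cases h : a + b = c
  · have h' : b + a = c := by omega
    ext v
    rw [ContinuousAlternatingMap.smul_apply, wedgeForm_eq h, wedgeForm_eq h',
      asym_tens_comm h' h, mul_comm b a, mul_comm (b.factorial : ℂ), Complex.real_smul]
    push_cast
    ring
  · rw [wedgeForm_of_ne h, wedgeForm_of_ne (by omega)]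
    ext v
    simp

theorem wedgeForm_add_left {a b : ℕ} (c : ℕ) (α α' : E [⋀^Fin a]→L[ℝ] ℂ)
    (β : E [⋀^Fin b]→L[ℝ] ℂ) :
    wedgeForm c (α + α') β = wedgeForm c α β + wedgeForm c α' β := by
  by_cases h : a + b = c
  · ext v
    rw [ContinuousAlternatingMap.add_apply, wedgeForm_eq h, wedgeForm_eq h, wedgeForm_eq h,
      ← mul_add, asym, asym, asym, ← Finset.sum_add_distrib]
    refine congrArg _ (Finset.sum_congr rfl fun σ _ => ?_)
    simp only [tens, ContinuousAlternatingMap.add_apply]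
    ring
  · simp [wedgeForm_of_ne h]

theorem wedgeForm_smul_left {a b : ℕ} (c : ℕ) (r : ℝ) (α : E [⋀^Fin a]→L[ℝ] ℂ)
    (β : E [⋀^Fin b]→L[ℝ] ℂ) : wedgeForm c (r • α) β = r • wedgeForm c α β := by
  by_cases h : a + b = c
  · have e : tens h (r • α) β = fun u => (r : ℂ) * tens h α β u := by
      funext u
      simp only [tens, ContinuousAlternatingMap.smul_apply, Complex.real_smul, mul_assoc]
    ext v
    rw [ContinuousAlternatingMap.smul_apply, wedgeForm_eq h, wedgeForm_eq h, Complex.real_smul, e,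
      asym_const_mul, mul_left_comm]
  · simp only [wedgeForm_of_ne h]
    ext v
    simp

theorem wedgeForm_add_right {a b : ℕ} (c : ℕ) (α : E [⋀^Fin a]→L[ℝ] ℂ)
    (β β' : E [⋀^Fin b]→L[ℝ] ℂ) :
    wedgeForm c α (β + β') = wedgeForm c α β + wedgeForm c α β' := by
  rw [wedgeForm_comm, wedgeForm_add_left, smul_add, ← wedgeForm_comm, ← wedgeForm_comm]

theorem wedgeForm_smul_right {a b : ℕ} (c : ℕ) (r : ℝ) (α : E [⋀^Fin a]→L[ℝ] ℂ)
    (β : E [⋀^Fin b]→L[ℝ] ℂ) : wedgeForm c α (r • β) = r • wedgeForm c α β := by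
  rw [wedgeForm_comm, wedgeForm_smul_left, smul_comm, ← wedgeForm_comm]

variable (E) in
/-- The wedge product as a bilinear map. -/
def wedgeBilin (a b c : ℕ) :
    (E [⋀^Fin a]→L[ℝ] ℂ) →ₗ[ℝ] (E [⋀^Fin b]→L[ℝ] ℂ) →ₗ[ℝ] E [⋀^Fin c]→L[ℝ] ℂ :=
  LinearMap.mk₂ ℝ (wedgeForm c) (wedgeForm_add_left c) (wedgeForm_smul_left c)
    (wedgeForm_add_right c) (fun r α β => wedgeForm_smul_right c r α β)

theorem wedgeForm_zero_left {a b c : ℕ} (β : E [⋀^Fin b]→L[ℝ] ℂ) :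
    wedgeForm c (0 : E [⋀^Fin a]→L[ℝ] ℂ) β = 0 :=
  congrArg (fun L => L β) (map_zero (wedgeBilin E a b c))

theorem wedgeForm_zero_right {a b c : ℕ} (α : E [⋀^Fin a]→L[ℝ] ℂ) :
    wedgeForm c α (0 : E [⋀^Fin b]→L[ℝ] ℂ) = 0 :=
  map_zero (wedgeBilin E a b c α)

theorem wedgeForm_comp {a b : ℕ} (c : ℕ) (α : F [⋀^Fin a]→L[ℝ] ℂ) (β : F [⋀^Fin b]→L[ℝ] ℂ)
    (f : E →L[ℝ] F) :
    wedgeForm c (α.compContinuousLinearMap f) (β.compContinuousLinearMap f) =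
      (wedgeForm c α β).compContinuousLinearMap f := by
  by_cases h : a + b = c
  · ext v
    rw [ContinuousAlternatingMap.compContinuousLinearMap_apply, wedgeForm_eq h, wedgeForm_eq h]
    rfl
  · rw [wedgeForm_of_ne h, wedgeForm_of_ne h]
    rfl

theorem wedgeForm_conj {a b : ℕ} (c : ℕ) (α : E [⋀^Fin a]→L[ℝ] ℂ) (β : E [⋀^Fin b]→L[ℝ] ℂ) :
    wedgeForm c ((Complex.conjCLE : ℂ →L[ℝ] ℂ).compContinuousAlternatingMap α)
        ((Complex.conjCLE : ℂ →L[ℝ] ℂ).compContinuousAlternatingMap β) =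
      (Complex.conjCLE : ℂ →L[ℝ] ℂ).compContinuousAlternatingMap (wedgeForm c α β) := by
  by_cases h : a + b = c
  · ext v
    have e : ((Complex.conjCLE : ℂ →L[ℝ] ℂ).compContinuousAlternatingMap (wedgeForm c α β)) v =
      (starRingEnd ℂ) (wedgeForm c α β v) := rfl
    rw [e, wedgeForm_eq h, wedgeForm_eq h, map_mul, map_inv₀, map_mul, map_natCast, map_natCast,
      asym, asym, map_sum]
    refine congrArg _ (Finset.sum_congr rfl fun σ _ => ?_)
    rw [map_mul, map_intCast]
    refine congrArg _ ?_
    simp [tens]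
  · rw [wedgeForm_of_ne h, wedgeForm_of_ne h]
    ext v
    simp

theorem wedgeForm_realAt {a b : ℕ} (c : ℕ) {s t : ℂ} {α : E [⋀^Fin a]→L[ℝ] ℂ}
    {β : E [⋀^Fin b]→L[ℝ] ℂ} (hα : α ∈ realAt E s a) (hβ : β ∈ realAt E t b) :
    wedgeForm c α β ∈ realAt E (s * t) c := by
  by_cases h : a + b = c
  · intro v
    choose r hr using hα
    choose u hu using hβ
    refine ⟨((a.factorial : ℝ) * b.factorial)⁻¹ * ∑ σ : Equiv.Perm (Fin c),
      ((Equiv.Perm.sign σ : ℤ) : ℝ) * (r (fun i => (v ∘ σ) (Fin.cast h (Fin.castAdd b i))) *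
        u (fun i => (v ∘ σ) (Fin.cast h (Fin.natAdd a i)))), ?_⟩
    rw [wedgeForm_eq h, asym]
    push_cast
    rw [mul_left_comm]
    refine congrArg (((a.factorial : ℂ) * b.factorial)⁻¹ * ·) ?_
    rw [Finset.mul_sum]
    refine Finset.sum_congr rfl fun σ _ => ?_
    rw [tens, hr, hu]
    ring
  · rw [wedgeForm_of_ne h]
    exact (realAt E (s * t) c).zero_mem

theorem constOfIsEmpty_wedgeForm {b : ℕ} (s : ℂ) (β : E [⋀^Fin b]→L[ℝ] ℂ) (v : Fin b → E) :
    wedgeForm b (ContinuousAlternatingMap.constOfIsEmpty ℝ E (Fin 0) s) β v = s * β v := by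
  have hb : (b.factorial : ℂ) ≠ 0 := Nat.cast_ne_zero.2 b.factorial_ne_zero
  have e : tens (zero_add b) (ContinuousAlternatingMap.constOfIsEmpty ℝ E (Fin 0) s) β =
      fun u => s * β u := by
    funext u
    refine congrArg (fun w => s * β w) (funext fun i => congrArg u (Fin.ext ?_))
    simp
  rw [wedgeForm_eq (zero_add b), e, asym_const_mul, asym_alternating, Nat.factorial_zero]
  push_cast
  field_simp

/-- The pointwise form of the Leibniz rule for the derivative of the first factor. -/
theorem alternatizeUncurryFin_wedgeForm_left {a b c : ℕ} (h : a + b = c)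
    (L : E →L[ℝ] E [⋀^Fin a]→L[ℝ] ℂ) (β : E [⋀^Fin b]→L[ℝ] ℂ)
    (K : E →L[ℝ] E [⋀^Fin c]→L[ℝ] ℂ) (hK : ∀ w, K w = wedgeForm c (L w) β) :
    ContinuousAlternatingMap.alternatizeUncurryFin K =
      wedgeForm (c + 1) (ContinuousAlternatingMap.alternatizeUncurryFin L) β := by
  have ha : (a.factorial : ℂ) ≠ 0 := Nat.cast_ne_zero.2 a.factorial_ne_zero
  have hb : (b.factorial : ℂ) ≠ 0 := Nat.cast_ne_zero.2 b.factorial_ne_zero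
  have h' : a + 1 + b = c + 1 := by omega
  ext v
  have e1 : ContinuousAlternatingMap.alternatizeUncurryFin K v =
      ((a.factorial : ℂ) * b.factorial)⁻¹ *
        asym (fun u => tens h (L (u 0)) β (Fin.tail u)) v := by
    rw [ContinuousAlternatingMap.alternatizeUncurryFin_apply,
      ← sum_asym_removeNth (fun w => tens h (L w) β), Finset.mul_sum]
    refine Finset.sum_congr rfl fun p _ => ?_
    rw [hK, wedgeForm_eq h, zsmul_eq_mul]
    push_cast
    ring
  have e2 : (ContinuousAlternatingMap.alternatizeUncurryFin L : (Fin (a + 1) → E) → ℂ) =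
      fun u => (a.factorial : ℂ)⁻¹ * asym (fun w => L (w 0) (Fin.tail w)) u := by
    funext u
    rw [ContinuousAlternatingMap.alternatizeUncurryFin_apply,
      ← sum_asym_removeNth (fun w => L w), Finset.mul_sum]
    refine Finset.sum_congr rfl fun p _ => ?_
    rw [asym_alternating, zsmul_eq_mul]
    push_cast
    field_simp
  have e3 : tens h' (ContinuousAlternatingMap.alternatizeUncurryFin L) β = fun u =>
      (a.factorial : ℂ)⁻¹ * tens h' (asym (fun w => L (w 0) (Fin.tail w))) β u := by
    funext u
    simp only [tens, e2, mul_assoc]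
  have e4 : tens h' (fun w => L (w 0) (Fin.tail w)) β =
      fun u => tens h (L (u 0)) β (Fin.tail u) := by
    funext u
    simp only [tens]
    refine congrArg₂ (· * ·) ?_ (congrArg β (funext fun j => congrArg u (Fin.ext ?_)))
    · rfl
    · simp
      omega
  rw [e1, wedgeForm_eq h', e3, asym_const_mul, asym_tens_asym_left, e4, Nat.factorial_succ]
  push_cast
  field_simp

end

section

variable {E G₁ G₂ G₃ : Type} [NormedAddCommGroup E] [NormedSpace ℝ E]
  [NormedAddCommGroup G₁] [NormedSpace ℝ G₁] [FiniteDimensional ℝ G₁]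
  [NormedAddCommGroup G₂] [NormedSpace ℝ G₂] [FiniteDimensional ℝ G₂]
  [NormedAddCommGroup G₃] [NormedSpace ℝ G₃]

theorem contDiffOn_bilin (B : G₁ →ₗ[ℝ] G₂ →ₗ[ℝ] G₃) {s : Set E} {f : E → G₁} {g : E → G₂}
    (hf : ContDiffOn ℝ ∞ f s) (hg : ContDiffOn ℝ ∞ g s) :
    ContDiffOn ℝ ∞ (fun z => B (f z) (g z)) s :=
  (B.toContinuousBilinearMap.isBoundedBilinearMap.contDiff (n := ∞)).comp_contDiffOn (hf.prodMk hg)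

theorem fderivWithin_bilin (B : G₁ →ₗ[ℝ] G₂ →ₗ[ℝ] G₃) {s : Set E} {f : E → G₁} {g : E → G₂} {z : E}
    (hs : UniqueDiffWithinAt ℝ s z) (hf : DifferentiableWithinAt ℝ f s z)
    (hg : DifferentiableWithinAt ℝ g s z) (w : E) :
    fderivWithin ℝ (fun z => B (f z) (g z)) s z w =
      B (fderivWithin ℝ f s z w) (g z) + B (f z) (fderivWithin ℝ g s z w) := by
  have h := B.toContinuousBilinearMap.hasFDerivWithinAt_of_bilinear hf.hasFDerivWithinAt
    hg.hasFDerivWithinAt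
  have e := h.fderivWithin hs
  refine (congrArg (fun T => T w) e).trans ?_
  rw [add_comm]
  rfl

end

section

variable {E : Type} [NormedAddCommGroup E] [NormedSpace ℝ E] [FiniteDimensional ℝ E]

theorem contDiffOn_wedgeForm {a b : ℕ} (c : ℕ) {s : Set E} {α : E → E [⋀^Fin a]→L[ℝ] ℂ}
    {β : E → E [⋀^Fin b]→L[ℝ] ℂ} (hα : ContDiffOn ℝ ∞ α s) (hβ : ContDiffOn ℝ ∞ β s) :
    ContDiffOn ℝ ∞ (fun z => wedgeForm c (α z) (β z)) s := by
  have := finite_alternating E a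
  have := finite_alternating E b
  exact contDiffOn_bilin (wedgeBilin E a b c) hα hβ

/-- The Leibniz rule.  The derivative of the second factor is moved to the front by graded
commutativity, which reduces it to the derivative of the first factor. -/
theorem extDerivWithin_wedgeForm {a b c : ℕ} (h : a + b = c) {s : Set E}
    {α : E → E [⋀^Fin a]→L[ℝ] ℂ} {β : E → E [⋀^Fin b]→L[ℝ] ℂ} {z : E}
    (hs : UniqueDiffWithinAt ℝ s z) (hα : DifferentiableWithinAt ℝ α s z)
    (hβ : DifferentiableWithinAt ℝ β s z) :
    extDerivWithin (fun z => wedgeForm c (α z) (β z)) s z =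
      wedgeForm (c + 1) (extDerivWithin α s z) (β z) +
        (-1 : ℝ) ^ a • wedgeForm (c + 1) (α z) (extDerivWithin β s z) := by
  have := finite_alternating E a
  have := finite_alternating E b
  let K₁ : E →L[ℝ] E [⋀^Fin c]→L[ℝ] ℂ := LinearMap.toContinuousLinearMap
    ((wedgeBilin E a b c).flip (β z) ∘ₗ (fderivWithin ℝ α s z : E →ₗ[ℝ] _))
  let K₂ : E →L[ℝ] E [⋀^Fin c]→L[ℝ] ℂ := LinearMap.toContinuousLinearMap
    ((wedgeBilin E b a c).flip (α z) ∘ₗ (fderivWithin ℝ β s z : E →ₗ[ℝ] _))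
  have e : fderivWithin ℝ (fun z => wedgeForm c (α z) (β z)) s z =
      K₁ + (-1 : ℝ) ^ (a * b) • K₂ := by
    ext1 w
    refine (fderivWithin_bilin (wedgeBilin E a b c) hs hα hβ w).trans ?_
    exact congrArg (wedgeForm c (fderivWithin ℝ α s z w) (β z) + ·)
      (wedgeForm_comm c (α z) (fderivWithin ℝ β s z w))
  rw [extDerivWithin, e, ContinuousAlternatingMap.alternatizeUncurryFin_add,
    ContinuousAlternatingMap.alternatizeUncurryFin_smul,
    alternatizeUncurryFin_wedgeForm_left h _ (β z) K₁ fun _ => rfl,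
    alternatizeUncurryFin_wedgeForm_left (by omega : b + a = c) _ (α z) K₂ fun _ => rfl,
    wedgeForm_comm (c + 1) (ContinuousAlternatingMap.alternatizeUncurryFin (fderivWithin ℝ β s z)),
    smul_smul, ← pow_add, add_mul, one_mul, mul_comm b a, ← add_assoc, ← two_mul, pow_add,
    pow_mul, neg_one_sq, one_pow, one_mul]
  rfl

end

theorem monomialForm_eq_asym {n m k : ℕ} (c : Fin k → Fin n ⊕ Fin m ⊕ Fin m) :
    monomialForm c = asym fun u => ∏ i, covector (c i) (u i) := by
  funext v
  rw [monomialForm, ← Matrix.det_transpose, Matrix.det_apply', asym]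
  rfl

theorem tens_prod_covector {n m a b k : ℕ} (h : a + b = k) (c : Fin a → Fin n ⊕ Fin m ⊕ Fin m)
    (d : Fin b → Fin n ⊕ Fin m ⊕ Fin m) :
    tens h (fun u => ∏ i, covector (c i) (u i)) (fun u => ∏ i, covector (d i) (u i)) =
      fun u => ∏ i, covector (Fin.append c d (Fin.cast h.symm i)) (u i) := by
  subst h
  funext u
  simp [tens, Fin.prod_univ_add]

theorem holDegree_append {n m a b : ℕ} (c : Fin a → Fin n ⊕ Fin m ⊕ Fin m)
    (d : Fin b → Fin n ⊕ Fin m ⊕ Fin m) :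
    holDegree c + holDegree d ≤ holDegree (Fin.append c d) := by
  rw [holDegree, holDegree, holDegree, ← Nat.card_sum]
  refine Nat.card_le_card_of_injective (fun
    | .inl i => ⟨Fin.castAdd b i.1, by simpa using i.2⟩
    | .inr i => ⟨Fin.natAdd a i.1, by simpa using i.2⟩) ?_
  rintro (⟨i, hi⟩ | ⟨i, hi⟩) (⟨j, hj⟩ | ⟨j, hj⟩) hij
  · simpa using hij
  · have := congrArg (fun x => (x.1 : ℕ)) hij
    simp only [Fin.val_castAdd, Fin.val_natAdd] at this
    omega
  · have := congrArg (fun x => (x.1 : ℕ)) hij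
    simp only [Fin.val_castAdd, Fin.val_natAdd] at this
    omega
  · simpa using hij

theorem asym_tens_mem_hodgeSpan {n m p q a b k : ℕ} (h : a + b = k) {f : (Fin a → Crd n m) → ℂ}
    {g : (Fin b → Crd n m) → ℂ} (hf : f ∈ hodgeSpan n m p a) (hg : g ∈ hodgeSpan n m q b) :
    asym (tens h f g) ∈ hodgeSpan n m (p + q) k := by
  let T : ((Fin a → Crd n m) → ℂ) →ₗ[ℂ] ((Fin b → Crd n m) → ℂ) →ₗ[ℂ] (Fin k → Crd n m) → ℂ :=
    LinearMap.mk₂ ℂ (fun f g => asym (tens h f g))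
      (fun f f' g => by
        funext v
        simp only [Pi.add_apply, asym, tens, ← Finset.sum_add_distrib]
        exact Finset.sum_congr rfl fun σ _ => by ring)
      (fun c f g => by
        funext v
        simp only [Pi.smul_apply, asym, tens, smul_eq_mul, Finset.mul_sum]
        exact Finset.sum_congr rfl fun σ _ => by ring)
      (fun f g g' => by
        funext v
        simp only [Pi.add_apply, asym, tens, ← Finset.sum_add_distrib]
        exact Finset.sum_congr rfl fun σ _ => by ring)
      (fun c f g => by
        funext v
        simp only [Pi.smul_apply, asym, tens, smul_eq_mul, Finset.mul_sum]
        exact Finset.sum_congr rfl fun σ _ => by ring)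
  change T f g ∈ _
  refine Submodule.map₂_le.1 ?_ f hf g hg
  rw [hodgeSpan, hodgeSpan, Submodule.map₂_span_span, Submodule.span_le]
  rintro _ ⟨_, ⟨c, hc, rfl⟩, _, ⟨d, hd, rfl⟩, rfl⟩
  have e : T (monomialForm c) (monomialForm d) = ((a.factorial : ℂ) * b.factorial) •
      monomialForm (fun i => Fin.append c d (Fin.cast h.symm i)) := by
    funext v
    change asym (tens h _ _) v = _ * _
    rw [monomialForm_eq_asym, monomialForm_eq_asym, monomialForm_eq_asym, asym_tens_asym_left,
      asym_tens_asym_right, tens_prod_covector, mul_assoc]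
  refine (congrArg (· ∈ hodgeSpan n m (p + q) k) e).mpr (Submodule.smul_mem _ _
    (Submodule.subset_span ⟨_, ?_, rfl⟩))
  subst h
  exact (add_le_add hc hd).trans (holDegree_append c d)

/-- The wedge product maps `F^p × F^q` to `F^{p+q}`, since monomials multiply by concatenation. -/
theorem wedgeForm_hodgeAt {n m p q a b : ℕ} (c : ℕ) {α : Crd n m [⋀^Fin a]→L[ℝ] ℂ}
    {β : Crd n m [⋀^Fin b]→L[ℝ] ℂ} (hα : α ∈ hodgeAt n m p a) (hβ : β ∈ hodgeAt n m q b) :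
    wedgeForm c α β ∈ hodgeAt n m (p + q) c := by
  by_cases h : a + b = c
  · have e : (fun v => wedgeForm c α β v) =
        ((a.factorial : ℂ) * b.factorial)⁻¹ • asym (tens h α β) := funext (wedgeForm_eq h α β)
    change (fun v => wedgeForm c α β v) ∈ hodgeSpan n m (p + q) c
    rw [e]
    exact Submodule.smul_mem _ _ (asym_tens_mem_hodgeSpan h hα hβ)
  · rw [wedgeForm_of_ne h]
    exact (hodgeAt n m (p + q) c).zero_mem

/-! ### The wedge product of differential forms -/

/-- The wedge product `A^k × A^l → A^m` for `m = k + l` (and zero if `m ≠ k + l`), computed in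
local coordinates. -/
def Form.wedge (k l m : ℤ) : Form M X k →ₗ[ℝ] Form M X l →ₗ[ℝ] Form M X m :=
  if h : k + l = m then
    LinearMap.mk₂ ℝ
      (fun α β => ⟨fun P Q z => wedgeForm m.toNat (α.1 P Q z) (β.1 P Q z), by
        refine ⟨fun hm => ?_, fun P Q => contDiffOn_wedgeForm _ (α.2.2.1 P Q) (β.2.2.1 P Q),
          fun P Q z hz => ?_, fun P' P a Q' Q b ha hb z hz => ?_⟩
        · funext P Q z
          obtain hk | hl : k < 0 ∨ l < 0 := by omega
          · rw [α.2.1 hk]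
            exact wedgeForm_zero_left _
          · rw [β.2.1 hl]
            exact wedgeForm_zero_right _
        · beta_reduce
          rw [α.2.2.2.1 P Q z hz]
          exact wedgeForm_zero_left _
        · beta_reduce
          rw [α.2.2.2.2 P' P a Q' Q b ha hb z hz, β.2.2.2.2 P' P a Q' Q b ha hb z hz,
            wedgeForm_comp]⟩)
      (fun α α' β => Subtype.ext (funext fun P => funext fun Q => funext fun z =>
        wedgeForm_add_left _ (α.1 P Q z) (α'.1 P Q z) (β.1 P Q z)))
      (fun c α β => Subtype.ext (funext fun P => funext fun Q => funext fun z =>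
        wedgeForm_smul_left _ c (α.1 P Q z) (β.1 P Q z)))
      (fun α β β' => Subtype.ext (funext fun P => funext fun Q => funext fun z =>
        wedgeForm_add_right _ (α.1 P Q z) (β.1 P Q z) (β'.1 P Q z)))
      (fun c α β => Subtype.ext (funext fun P => funext fun Q => funext fun z =>
        wedgeForm_smul_right _ c (α.1 P Q z) (β.1 P Q z)))
  else 0

theorem Form.wedge_val {k l m : ℤ} (h : k + l = m) (α : Form M X k) (β : Form M X l)
    (P : MPlot M) (Q : XPlot X) (z : Crd P.dim Q.dim) :
    (Form.wedge k l m α β).1 P Q z = wedgeForm m.toNat (α.1 P Q z) (β.1 P Q z) := by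
  rw [Form.wedge, dif_pos h]
  rfl

theorem Form.wedge_of_ne {k l m : ℤ} (h : k + l ≠ m) (α : Form M X k) (β : Form M X l) :
    Form.wedge k l m α β = 0 := by
  rw [Form.wedge, dif_neg h]
  rfl

theorem Form.eq_zero_of_neg {k : ℤ} (hk : k < 0) (α : Form M X k) : α = 0 :=
  Subtype.ext (α.2.1 hk)

theorem Form.val_ext {k : ℤ} {α β : Form M X k} (h : ∀ P Q z, α.1 P Q z = β.1 P Q z) : α = β :=
  Subtype.ext (funext fun P => funext fun Q => funext fun z => h P Q z)

theorem Form.add_val {k : ℤ} (α β : Form M X k) (P : MPlot M) (Q : XPlot X)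
    (z : Crd P.dim Q.dim) : (α + β).1 P Q z = α.1 P Q z + β.1 P Q z := rfl

theorem Form.smul_val {k : ℤ} (c : ℝ) (α : Form M X k) (P : MPlot M) (Q : XPlot X)
    (z : Crd P.dim Q.dim) : (c • α).1 P Q z = c • α.1 P Q z := rfl

theorem Form.pull_wedge (f : SmoothMap M N) (g : X ⟶ Y) (k l m : ℤ) (α : Form N Y k)
    (β : Form N Y l) : Form.pull f g m (Form.wedge k l m α β) =
      Form.wedge k l m (Form.pull f g k α) (Form.pull f g l β) := by
  by_cases h : k + l = m
  · refine Form.val_ext fun P Q z => ?_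
    rw [Form.wedge_val h]
    exact Form.wedge_val h α β _ _ _
  · rw [Form.wedge_of_ne h, Form.wedge_of_ne h, map_zero]

theorem Form.restrict_wedge (s : Icc (0 : ℝ) 1) (k l m : ℤ) (α : Form (cyl M) X k)
    (β : Form (cyl M) X l) : Form.restrict s m (Form.wedge k l m α β) =
      Form.wedge k l m (Form.restrict s k α) (Form.restrict s l β) := by
  by_cases h : k + l = m
  · refine Form.val_ext fun P Q z => ?_
    rw [Form.wedge_val h]
    exact Form.wedge_val h α β _ _ _
  · rw [Form.wedge_of_ne h, Form.wedge_of_ne h, map_zero]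

theorem Form.wedge_real {p q r : ℕ} (hr : p + q = r) {k l : ℤ} (m : ℤ) {α : Form M X k}
    {β : Form M X l} (hα : α ∈ Form.real M X p k) (hβ : β ∈ Form.real M X q l) :
    Form.wedge k l m α β ∈ Form.real M X r m := by
  by_cases h : k + l = m
  · intro P Q z
    rw [Form.wedge_val h, ← hr, pow_add]
    exact wedgeForm_realAt _ (hα P Q z) (hβ P Q z)
  · rw [Form.wedge_of_ne h]
    exact Submodule.zero_mem _

theorem Form.wedge_hodge {p q r : ℕ} (hr : p + q = r) {k l : ℤ} (m : ℤ) {α : Form M X k}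
    {β : Form M X l} (hα : α ∈ Form.hodge M X p k) (hβ : β ∈ Form.hodge M X q l) :
    Form.wedge k l m α β ∈ Form.hodge M X r m := by
  by_cases h : k + l = m
  · intro P Q z
    rw [Form.wedge_val h, ← hr]
    exact wedgeForm_hodgeAt _ (hα P Q z) (hβ P Q z)
  · rw [Form.wedge_of_ne h]
    exact Submodule.zero_mem _

theorem Form.wedge_invariants {k l : ℤ} (m : ℤ) {α : Form M X k} {β : Form M X l}
    (hα : α ∈ Form.invariants M X k) (hβ : β ∈ Form.invariants M X l) :
    Form.wedge k l m α β ∈ Form.invariants M X m := by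
  by_cases h : k + l = m
  · funext P Q z
    have h1 := congrFun (congrFun (congrFun (show galois α.1 = α.1 from hα) P) Q) z
    have h2 := congrFun (congrFun (congrFun (show galois β.1 = β.1 from hβ) P) Q) z
    rw [Form.wedge_val h, ← h1, ← h2, galois, Form.wedge_val h, galois, galois, wedgeForm_conj,
      wedgeForm_comp]
  · rw [Form.wedge_of_ne h]
    exact Submodule.zero_mem _

theorem Form.wedge_assoc {k l m kl lm n : ℤ} (h₁ : k + l = kl) (h₂ : kl + m = n) (h₃ : l + m = lm)
    (h₄ : k + lm = n) (α : Form M X k) (β : Form M X l) (γ : Form M X m) :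
    Form.wedge kl m n (Form.wedge k l kl α β) γ = Form.wedge k lm n α (Form.wedge l m lm β γ) := by
  by_cases hk : k < 0
  · simp [Form.eq_zero_of_neg hk α]
  by_cases hl : l < 0
  · simp [Form.eq_zero_of_neg hl β]
  by_cases hm : m < 0
  · simp [Form.eq_zero_of_neg hm γ]
  refine Form.val_ext fun P Q z => ?_
  rw [Form.wedge_val h₂, Form.wedge_val h₁, Form.wedge_val h₄, Form.wedge_val h₃]
  exact wedgeForm_assoc (by omega) (by omega) (by omega) (by omega) _ _ _

theorem Form.wedge_comm {k l : ℤ} (m : ℤ) (α : Form M X k) (β : Form M X l) :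
    Form.wedge k l m α β = (-1 : ℝ) ^ (k.toNat * l.toNat) • Form.wedge l k m β α := by
  by_cases h : k + l = m
  · refine Form.val_ext fun P Q z => ?_
    rw [Form.smul_val, Form.wedge_val h, Form.wedge_val (by omega)]
    exact wedgeForm_comm _ _ _
  · rw [Form.wedge_of_ne h, Form.wedge_of_ne (by omega), smul_zero]

theorem castDeg_apply {E : Type} [NormedAddCommGroup E] [NormedSpace ℝ E] {a b : ℕ} (h : a = b)
    (α : E [⋀^Fin a]→L[ℝ] ℂ) (v : Fin b → E) : castDeg h α v = α (v ∘ Fin.cast h) := by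
  subst h
  rfl

theorem extD_wedgeForm {E : Type} [NormedAddCommGroup E] [NormedSpace ℝ E] [FiniteDimensional ℝ E]
    {a b c a' b' c' : ℕ} (h : a + b = c) (ha : a + 1 = a') (hb : b + 1 = b') (hc : c + 1 = c')
    {s : Set E} {α : E → E [⋀^Fin a]→L[ℝ] ℂ} {β : E → E [⋀^Fin b]→L[ℝ] ℂ} {z : E}
    (hs : UniqueDiffWithinAt ℝ s z) (hα : DifferentiableWithinAt ℝ α s z)
    (hβ : DifferentiableWithinAt ℝ β s z) :
    extD s c' (fun z => wedgeForm c (α z) (β z)) z =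
      wedgeForm c' (extD s a' α z) (β z) + (-1 : ℝ) ^ a • wedgeForm c' (α z) (extD s b' β z) := by
  subst ha hb hc
  rw [extD_self, extD_self, extD_self, extDerivWithin_wedgeForm h hs hα hβ]

theorem Form.d_wedge {k k' l l' m m' : ℤ} (hk : k + 1 = k') (hl : l + 1 = l') (hm : m + 1 = m')
    (h : k + l = m) (α : Form M X k) (β : Form M X l) :
    Form.d m m' (Form.wedge k l m α β) = Form.wedge k' l m' (Form.d k k' α) β +
      (-1 : ℝ) ^ k.toNat • Form.wedge k l' m' α (Form.d l l' β) := by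
  by_cases hk0 : k < 0
  · simp [Form.eq_zero_of_neg hk0 α]
  by_cases hl0 : l < 0
  · simp [Form.eq_zero_of_neg hl0 β]
  refine Form.ext fun P Q z hz => ?_
  rw [Form.add_val, Form.smul_val, Form.wedge_val (by omega), Form.wedge_val (by omega)]
  change (dom P Q).indicator (extD (dom P Q) m'.toNat ((Form.wedge k l m α β).1 P Q)) z =
    wedgeForm m'.toNat ((dom P Q).indicator (extD (dom P Q) k'.toNat (α.1 P Q)) z) (β.1 P Q z) +
      (-1 : ℝ) ^ k.toNat • wedgeForm m'.toNat (α.1 P Q z)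
        ((dom P Q).indicator (extD (dom P Q) l'.toNat (β.1 P Q)) z)
  rw [indicator_of_mem hz, indicator_of_mem hz, indicator_of_mem hz,
    funext (fun w => Form.wedge_val h α β P Q w)]
  exact extD_wedgeForm (by omega) (by omega) (by omega) (by omega) (uniqueDiffOn_dom P Q z hz)
    ((α.2.2.1 P Q).differentiableOn (by simp) z hz) ((β.2.2.1 P Q).differentiableOn (by simp) z hz)

/-- The constant function `1`, a form of degree `0`. -/
def Form.unit (M : CornerMfd) (X : Scheme.{0}) {k : ℤ} (hk : k = 0) : Form M X k :=
  ⟨fun P Q => (dom P Q).indicator fun _ =>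
    castDeg (by omega) (ContinuousAlternatingMap.constOfIsEmpty ℝ (Crd P.dim Q.dim) (Fin 0) 1), by
    refine ⟨fun h => by omega, fun P Q => ?_, fun P Q z hz => indicator_of_notMem hz _,
      fun P' P a Q' Q b ha hb z hz => ?_⟩
    · exact contDiffOn_const.congr fun z hz => indicator_of_mem hz _
    · beta_reduce
      rw [indicator_of_mem hz, indicator_of_mem (mapsTo_prodMap ha hb hz)]
      ext v
      rw [ContinuousAlternatingMap.compContinuousLinearMap_apply, castDeg_apply, castDeg_apply]
      rfl⟩

theorem Form.unit_apply {k : ℤ} (hk : k = 0) {P : MPlot M} {Q : XPlot X} {z : Crd P.dim Q.dim}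
    (hz : z ∈ dom P Q) (v : Fin k.toNat → Crd P.dim Q.dim) :
    (Form.unit M X hk).1 P Q z v = 1 := by
  have e : (Form.unit M X hk).1 P Q z = castDeg (by omega)
    (ContinuousAlternatingMap.constOfIsEmpty ℝ (Crd P.dim Q.dim) (Fin 0) 1) :=
    indicator_of_mem hz fun _ => castDeg (by omega)
      (ContinuousAlternatingMap.constOfIsEmpty ℝ (Crd P.dim Q.dim) (Fin 0) (1 : ℂ))
  rw [e, castDeg_apply]
  rfl

theorem Form.unit_wedge {k l : ℤ} (hk : k = 0) (β : Form M X l) :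
    Form.wedge k l l (Form.unit M X hk) β = β := by
  subst hk
  refine Form.ext fun P Q z hz => ?_
  ext v
  have e : (Form.unit M X rfl).1 P Q z =
    ContinuousAlternatingMap.constOfIsEmpty ℝ (Crd P.dim Q.dim) (Fin 0) 1 :=
    indicator_of_mem hz fun _ => ContinuousAlternatingMap.constOfIsEmpty ℝ _ (Fin 0) (1 : ℂ)
  rw [Form.wedge_val (zero_add l), e]
  exact (constOfIsEmpty_wedgeForm 1 (β.1 P Q z) v).trans (one_mul _)

theorem Form.unit_real (k : ℤ) (hk : k = 0) : Form.unit M X hk ∈ Form.real M X 0 k := by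
  intro P Q z v
  by_cases hz : z ∈ dom P Q
  · exact ⟨1, by rw [Form.unit_apply hk hz]; simp⟩
  · exact ⟨0, by rw [(Form.unit M X hk).2.2.2.1 P Q z hz]; simp⟩

theorem Form.unit_hodge (k : ℤ) (hk : k = 0) : Form.unit M X hk ∈ Form.hodge M X 0 k := by
  subst hk
  intro P Q z
  by_cases hz : z ∈ dom P Q
  · refine Submodule.subset_span ⟨Fin.elim0, Nat.zero_le _, ?_⟩
    funext v
    rw [Form.unit_apply rfl hz]
    exact (Matrix.det_isEmpty (n := Fin 0)).symm
  · rw [(Form.unit M X rfl).2.2.2.1 P Q z hz]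
    exact Submodule.zero_mem _

theorem Form.unit_invariants (k : ℤ) (hk : k = 0) :
    Form.unit M X hk ∈ Form.invariants M X k := by
  funext P Q z
  ext v
  have e : (galois (Form.unit M X hk).1 P Q z) v = starRingEnd ℂ
    ((Form.unit M X hk).1 P Q.conj (conjCrd _ _ z) (conjCrd _ _ ∘ v)) := rfl
  rw [e]
  by_cases hz : z ∈ dom P Q
  · have hz' : conjCrd _ _ z ∈ dom P Q.conj := by
      rw [dom_conj] at hz
      exact hz
    rw [Form.unit_apply hk hz, Form.unit_apply hk hz', map_one]
  · have hz' : conjCrd _ _ z ∉ dom P Q.conj := by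
      rw [dom_conj] at hz
      exact hz
    rw [(Form.unit M X hk).2.2.2.1 P Q z hz, (Form.unit M X hk).2.2.2.1 P Q.conj _ hz']
    exact map_zero _

/-! ### The bigraded algebra -/

/-- Sequences of forms `(ω_p)_p` where `ω_p` has degree `n + 2p`. -/
abbrev FormSeq (M : CornerMfd) (X : Scheme.{0}) (n : ℤ) : Type := ∀ p : ℕ, Form M X (n + 2 * p)

/-- The product `(x ∧ y)_r = ∑_{p + q = r} x_p ∧ y_q` of sequences of forms. -/
def FormSeq.mul (n m k : ℤ) : FormSeq M X n →ₗ[ℝ] FormSeq M X m →ₗ[ℝ] FormSeq M X k :=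
  LinearMap.mk₂ ℝ
    (fun x y r => ∑ pq ∈ Finset.HasAntidiagonal.antidiagonal r,
      Form.wedge (n + 2 * pq.1) (m + 2 * pq.2) (k + 2 * r) (x pq.1) (y pq.2))
    (fun x x' y => funext fun r => by
      simp only [Pi.add_apply, map_add, LinearMap.add_apply, Finset.sum_add_distrib])
    (fun c x y => funext fun r => by
      simp only [Pi.smul_apply, map_smul, LinearMap.smul_apply, Finset.smul_sum])
    (fun x y y' => funext fun r => by
      simp only [Pi.add_apply, map_add, Finset.sum_add_distrib])
    (fun c x y => funext fun r => by
      simp only [Pi.smul_apply, map_smul, Finset.smul_sum])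

theorem FormSeq.mul_apply (n m k : ℤ) (x : FormSeq M X n) (y : FormSeq M X m) (r : ℕ) :
    FormSeq.mul n m k x y r = ∑ pq ∈ Finset.HasAntidiagonal.antidiagonal r,
      Form.wedge (n + 2 * pq.1) (m + 2 * pq.2) (k + 2 * r) (x pq.1) (y pq.2) := rfl

/-- The sequence `(1, 0, 0, …)`. -/
def FormSeq.one (M : CornerMfd) (X : Scheme.{0}) : FormSeq M X 0 := fun p =>
  if h : p = 0 then Form.unit M X (by omega) else 0

theorem FormSeq.one_zero : FormSeq.one M X 0 = Form.unit M X (by simp) := dif_pos rfl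

theorem FormSeq.one_of_ne {p : ℕ} (h : p ≠ 0) : FormSeq.one M X p = 0 := dif_neg h

theorem FormSeq.one_mul (n : ℤ) (x : FormSeq M X n) :
    FormSeq.mul 0 n n (FormSeq.one M X) x = x := by
  funext r
  rw [FormSeq.mul_apply, Finset.sum_eq_single (0, r)]
  · rw [FormSeq.one_zero]
    exact Form.unit_wedge (by simp) (x r)
  · rintro ⟨p, q⟩ h hne
    have hp : p ≠ 0 := by
      rintro rfl
      simp_all
    rw [FormSeq.one_of_ne hp, map_zero, LinearMap.zero_apply]
  · simp

/-- The signs attached to an integral and to a natural exponent of the same parity agree.  It is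
used to pass from the degree `n` to the degree `n + 2p` of the underlying form. -/
theorem negOnePow_smul_eq {V : Type*} [AddCommGroup V] [Module ℝ V] {n : ℤ} {k : ℕ}
    (h : Even n ↔ Even k) (x : V) : n.negOnePow • x = (-1 : ℝ) ^ k • x := by
  obtain hn | hn := Int.even_or_odd n
  · rw [Int.negOnePow_even _ hn, (h.1 hn).neg_one_pow, one_smul, one_smul]
  · have hk : Odd k := by
      rw [← Nat.not_even_iff_odd, ← h]
      exact Int.not_even_iff_odd.2 hn
    rw [Int.negOnePow_odd _ hn, hk.neg_one_pow, Units.neg_smul, one_smul, neg_smul, one_smul]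

theorem even_toNat_iff {n : ℤ} {p : ℕ} (h : 0 ≤ n + 2 * p) : Even n ↔ Even (n + 2 * p).toNat := by
  rw [← Int.even_coe_nat, Int.toNat_of_nonneg h]
  simp [Int.even_add]

theorem FormSeq.mul_comm (n m k : ℤ) (x : FormSeq M X n) (y : FormSeq M X m) :
    FormSeq.mul n m k x y = (n * m).negOnePow • FormSeq.mul m n k y x := by
  funext r
  rw [Pi.smul_apply, FormSeq.mul_apply, FormSeq.mul_apply, Finset.smul_sum,
    ← Finset.Nat.sum_antidiagonal_swap]
  refine Finset.sum_congr rfl fun pq _ => ?_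
  by_cases hn : n + 2 * (pq.2 : ℤ) < 0
  · simp [Form.eq_zero_of_neg hn (x pq.2)]
  by_cases hm : m + 2 * (pq.1 : ℤ) < 0
  · simp [Form.eq_zero_of_neg hm (y pq.1)]
  rw [negOnePow_smul_eq (k := (n + 2 * pq.2).toNat * (m + 2 * pq.1).toNat)]
  · exact Form.wedge_comm _ _ _
  · rw [Int.even_mul, Nat.even_mul, even_toNat_iff (not_lt.1 hn), even_toNat_iff (not_lt.1 hm)]

theorem FormSeq.mul_one (n : ℤ) (x : FormSeq M X n) :
    FormSeq.mul n 0 n x (FormSeq.one M X) = x := by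
  rw [FormSeq.mul_comm, FormSeq.one_mul]
  simp

theorem FormSeq.mul_assoc {n m l nm ml k : ℤ} (h₁ : n + m = nm) (h₂ : nm + l = k)
    (h₃ : m + l = ml) (x : FormSeq M X n) (y : FormSeq M X m)
    (z : FormSeq M X l) :
    FormSeq.mul nm l k (FormSeq.mul n m nm x y) z =
      FormSeq.mul n ml k x (FormSeq.mul m l ml y z) := by
  funext r
  simp only [FormSeq.mul_apply, map_sum, LinearMap.sum_apply, Finset.sum_sigma']
  refine Finset.sum_nbij' (fun ⟨⟨_i, j⟩, ⟨k, l⟩⟩ => ⟨(k, l + j), (l, j)⟩)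
    (fun ⟨⟨i, _j⟩, ⟨k, l⟩⟩ => ⟨(i + k, l), (i, k)⟩) ?_ ?_ ?_ ?_ ?_
  · rintro ⟨⟨i, j⟩, ⟨p, q⟩⟩ h
    simp only [Finset.mem_sigma, Finset.HasAntidiagonal.mem_antidiagonal] at h ⊢
    obtain ⟨h₁, h₂⟩ := h
    constructor <;> (try dsimp only at *) <;> omega
  · rintro ⟨⟨i, j⟩, ⟨p, q⟩⟩ h
    simp only [Finset.mem_sigma, Finset.HasAntidiagonal.mem_antidiagonal] at h ⊢
    obtain ⟨h₁, h₂⟩ := h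
    constructor <;> (try dsimp only at *) <;> omega
  · rintro ⟨⟨_, _⟩, ⟨_, _⟩⟩
    simp +contextual
  · rintro ⟨⟨_, _⟩, ⟨_, _⟩⟩
    simp +contextual
  · rintro ⟨⟨i, j⟩, ⟨p, q⟩⟩ h
    simp only [Finset.mem_sigma, Finset.HasAntidiagonal.mem_antidiagonal] at h
    obtain ⟨hr, hi⟩ := h
    refine Form.wedge_assoc ?_ ?_ ?_ ?_ _ _ _ <;> push_cast <;> omega

/-- The differential of sequences of forms. -/
def FormSeq.d (n m : ℤ) : FormSeq M X n →ₗ[ℝ] FormSeq M X m :=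
  LinearMap.pi fun p => Form.d (n + 2 * p) (m + 2 * p) ∘ₗ LinearMap.proj p

theorem FormSeq.d_apply (n m : ℤ) (x : FormSeq M X n) (p : ℕ) :
    FormSeq.d n m x p = Form.d (n + 2 * p) (m + 2 * p) (x p) := rfl

theorem FormSeq.d_mul {n n' m m' k k' : ℤ} (hn : n + 1 = n') (hm : m + 1 = m') (hk : k + 1 = k')
    (h : n + m = k) (x : FormSeq M X n) (y : FormSeq M X m) :
    FormSeq.d k k' (FormSeq.mul n m k x y) =
      FormSeq.mul n' m k' (FormSeq.d n n' x) y +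
        n.negOnePow • FormSeq.mul n m' k' x (FormSeq.d m m' y) := by
  funext r
  rw [Pi.add_apply, Pi.smul_apply]
  simp only [FormSeq.mul_apply, FormSeq.d_apply, map_sum, Finset.smul_sum]
  rw [← Finset.sum_add_distrib]
  refine Finset.sum_congr rfl fun pq hpq => ?_
  rw [Finset.HasAntidiagonal.mem_antidiagonal] at hpq
  by_cases hn0 : n + 2 * (pq.1 : ℤ) < 0
  · simp [Form.eq_zero_of_neg hn0 (x pq.1)]
  rw [negOnePow_smul_eq (even_toNat_iff (not_lt.1 hn0))]
  exact Form.d_wedge (by omega) (by omega) (by omega) (by omega) _ _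

theorem wedge_mem_idr {p q r : ℕ} (hr : p + q = r) {n m : ℤ} (k : ℤ)
    {α : Form (cyl M) X (n + 2 * p)} {β : Form (cyl M) X (m + 2 * q)}
    (hα : α ∈ idr p M X n) (hβ : β ∈ idr q M X m) :
    Form.wedge (n + 2 * p) (m + 2 * q) (k + 2 * r) α β ∈ idr r M X k := by
  refine ⟨⟨?_, ?_⟩, Form.wedge_invariants _ hα.2 hβ.2⟩
  · change Form.restrict 0 _ (Form.wedge _ _ _ α β) ∈ Form.real M X r _
    rw [Form.restrict_wedge]
    exact Form.wedge_real hr _ hα.1.1 hβ.1.1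
  · change Form.restrict 1 _ (Form.wedge _ _ _ α β) ∈ Form.hodge M X r _
    rw [Form.restrict_wedge]
    exact Form.wedge_hodge hr _ hα.1.2 hβ.1.2

/-- The sequences in `∏_p IDR(p)^n(M × X)`. -/
abbrev IdrSeq (M : CornerMfd) (X : Scheme.{0}) (n : ℤ) : Type := ∀ p : ℕ, idr p M X n

/-- The sequence of forms underlying an element of `∏_p IDR(p)^n(M × X)`. -/
def IdrSeq.forms (M : CornerMfd) (X : Scheme.{0}) (n : ℤ) :
    IdrSeq M X n →ₗ[ℝ] FormSeq (cyl M) X n :=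
  LinearMap.pi fun p => (idr p M X n).subtype ∘ₗ LinearMap.proj p

theorem IdrSeq.forms_apply (n : ℤ) (x : IdrSeq M X n) (p : ℕ) :
    IdrSeq.forms M X n x p = (x p).1 := rfl

theorem IdrSeq.forms_injective (n : ℤ) : Function.Injective (IdrSeq.forms M X n) :=
  fun _ _ h => funext fun p => Subtype.ext (congrFun h p)

theorem FormSeq.mul_mem_idr {n m : ℤ} (k : ℤ) (x : IdrSeq M X n) (y : IdrSeq M X m) (r : ℕ) :
    FormSeq.mul n m k (IdrSeq.forms M X n x) (IdrSeq.forms M X m y) r ∈ idr r M X k :=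
  Submodule.sum_mem _ fun pq hpq => wedge_mem_idr (Finset.HasAntidiagonal.mem_antidiagonal.1 hpq) k
    (x pq.1).2 (y pq.2).2

/-- The product on `∏_p IDR(p)(M × X)`. -/
def IdrSeq.mul (n m k : ℤ) : IdrSeq M X n →ₗ[ℝ] IdrSeq M X m →ₗ[ℝ] IdrSeq M X k :=
  LinearMap.mk₂ ℝ (fun x y r => ⟨_, FormSeq.mul_mem_idr k x y r⟩)
    (fun x x' y => by
      apply IdrSeq.forms_injective
      refine Eq.trans ?_ (map_add (IdrSeq.forms M X k) _ _).symm
      change FormSeq.mul n m k (IdrSeq.forms M X n (x + x')) (IdrSeq.forms M X m y) =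
        FormSeq.mul n m k (IdrSeq.forms M X n x) (IdrSeq.forms M X m y) +
          FormSeq.mul n m k (IdrSeq.forms M X n x') (IdrSeq.forms M X m y)
      rw [map_add, LinearMap.map_add₂])
    (fun c x y => by
      apply IdrSeq.forms_injective
      refine Eq.trans ?_ (map_smul (IdrSeq.forms M X k) _ _).symm
      change FormSeq.mul n m k (IdrSeq.forms M X n (c • x)) (IdrSeq.forms M X m y) =
        c • FormSeq.mul n m k (IdrSeq.forms M X n x) (IdrSeq.forms M X m y)
      rw [map_smul, LinearMap.map_smul₂])
    (fun x y y' => by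
      apply IdrSeq.forms_injective
      refine Eq.trans ?_ (map_add (IdrSeq.forms M X k) _ _).symm
      change FormSeq.mul n m k (IdrSeq.forms M X n x) (IdrSeq.forms M X m (y + y')) =
        FormSeq.mul n m k (IdrSeq.forms M X n x) (IdrSeq.forms M X m y) +
          FormSeq.mul n m k (IdrSeq.forms M X n x) (IdrSeq.forms M X m y')
      rw [map_add, map_add])
    (fun c x y => by
      apply IdrSeq.forms_injective
      refine Eq.trans ?_ (map_smul (IdrSeq.forms M X k) _ _).symm
      change FormSeq.mul n m k (IdrSeq.forms M X n x) (IdrSeq.forms M X m (c • y)) =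
        c • FormSeq.mul n m k (IdrSeq.forms M X n x) (IdrSeq.forms M X m y)
      rw [map_smul, map_smul])

/-- The unit of `∏_p IDR(p)(M × X)`, the constant function `1` in weight `0`. -/
def IdrSeq.one (M : CornerMfd) (X : Scheme.{0}) : IdrSeq M X 0 := fun p =>
  ⟨FormSeq.one (cyl M) X p, by
    by_cases hp : p = 0
    · subst hp
      rw [FormSeq.one_zero]
      exact ⟨⟨Form.unit_real (M := M) (X := X) _ (by simp), Form.unit_hodge (M := M) (X := X) _
        (by simp)⟩, Form.unit_invariants _ _⟩
    · rw [FormSeq.one_of_ne hp]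
      exact Submodule.zero_mem _⟩

theorem IdrSeq.forms_negOnePow_smul (n k : ℤ) (x : IdrSeq M X k) :
    IdrSeq.forms M X k (n.negOnePow • x) = n.negOnePow • IdrSeq.forms M X k x := by
  obtain hn | hn := Int.even_or_odd n
  · rw [Int.negOnePow_even _ hn, one_smul, one_smul]
  · rw [Int.negOnePow_odd _ hn, Units.neg_smul, Units.neg_smul, one_smul, one_smul, map_neg]

/-- The differential of `∏_p IDR(p)(M × X)`. -/
def IdrSeq.d (n m : ℤ) : IdrSeq M X n →ₗ[ℝ] IdrSeq M X m :=
  LinearMap.pi fun p => idrD p M X n m ∘ₗ LinearMap.proj p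

theorem IdrSeq.d_mul {n n' m m' k k' : ℤ} (hn : n + 1 = n') (hm : m + 1 = m') (hk : k + 1 = k')
    (h : n + m = k) (x : IdrSeq M X n) (y : IdrSeq M X m) :
    IdrSeq.d k k' (IdrSeq.mul n m k x y) =
      IdrSeq.mul n' m k' (IdrSeq.d n n' x) y +
        n.negOnePow • IdrSeq.mul n m' k' x (IdrSeq.d m m' y) := by
  apply IdrSeq.forms_injective
  rw [map_add, IdrSeq.forms_negOnePow_smul]
  exact FormSeq.d_mul hn hm hk h _ _

theorem IdrSeq.mul_comm (n m k : ℤ) (x : IdrSeq M X n) (y : IdrSeq M X m) :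
    IdrSeq.mul n m k x y = (n * m).negOnePow • IdrSeq.mul m n k y x := by
  apply IdrSeq.forms_injective
  rw [IdrSeq.forms_negOnePow_smul]
  exact FormSeq.mul_comm _ _ _ _ _

theorem IdrSeq.mul_weight (n m k : ℤ) (p q : ℕ) (x : IdrSeq M X n) (y : IdrSeq M X m)
    (hx : ∀ r ≠ p, x r = 0) (hy : ∀ r ≠ q, y r = 0) (r : ℕ) (hr : r ≠ p + q) :
    IdrSeq.mul n m k x y r = 0 := by
  apply Subtype.ext
  change FormSeq.mul n m k (IdrSeq.forms M X n x) (IdrSeq.forms M X m y) r = 0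
  rw [FormSeq.mul_apply]
  refine Finset.sum_eq_zero fun ij hij => ?_
  rw [Finset.HasAntidiagonal.mem_antidiagonal] at hij
  by_cases hi : ij.1 = p
  · have hj : ij.2 ≠ q := by omega
    rw [IdrSeq.forms_apply _ y, hy _ hj]
    exact map_zero _
  · rw [IdrSeq.forms_apply _ x, hx _ hi]
    exact LinearMap.map_zero₂ _ _

/-- The wedge product makes `IDR(M × X)` a bigraded graded commutative differential graded
algebra. -/
def idrAlgebra (Z : Pairsᵒᵖ) : BigradedCDGA fun p => (IDRp p).obj Z where
  one := IdrSeq.one Z.unop.1 Z.unop.2.obj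
  mul n m k _ := IdrSeq.mul (M := Z.unop.1) (X := Z.unop.2.obj) n m k
  one_mul n _ _ := IdrSeq.forms_injective (M := Z.unop.1) (X := Z.unop.2.obj) n
    (FormSeq.one_mul n _)
  mul_one n _ _ := IdrSeq.forms_injective (M := Z.unop.1) (X := Z.unop.2.obj) n
    (FormSeq.mul_one n _)
  mul_assoc _ _ _ _ _ k h₁ h₂ h₃ _ _ _ _ :=
    IdrSeq.forms_injective (M := Z.unop.1) (X := Z.unop.2.obj) k
      (FormSeq.mul_assoc h₁ h₂ h₃ _ _ _)
  mul_comm n m k _ _ x y := IdrSeq.mul_comm (M := Z.unop.1) (X := Z.unop.2.obj) n m k x y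
  leibniz _ _ _ _ _ _ hn hm hk h _ _ x y :=
    IdrSeq.d_mul (M := Z.unop.1) (X := Z.unop.2.obj) hn hm hk h x y
  one_weight _ hr := Subtype.ext (FormSeq.one_of_ne hr)
  mul_weight n m k _ p q x y hx hy r hr :=
    IdrSeq.mul_weight (M := Z.unop.1) (X := Z.unop.2.obj) n m k p q x y hx hy r hr

theorem Form.sum_val {k : ℤ} {ι : Type*} (s : Finset ι) (α : ι → Form M X k) (P : MPlot M)
    (Q : XPlot X) (z : Crd P.dim Q.dim) (v : Fin k.toNat → Crd P.dim Q.dim) :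
    (∑ i ∈ s, α i).1 P Q z v = ∑ i ∈ s, (α i).1 P Q z v := by
  let L : Form M X k →+ ℂ :=
    { toFun := fun α => α.1 P Q z v
      map_zero' := rfl
      map_add' := fun _ _ => rfl }
  exact map_sum L α s

theorem idrAlgebra_mul_val (Z : Pairsᵒᵖ) (n m k : ℤ) (h : n + m = k)
    (x : (IDR.obj Z).X n) (y : (IDR.obj Z).X m) (r : ℕ) (P : MPlot (cyl Z.unop.1))
    (Q : XPlot Z.unop.2.obj) (z : Crd P.dim Q.dim)
    (v : Fin (k + 2 * (r : ℤ)).toNat → Crd P.dim Q.dim) :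
    (IDR.form (Z := Z) ((idrAlgebra Z).mul n m k h x y) r).1 P Q z v =
      ∑ pq ∈ Finset.HasAntidiagonal.antidiagonal r,
        Deligne.wedge ((IDR.form x pq.1).1 P Q z) ((IDR.form y pq.2).1 P Q z) v := by
  refine (Form.sum_val _ _ P Q z v).trans (Finset.sum_congr rfl fun pq hpq => ?_)
  rw [Finset.HasAntidiagonal.mem_antidiagonal] at hpq
  rw [Form.wedge_val (by omega), wedgeForm_apply]
  rfl

theorem idrAlgebra_one_val (Z : Pairsᵒᵖ) {P : MPlot (cyl Z.unop.1)} {Q : XPlot Z.unop.2.obj}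
    {z : Crd P.dim Q.dim} (hz : z ∈ dom P Q) (v) :
    (IDR.form (Z := Z) (idrAlgebra Z).one 0).1 P Q z v = 1 :=
  Form.unit_apply (M := cyl Z.unop.1) (X := Z.unop.2.obj) (k := 0 + 2 * ((0 : ℕ) : ℤ)) (by simp)
    hz v

theorem idrAlgebra_map_one {Z W : Pairsᵒᵖ} (f : Z ⟶ W) :
    ((IDR.map f).f 0).hom (idrAlgebra Z).one = (idrAlgebra W).one := by
  refine funext fun p => Subtype.ext ?_
  change Form.pull (cylMap f.unop.1) f.unop.2.hom _ (FormSeq.one _ _ p) = FormSeq.one _ _ p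
  by_cases hp : p = 0
  · subst hp
    rfl
  · rw [FormSeq.one_of_ne hp, FormSeq.one_of_ne hp, map_zero]

theorem idrAlgebra_map_mul {Z W : Pairsᵒᵖ} (f : Z ⟶ W) (n m k : ℤ) (h : n + m = k)
    (x : (IDR.obj Z).X n) (y : (IDR.obj Z).X m) :
    ((IDR.map f).f k).hom ((idrAlgebra Z).mul n m k h x y) =
      (idrAlgebra W).mul n m k h (((IDR.map f).f n).hom x) (((IDR.map f).f m).hom y) := by
  refine funext fun r => Subtype.ext ?_
  refine (map_sum (Form.pull (cylMap f.unop.1) f.unop.2.hom (k + 2 * r)) _ _).trans ?_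
  exact Finset.sum_congr rfl fun pq _ => Form.pull_wedge _ _ _ _ _ _ _

/-! ### Open submanifolds and lifts along open embeddings -/

theorem SmoothMap.IsOpenEmbedding.exists_local_inverse {f : SmoothMap N M} (hf : f.IsOpenEmbedding)
    {i : N.ι} {x : N.Pt i} {j : M.ι} {y : M.Pt j} (h : f.toFun ⟨i, x⟩ = ⟨j, y⟩) :
    ∃ Ψ : M.Pt j → N.Pt i, ContMDiffAt (M.model j) (N.model i) ∞ Ψ y ∧
      ∀ᶠ y' in 𝓝 y, f.toFun ⟨i, Ψ y'⟩ = ⟨j, y'⟩ := by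
  obtain ⟨j', Φ, hx, hΦ⟩ := hf.2 i x
  have e := (hΦ x hx).symm.trans h
  obtain rfl : j' = j := congrArg Sigma.fst e
  obtain rfl : Φ x = y := eq_of_heq (Sigma.mk.inj_iff.1 e).2
  have hy : Φ x ∈ Φ.target := Φ.map_source hx
  refine ⟨Φ.invFun, Φ.contMDiffOn_invFun.contMDiffAt (Φ.open_target.mem_nhds hy), ?_⟩
  filter_upwards [Φ.open_target.mem_nhds hy] with y' hy'
  exact (hΦ _ (Φ.map_target hy')).trans (congrArg (Sigma.mk j') (Φ.right_inv hy'))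

/-- A map which becomes smooth after composition with an open embedding is smooth. -/
def SmoothMap.IsOpenEmbedding.lift {K : CornerMfd} {f : SmoothMap N M} (hf : f.IsOpenEmbedding)
    (g : SmoothMap K M) (h : ∀ k, g.toFun k ∈ range f.toFun) : SmoothMap K N where
  toFun k := (h k).choose
  smooth i x := by
    obtain ⟨j, b, hb, hgb⟩ := g.smooth i x
    have hfg (k) : f.toFun (h k).choose = g.toFun k := (h k).choose_spec
    have hx : f.toFun ⟨(h ⟨i, x⟩).choose.1, (h ⟨i, x⟩).choose.2⟩ = ⟨j, b x⟩ :=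
      (hfg _).trans hgb.self_of_nhds
    obtain ⟨Ψ, hΨ, hf'⟩ := hf.exists_local_inverse hx
    refine ⟨_, Ψ ∘ b, hΨ.comp x hb, ?_⟩
    filter_upwards [hgb, hb.continuousAt.eventually hf'] with y h1 h2
    exact hf.1 ((hfg _).trans (h1.trans h2.symm))

theorem SmoothMap.IsOpenEmbedding.lift_spec {K : CornerMfd} {f : SmoothMap N M}
    (hf : f.IsOpenEmbedding) (g : SmoothMap K M) (h : ∀ k, g.toFun k ∈ range f.toFun) (k) :
    f.toFun ((hf.lift g h).toFun k) = g.toFun k := (h k).choose_spec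

theorem SmoothMap.isOpen_preimage_range {K : CornerMfd} {f : SmoothMap N M}
    (hf : f.IsOpenEmbedding) (g : SmoothMap K M) (i : K.ι) :
    IsOpen {x : K.Pt i | g.toFun ⟨i, x⟩ ∈ range f.toFun} := by
  refine isOpen_iff_mem_nhds.2 ?_
  rintro x ⟨⟨k, n⟩, hn⟩
  obtain ⟨j, b, hb, hgb⟩ := g.smooth i x
  obtain ⟨Ψ, hΨ, hf'⟩ := hf.exists_local_inverse (hn.trans hgb.self_of_nhds)
  filter_upwards [hgb, hb.continuousAt.eventually hf'] with y h1 h2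
  exact ⟨_, h2.trans h1.symm⟩

theorem MPlot.eventually_mem_range {f : SmoothMap N M} (hf : f.IsOpenEmbedding) (P : MPlot M)
    {u : Fin P.dim → ℝ} (hu : u ∈ P.U) (h : P.φ u ∈ range f.toFun) :
    ∀ᶠ v in 𝓝[P.U] u, P.φ v ∈ range f.toFun := by
  obtain ⟨⟨k, n⟩, hn⟩ := h
  obtain ⟨j, b, hb, hP⟩ := P.smooth u hu
  obtain ⟨Ψ, hΨ, hf'⟩ := hf.exists_local_inverse (hn.trans (hP.self_of_nhdsWithin hu))
  filter_upwards [hP, hb.continuousWithinAt.eventually hf'] with y h1 h2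
  exact ⟨_, h2.trans h1.symm⟩

theorem MPlot.nonempty (P : MPlot M) : P.U.Nonempty := P.nonempty_interior.mono interior_subset

/-- The lift of a parametrisation along an open embedding whose image contains its image.  Outside
the coordinate domain, where the parametrisation may leave that image, the value is arbitrary. -/
@[reducible] def MPlot.lift {f : SmoothMap N M} (hf : f.IsOpenEmbedding) (P : MPlot M)
    (h : ∀ u ∈ P.U, P.φ u ∈ range f.toFun) : MPlot N where
  dim := P.dim
  U := P.U
  convex := P.convex
  nonempty_interior := P.nonempty_interior
  φ u := open Classical in
    if hu : P.φ u ∈ range f.toFun then hu.choose else (h _ P.nonempty.some_mem).choose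
  smooth u hu := by
    obtain ⟨j, b, hb, hP⟩ := P.smooth u hu
    have hu' : f.toFun ⟨(h u hu).choose.1, (h u hu).choose.2⟩ = ⟨j, b u⟩ :=
      (h u hu).choose_spec.trans (hP.self_of_nhdsWithin hu)
    obtain ⟨Ψ, hΨ, hf'⟩ := hf.exists_local_inverse hu'
    refine ⟨_, Ψ ∘ b, hΨ.comp_contMDiffWithinAt u hb, ?_⟩
    filter_upwards [hP, hb.continuousWithinAt.eventually hf', self_mem_nhdsWithin] with y h1 h2 hy
    rw [dif_pos (h y hy)]
    exact hf.1 ((h y hy).choose_spec.trans (h1.trans h2.symm))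

theorem MPlot.lift_spec {f : SmoothMap N M} (hf : f.IsOpenEmbedding) (P : MPlot M)
    (h : ∀ u ∈ P.U, P.φ u ∈ range f.toFun) {u : Fin P.dim → ℝ} (hu : u ∈ P.U) :
    f.toFun ((P.lift hf h).φ u) = P.φ u := by
  have e : (P.lift hf h).φ u = (h u hu).choose := dif_pos (h u hu)
  rw [e]
  exact (h u hu).choose_spec

/-- The restriction of a parametrisation to a ball. -/
@[reducible] def MPlot.restrict (P : MPlot M) {c : Fin P.dim → ℝ} (hc : c ∈ P.U) {r : ℝ}
    (hr : 0 < r) : MPlot M where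
  dim := P.dim
  U := P.U ∩ Metric.ball c r
  convex := P.convex.inter (convex_ball c r)
  nonempty_interior := by
    have h1 : c ∈ closure (interior P.U) := by
      rw [P.convex.closure_interior_eq_closure_of_nonempty_interior P.nonempty_interior]
      exact subset_closure hc
    obtain ⟨y, hy, hy'⟩ := mem_closure_iff.1 h1 _ Metric.isOpen_ball (Metric.mem_ball_self hr)
    rw [interior_inter, Metric.isOpen_ball.interior_eq]
    exact ⟨y, hy', hy⟩
  φ := P.φ
  smooth u hu := by
    obtain ⟨j, b, hb, hP⟩ := P.smooth u hu.1
    exact ⟨j, b, hb.mono inter_subset_left, nhdsWithin_mono u inter_subset_left hP⟩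

/-- The open submanifold of `M` given by open subsets of its components. -/
def CornerMfd.sub (M : CornerMfd) (O : ∀ i, TopologicalSpace.Opens (M.Pt i)) : CornerMfd where
  ι := M.ι
  countable := M.countable
  E := M.E
  H := M.H
  Pt i := O i
  model := M.model
  corner := M.corner
  manifold i := inferInstance
  t2 i := by have := M.t2 i; infer_instance
  secondCountable i := by have := M.secondCountable i; infer_instance

/-- The inclusion of an open submanifold. -/
def subIncl (M : CornerMfd) (O : ∀ i, TopologicalSpace.Opens (M.Pt i)) :
    SmoothMap (M.sub O) M where
  toFun x := ⟨x.1, (show O x.1 from x.2).1⟩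
  smooth := by
    intro (i : M.ι) (x : O i)
    exact ⟨i, fun y : O i => y.1, (contMDiff_subtype_val (I := M.model i) (U := O i)) x,
      Eventually.of_forall fun _ => rfl⟩

theorem mem_range_subIncl {O : ∀ i, TopologicalSpace.Opens (M.Pt i)} {x : M.Point} :
    x ∈ range (subIncl M O).toFun ↔ x.2 ∈ O x.1 := by
  constructor
  · rintro ⟨y, rfl⟩
    exact (show O y.1 from y.2).2
  · exact fun h => ⟨⟨x.1, (⟨x.2, h⟩ : O x.1)⟩, rfl⟩

theorem subIncl_isOpenEmbedding (M : CornerMfd) (O : ∀ i, TopologicalSpace.Opens (M.Pt i)) :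
    (subIncl M O).IsOpenEmbedding := by
  refine ⟨?_, ?_⟩
  · rintro ⟨(i : M.ι), (x : O i)⟩ ⟨(j : M.ι), (y : O j)⟩ h
    obtain rfl : i = j := congrArg Sigma.fst h
    have := eq_of_heq (Sigma.mk.inj_iff.1 h).2
    exact congrArg (Sigma.mk (β := (M.sub O).Pt) i) (Subtype.ext this)
  · intro (i : M.ι) (x : O i)
    have hx : Nonempty (O i) := ⟨x⟩
    let e := (O i).openPartialHomeomorphSubtypeCoe hx
    let Φ : PartialDiffeomorph (M.model i) (M.model i) (O i) (M.Pt i) ∞ :=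
      { toPartialEquiv := e.toPartialEquiv
        open_source := e.open_source
        open_target := e.open_target
        contMDiffOn_toFun := (contMDiff_subtype_val (I := M.model i) (U := O i)).contMDiffOn
        contMDiffOn_invFun := by
          intro y hy
          refine (ContMDiffWithinAt.subtypeVal_comp_iff (O i) _ _ _).1 ?_
          exact contMDiffWithinAt_id.congr (fun z hz => e.right_inv hz) (e.right_inv hy) }
    exact ⟨i, Φ, trivial, fun _ _ => rfl⟩

theorem cylMap_isOpenEmbedding {f : SmoothMap M N} (hf : f.IsOpenEmbedding) :
    (cylMap f).IsOpenEmbedding := by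
  refine ⟨?_, ?_⟩
  · rintro ⟨(i : M.ι), (x : Icc (0 : ℝ) 1 × M.Pt i)⟩ ⟨(j : M.ι), (y : Icc (0 : ℝ) 1 × M.Pt j)⟩ h
    have h1 : f.toFun ⟨i, x.2⟩ = f.toFun ⟨j, y.2⟩ := by
      have h' : (cylProj N).toFun ((cylMap f).toFun ⟨i, x⟩) =
        (cylProj N).toFun ((cylMap f).toFun ⟨j, y⟩) := congrArg _ h
      exact h'
    have h2 : x.1 = y.1 :=
      congrArg (fun z : (cyl N).Point => (show Icc (0 : ℝ) 1 × N.Pt z.1 from z.2).1) h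
    have h3 := hf.1 h1
    obtain rfl : i = j := congrArg Sigma.fst h3
    have h4 := eq_of_heq (Sigma.mk.inj_iff.1 h3).2
    exact congrArg (Sigma.mk (β := (cyl M).Pt) i) (Prod.ext h2 h4)
  · intro (i : M.ι) (x : Icc (0 : ℝ) 1 × M.Pt i)
    obtain ⟨j, Φ, hx, hΦ⟩ := hf.2 i x.2
    let Ψ : PartialDiffeomorph ((𝓡∂ 1).prod (M.model i)) ((𝓡∂ 1).prod (N.model j))
        (Icc (0 : ℝ) 1 × M.Pt i) (Icc (0 : ℝ) 1 × N.Pt j) ∞ :=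
      { toPartialEquiv := (PartialEquiv.refl (Icc (0 : ℝ) 1)).prod Φ.toPartialEquiv
        open_source := isOpen_univ.prod Φ.open_source
        open_target := isOpen_univ.prod Φ.open_target
        contMDiffOn_toFun := contMDiffOn_id.prodMap Φ.contMDiffOn_toFun
        contMDiffOn_invFun := contMDiffOn_id.prodMap Φ.contMDiffOn_invFun }
    refine ⟨j, Ψ, ⟨trivial, hx⟩, fun (y : Icc (0 : ℝ) 1 × M.Pt i) hy => ?_⟩
    have h1 : (cylMap f).toFun ⟨i, y⟩ =
      ⟨(f.toFun ⟨i, y.2⟩).1, (y.1, (f.toFun ⟨i, y.2⟩).2)⟩ := rfl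
    rw [h1, hΦ y.2 hy.2]
    rfl

theorem mem_range_cylMap {f : SmoothMap M N} {x : (cyl N).Point} :
    x ∈ range (cylMap f).toFun ↔ (cylProj N).toFun x ∈ range f.toFun := by
  constructor
  · rintro ⟨y, rfl⟩
    exact ⟨(cylProj M).toFun y, rfl⟩
  · obtain ⟨(j : N.ι), (x : Icc (0 : ℝ) 1 × N.Pt j)⟩ := x
    rintro ⟨⟨i, y⟩, hy⟩
    refine ⟨⟨i, ((x.1, y) : Icc (0 : ℝ) 1 × M.Pt i)⟩, ?_⟩
    have h1 : (cylMap f).toFun ⟨i, ((x.1, y) : Icc (0 : ℝ) 1 × M.Pt i)⟩ =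
      ⟨(f.toFun ⟨i, y⟩).1, (x.1, (f.toFun ⟨i, y⟩).2)⟩ := rfl
    rw [h1, hy]
    rfl

/-! ### Open subschemes and lifts along open immersions -/

theorem evalAt_map_eqToHom {U V : X.Opens} (h : U = V) (f : Γ(X, V)) (x : CPoint X) :
    evalAt U (X.presheaf.map (eqToHom h).op f) x = evalAt V f x := by
  subst h
  simp

/-- Functions on an open subscheme are functions on an open subset of the ambient scheme, with the
same values at complex points. -/
theorem evalAt_comp_openImmersion (g : Y ⟶ X) [IsOpenImmersion g] (W : Y.Opens) (f : Γ(Y, W))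
    (x : CPoint Y) : evalAt (g ''ᵁ W) ((g.appIso W).inv f) (x ≫ g) = evalAt W f x := by
  have e : g.app (g ''ᵁ W) ((g.appIso W).inv f) =
      Y.presheaf.map (eqToHom (g.preimage_image_eq W)).op f :=
    congrArg (fun k => k f) (g.appIso_inv_app W)
  rw [evalAt_comp, e, evalAt_map_eqToHom]

theorem range_subset_of_le_preimage {g : Y ⟶ X} [IsOpenImmersion g] {x : CPoint X}
    (h : ⊤ ≤ x ⁻¹ᵁ g.opensRange) : range x ⊆ range g := by
  rintro _ ⟨s, rfl⟩
  exact h (x := s) trivial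

/-- A complex point lies in `W` as soon as its only topological point `s` does. -/
theorem top_le_preimage_iff (x : CPoint X) (W : X.Opens) (s : Spec (.of ℂ)) :
    ⊤ ≤ x ⁻¹ᵁ W ↔ x s ∈ W := by
  have : Subsingleton (Spec (.of ℂ)) :=
    inferInstanceAs (Subsingleton (PrimeSpectrum ℂ))
  constructor
  · exact fun h => h (x := s) trivial
  · intro h t _
    obtain rfl : t = s := Subsingleton.elim _ _
    exact h

/-- The lift of a parametrisation along an open immersion whose image contains its image.  Outside
the coordinate domain the value is arbitrary; the point `z₀` provides one. -/
@[reducible] def XPlot.lift (g : Y ⟶ X) [IsOpenImmersion g] (Q : XPlot X)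
    (h : ∀ z ∈ Q.V, ⊤ ≤ Q.ψ z ⁻¹ᵁ g.opensRange) {z₀ : Fin Q.dim → ℂ} (h₀ : z₀ ∈ Q.V) :
    XPlot Y :=
  let ψ' : (Fin Q.dim → ℂ) → CPoint Y := fun z => open Classical in
    if hz : ⊤ ≤ Q.ψ z ⁻¹ᵁ g.opensRange then
      IsOpenImmersion.lift g (Q.ψ z) (range_subset_of_le_preimage hz)
    else IsOpenImmersion.lift g (Q.ψ z₀) (range_subset_of_le_preimage (h z₀ h₀))
  have hψ : ∀ z ∈ Q.V, ψ' z ≫ g = Q.ψ z := fun z hz => by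
    simp only [ψ', dif_pos (h z hz), IsOpenImmersion.lift_fac]
  have hV : ∀ W : Y.Opens, {z | z ∈ Q.V ∧ ⊤ ≤ ψ' z ⁻¹ᵁ W} =
      {z | z ∈ Q.V ∧ ⊤ ≤ Q.ψ z ⁻¹ᵁ (g ''ᵁ W)} := fun W => by
    ext z
    refine and_congr_right fun hz => ?_
    have e : Q.ψ z ⁻¹ᵁ (g ''ᵁ W) = ψ' z ⁻¹ᵁ (g ⁻¹ᵁ (g ''ᵁ W)) := by rw [← hψ z hz]; rfl
    rw [e, g.preimage_image_eq]
  { dim := Q.dim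
    V := Q.V
    isOpen := Q.isOpen
    ψ := ψ'
    isOpen_preimage := fun W => by
      rw [hV]
      exact Q.isOpen_preimage _
    holomorphic := fun W f => by
      rw [hV]
      refine (Q.holomorphic (g ''ᵁ W) ((g.appIso W).inv f)).congr fun z hz => ?_
      rw [← evalAt_comp_openImmersion g W f, hψ z hz.1] }

theorem XPlot.lift_spec (g : Y ⟶ X) [IsOpenImmersion g] (Q : XPlot X)
    (h : ∀ z ∈ Q.V, ⊤ ≤ Q.ψ z ⁻¹ᵁ g.opensRange) {z₀ : Fin Q.dim → ℂ} (h₀ : z₀ ∈ Q.V)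
    {z : Fin Q.dim → ℂ} (hz : z ∈ Q.V) : (Q.lift g h h₀).ψ z ≫ g = Q.ψ z := by
  simp only [dif_pos (h z hz), IsOpenImmersion.lift_fac]

/-- The restriction of a parametrisation to an open subset. -/
@[reducible] def XPlot.restrict (Q : XPlot X) {V : Set (Fin Q.dim → ℂ)} (hV : IsOpen V) :
    XPlot X where
  dim := Q.dim
  V := Q.V ∩ V
  isOpen := Q.isOpen.inter hV
  ψ := Q.ψ
  isOpen_preimage W := by
    have e : {z | z ∈ Q.V ∩ V ∧ ⊤ ≤ Q.ψ z ⁻¹ᵁ W} = {z | z ∈ Q.V ∧ ⊤ ≤ Q.ψ z ⁻¹ᵁ W} ∩ V := by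
      ext z
      exact and_right_comm
    rw [e]
    exact (Q.isOpen_preimage W).inter hV
  holomorphic W f := (Q.holomorphic W f).mono fun _ hz => ⟨hz.1.1, hz.2⟩

theorem isArithmetic_opens {X : Scheme.{0}} (hX : isArithmetic X) (W : X.Opens) :
    isArithmetic W.toScheme := by
  obtain ⟨h1, h2, h3, h4⟩ := hX
  have hT : specZIsTerminal.from W.toScheme = W.ι ≫ specZIsTerminal.from X :=
    specZIsTerminal.hom_ext _ _
  have : IsLocallyNoetherian (Spec (.of ℤ)) := inferInstance
  have : IsLocallyNoetherian X := LocallyOfFiniteType.isLocallyNoetherian (specZIsTerminal.from X)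
  refine ⟨⟨?_⟩, ?_, ?_, fun x => ?_⟩
  · rw [← Limits.terminal.comp_from W.ι]
    infer_instance
  · rw [hT]
    infer_instance
  · rw [hT]
    infer_instance
  · have := h4 x.1
    exact IsRegularLocalRing.of_ringEquiv (W.stalkIso x).symm.commRingCatIsoToRingEquiv

/-- An open subscheme of an arithmetic scheme. -/
def ArithScheme.sub (X : ArithScheme) (W : X.obj.Opens) : ArithScheme :=
  ⟨W.toScheme, isArithmetic_opens X.property W⟩

/-- The inclusion of an open subscheme. -/
def ArithScheme.subIncl (X : ArithScheme) (W : X.obj.Opens) : X.sub W ⟶ X := ⟨W.ι⟩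

/-! ### Fibre products with open embeddings -/

/-- Products of an open embedding of manifolds and an open immersion of schemes. -/
class IsOpenPair {V Z : Pairs} (g : V ⟶ Z) : Prop where
  isOpenEmbedding : SmoothMap.IsOpenEmbedding g.1
  isOpenImmersion : IsOpenImmersion g.2.hom

attribute [instance] IsOpenPair.isOpenImmersion

/-- The fibre product of an open embedding `g₂ : V₂ → Z` and an arbitrary map `g₁ : V₁ → Z` is the
open subset `g₁⁻¹(V₂)` of `V₁`. -/
theorem exists_fibreProduct {V₁ V₂ Z : Pairs} (g₁ : V₁ ⟶ Z) (g₂ : V₂ ⟶ Z) (h : IsOpenPair g₂) :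
    ∃ (V : Pairs) (k : V ⟶ V₁) (l : V ⟶ V₂), IsOpenPair k ∧ k ≫ g₁ = l ≫ g₂ ∧
      (∀ m, SmoothMap.toFun g₁.1 m ∈ range (SmoothMap.toFun g₂.1) →
        m ∈ range (SmoothMap.toFun k.1)) ∧
      ∀ x, g₁.2.hom x ∈ range g₂.2.hom → x ∈ range k.2.hom := by
  obtain ⟨h₁, h₂⟩ := h
  let O : ∀ i, TopologicalSpace.Opens (V₁.1.Pt i) :=
    fun i => ⟨_, SmoothMap.isOpen_preimage_range h₁ g₁.1 i⟩
  let W : V₁.2.obj.Opens := g₁.2.hom ⁻¹ᵁ g₂.2.hom.opensRange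
  have hO : ∀ k, (SmoothMap.comp (subIncl V₁.1 O) g₁.1).toFun k ∈ range (SmoothMap.toFun g₂.1) :=
    fun k => (mem_range_subIncl (x := (subIncl V₁.1 O).toFun k)).1 ⟨k, rfl⟩
  have hW : range (W.ι ≫ g₁.2.hom) ⊆ range g₂.2.hom := by
    rintro _ ⟨x, rfl⟩
    exact x.2
  let k : ((V₁.1.sub O, V₁.2.sub W) : Pairs) ⟶ V₁ := (subIncl V₁.1 O, V₁.2.subIncl W)
  let l : ((V₁.1.sub O, V₁.2.sub W) : Pairs) ⟶ V₂ :=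
    (SmoothMap.IsOpenEmbedding.lift h₁ (SmoothMap.comp (subIncl V₁.1 O) g₁.1) hO,
      ⟨IsOpenImmersion.lift g₂.2.hom (W.ι ≫ g₁.2.hom) hW⟩)
  refine ⟨_, k, l, ⟨subIncl_isOpenEmbedding _ _, inferInstanceAs (IsOpenImmersion W.ι)⟩, ?_,
    fun m hm => ?_, fun x hx => ?_⟩
  · refine Prod.ext (SmoothMap.ext (funext fun x => ?_)) (ObjectProperty.hom_ext _ ?_)
    · exact (SmoothMap.IsOpenEmbedding.lift_spec h₁ _ hO x).symm
    · exact (IsOpenImmersion.lift_fac g₂.2.hom (W.ι ≫ g₁.2.hom) hW).symm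
  · exact mem_range_subIncl.2 hm
  · exact ⟨⟨x, hx⟩, rfl⟩

/-! ### Local lifts of parametrisations -/

theorem comp_fderivWithin_id {n m k : ℕ} {s : Set (Crd n m)} {z : Crd n m}
    (hs : UniqueDiffWithinAt ℝ s z) (η : Crd n m [⋀^Fin k]→L[ℝ] ℂ) :
    η.compContinuousLinearMap (fderivWithin ℝ (Prod.map (fun u => u) (fun v => v)) s z) = η := by
  have e : (Prod.map (fun u => u) (fun v => v) : Crd n m → Crd n m) = id := rfl
  rw [e, fderivWithin_id hs]
  rfl

/-- A ball around `z.1` on which the parametrisation `P` lifts along the open embedding `f`; the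
parametrisation `Q` lifts along `g` on the preimage of the image of `g`. -/
structure LiftAt (f : SmoothMap N M) (g : Y ⟶ X) [IsOpenImmersion g] (P : MPlot M)
    (Q : XPlot X) (z : Crd P.dim Q.dim) where
  isOpenEmbedding : f.IsOpenEmbedding
  mem : z ∈ dom P Q
  mem_range : ⊤ ≤ Q.ψ z.2 ⁻¹ᵁ g.opensRange
  r : ℝ
  pos : 0 < r
  mem_ball : ∀ u ∈ P.U ∩ Metric.ball z.1 r, P.φ u ∈ range f.toFun

theorem nonempty_liftAt {f : SmoothMap N M} (hf : f.IsOpenEmbedding) (g : Y ⟶ X)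
    [IsOpenImmersion g] {P : MPlot M} {Q : XPlot X} {z : Crd P.dim Q.dim} (hz : z ∈ dom P Q)
    (h₁ : P.φ z.1 ∈ range f.toFun) (h₂ : ⊤ ≤ Q.ψ z.2 ⁻¹ᵁ g.opensRange) :
    Nonempty (LiftAt f g P Q z) := by
  obtain ⟨r, hr, h⟩ := Metric.mem_nhdsWithin_iff.1 (P.eventually_mem_range hf hz.1 h₁)
  exact ⟨⟨hf, hz, h₂, r, hr, fun u hu => h ⟨hu.2, hu.1⟩⟩⟩

namespace LiftAt

variable {f : SmoothMap N M} {g : Y ⟶ X} [IsOpenImmersion g] {P : MPlot M} {Q : XPlot X}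
  {z : Crd P.dim Q.dim}

/-- The lift of the parametrisation of the manifold. -/
@[reducible] def mplot (D : LiftAt f g P Q z) : MPlot N :=
  (P.restrict D.mem.1 D.pos).lift D.isOpenEmbedding D.mem_ball

/-- The lift of the parametrisation of the complex points. -/
@[reducible] def xplot (D : LiftAt f g P Q z) : XPlot Y :=
  (Q.restrict (Q.isOpen_preimage g.opensRange)).lift g (fun _ h => h.2.2)
    (z₀ := z.2) ⟨D.mem.2, D.mem.2, D.mem_range⟩

theorem mplot_isReparam (D : LiftAt f g P Q z) : (D.mplot.map f).IsReparam P (fun u => u) where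
  smooth := contDiffOn_id
  mapsTo _ hu := hu.1
  eq _ hu := MPlot.lift_spec D.isOpenEmbedding (P.restrict D.mem.1 D.pos) D.mem_ball hu

theorem xplot_isReparam (D : LiftAt f g P Q z) : (D.xplot.map g).IsReparam Q (fun v => v) where
  holomorphic := analyticOnNhd_id
  mapsTo _ hv := hv.1
  eq _ hv := XPlot.lift_spec g (Q.restrict (Q.isOpen_preimage g.opensRange)) (fun _ h => h.2.2)
    ⟨D.mem.2, D.mem.2, D.mem_range⟩ hv

/-- The lifts are defined on the intersection of the coordinate domain with a neighbourhood. -/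
theorem dom_eq (D : LiftAt f g P Q z) : dom D.mplot D.xplot =
    dom P Q ∩ (Metric.ball z.1 D.r ×ˢ {v | v ∈ Q.V ∧ ⊤ ≤ Q.ψ v ⁻¹ᵁ g.opensRange}) :=
  prod_inter_prod.symm

theorem isOpen_nbhd (D : LiftAt f g P Q z) :
    IsOpen (Metric.ball z.1 D.r ×ˢ {v | v ∈ Q.V ∧ ⊤ ≤ Q.ψ v ⁻¹ᵁ g.opensRange}) :=
  Metric.isOpen_ball.prod (Q.isOpen_preimage g.opensRange)

theorem mem_dom (D : LiftAt f g P Q z) : z ∈ dom D.mplot D.xplot :=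
  ⟨⟨D.mem.1, Metric.mem_ball_self D.pos⟩, D.mem.2, D.mem.2, D.mem_range⟩

/-- Forms are determined by their pull-backs to an open subset near points of that subset. -/
theorem pull_val (D : LiftAt f g P Q z) {k : ℤ} (α : Form M X k) {w : Crd P.dim Q.dim}
    (hw : w ∈ dom D.mplot D.xplot) : (Form.pull f g k α).1 D.mplot D.xplot w = α.1 P Q w :=
  (α.2.2.2.2 _ _ _ _ _ _ D.mplot_isReparam D.xplot_isReparam w hw).trans
    (comp_fderivWithin_id (uniqueDiffOn_dom D.mplot D.xplot w hw) _)

theorem pull_val_conj (D : LiftAt f g P Q z) {k : ℤ} (α : Form M X k) :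
    (Form.pull f g k α).1 D.mplot D.xplot.conj (conjCrd _ _ z) = α.1 P Q.conj (conjCrd _ _ z) := by
  have hw : conjCrd P.dim Q.dim z ∈ dom D.mplot D.xplot.conj := by
    have := D.mem_dom
    rw [dom_conj] at this
    exact this
  have h : (D.xplot.conj.map g).IsReparam Q.conj (fun v => v) :=
    { holomorphic := analyticOnNhd_id
      mapsTo := fun v hv => hv.1
      eq := fun v hv => (Category.assoc _ _ _).trans
        (congrArg conjPoint (D.xplot_isReparam.eq (star v) hv)) }
  exact (α.2.2.2.2 _ _ _ _ _ _ D.mplot_isReparam h _ hw).trans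
    (comp_fderivWithin_id (uniqueDiffOn_dom D.mplot D.xplot.conj _ hw) _)

end LiftAt

/-! ### Gluing of forms -/

/-- Sieves which locally contain open subsets. -/
def IsLocallyOpen {Z : Pairs} (S : Sieve Z) : Prop :=
  ∀ (m : Z.1.Point) (x : Z.2.obj), ∃ (V : Pairs) (g : V ⟶ Z), S g ∧ IsOpenPair g ∧
    m ∈ range (SmoothMap.toFun g.1) ∧ x ∈ range g.2.hom

/-- Local lifts of parametrisations of `[0,1] × M` and `X(ℂ)` to a member of a sieve. -/
structure SieveLift {Z : Pairs} (S : Sieve Z) (P : MPlot (cyl Z.1)) (Q : XPlot Z.2.obj)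
    (z : Crd P.dim Q.dim) where
  V : Pairs
  g : V ⟶ Z
  mem : S g
  [isOpenPair : IsOpenPair g]
  lift : LiftAt (cylMap g.1) g.2.hom P Q z

attribute [instance] SieveLift.isOpenPair

theorem IsLocallyOpen.nonempty_sieveLift {Z : Pairs} {S : Sieve Z} (hS : IsLocallyOpen S)
    {P : MPlot (cyl Z.1)} {Q : XPlot Z.2.obj} {z : Crd P.dim Q.dim} (hz : z ∈ dom P Q) :
    Nonempty (SieveLift S P Q z) := by
  let s : Spec (.of ℂ) := IsLocalRing.closedPoint ℂ
  obtain ⟨V, g, hg, ho, h1, h2⟩ := hS ((cylProj Z.1).toFun (P.φ z.1)) (Q.ψ z.2 s)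
  obtain ⟨D⟩ := nonempty_liftAt (cylMap_isOpenEmbedding ho.isOpenEmbedding) g.2.hom hz
    (mem_range_cylMap.2 h1) ((top_le_preimage_iff _ _ s).2 h2)
  exact ⟨⟨V, g, hg, D⟩⟩

/-- Families of forms on the members of a sieve. -/
abbrev FormFamily {Z : Pairs} (S : Sieve Z) (k : ℤ) : Type 1 :=
  ∀ ⦃V : Pairs⦄ (g : V ⟶ Z), S g → Form (cyl V.1) V.2.obj k

/-- The compatibility of a family of forms with pull-backs. -/
def FormFamily.IsCompatible {Z : Pairs} {S : Sieve Z} {k : ℤ} (x : FormFamily S k) : Prop :=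
  ∀ ⦃V W : Pairs⦄ (g : V ⟶ Z) (h : W ⟶ V) (hg : S g),
    Form.pull (cylMap h.1) h.2.hom k (x g hg) = x (h ≫ g) (S.downward_closed hg h)

section

variable {Z : Pairs} {S : Sieve Z} {k : ℤ} {x : FormFamily S k}

/-- Two members of a compatible family agree, up to a change of coordinates, where both of them are
defined.  This is deduced from the compatibility on the fibre product. -/
theorem FormFamily.IsCompatible.val_eq (hx : x.IsCompatible) {V₁ V₂ : Pairs} {g₁ : V₁ ⟶ Z}
    (h₁ : S g₁) {g₂ : V₂ ⟶ Z} (h₂ : S g₂) [ho : IsOpenPair g₂]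
    {P₁ : MPlot (cyl V₁.1)} {Q₁ : XPlot V₁.2.obj} {P₂ : MPlot (cyl V₂.1)} {Q₂ : XPlot V₂.2.obj}
    {a : (Fin P₁.dim → ℝ) → (Fin P₂.dim → ℝ)} {b : (Fin Q₁.dim → ℂ) → (Fin Q₂.dim → ℂ)}
    (ha : (P₁.map (cylMap g₁.1)).IsReparam (P₂.map (cylMap g₂.1)) a)
    (hb : (Q₁.map g₁.2.hom).IsReparam (Q₂.map g₂.2.hom) b) {w : Crd P₁.dim Q₁.dim}
    (hw : w ∈ dom P₁ Q₁) :
    (x g₁ h₁).1 P₁ Q₁ w = ((x g₂ h₂).1 P₂ Q₂ (Prod.map a b w)).compContinuousLinearMap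
      (fderivWithin ℝ (Prod.map a b) (dom P₁ Q₁) w) := by
  obtain ⟨V, k', l, hk, hkl, hm, hs⟩ := exists_fibreProduct g₁ g₂ ho
  have hP : ∀ u ∈ P₁.U, P₁.φ u ∈ range (cylMap k'.1).toFun := fun u hu => by
    refine mem_range_cylMap.2 (hm _ ?_)
    refine ⟨(cylProj V₂.1).toFun (P₂.φ (a u)), ?_⟩
    exact congrArg (cylProj Z.1).toFun (ha.eq u hu).symm
  have hQ : ∀ v ∈ Q₁.V, ⊤ ≤ Q₁.ψ v ⁻¹ᵁ k'.2.hom.opensRange := fun v hv s _ => by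
    refine hs _ ⟨Q₂.ψ (b v) s, ?_⟩
    exact congrArg (fun y : CPoint Z.2.obj => y s) (hb.eq v hv).symm
  have hke := cylMap_isOpenEmbedding hk.isOpenEmbedding
  -- Both forms are compared with the pull-back to `V`, in the lifted coordinates.
  have hP₁ : P₁.IsReparam ((P₁.lift hke hP).map (cylMap k'.1)) (fun u => u) :=
    ⟨contDiffOn_id, fun _ h => h, fun u hu => (MPlot.lift_spec hke P₁ hP hu).symm⟩
  have hQ₁ : Q₁.IsReparam ((Q₁.lift k'.2.hom hQ hw.2).map k'.2.hom) (fun v => v) :=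
    ⟨analyticOnNhd_id, fun _ h => h, fun v hv => (XPlot.lift_spec k'.2.hom Q₁ hQ hw.2 hv).symm⟩
  have e₁ : (x g₁ h₁).1 P₁ Q₁ w =
      (x g₁ h₁).1 ((P₁.lift hke hP).map (cylMap k'.1))
        ((Q₁.lift k'.2.hom hQ hw.2).map k'.2.hom) w :=
    ((x g₁ h₁).2.2.2.2 _ _ _ _ _ _ hP₁ hQ₁ w hw).trans
      (comp_fderivWithin_id (uniqueDiffOn_dom P₁ Q₁ w hw) _)
  have e₂ : Form.pull (cylMap k'.1) k'.2.hom k (x g₁ h₁) =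
      Form.pull (cylMap l.1) l.2.hom k (x g₂ h₂) := by
    rw [hx g₁ k' h₁, hx g₂ l h₂]
    congr 1
  have e₃ : (x g₁ h₁).1 ((P₁.lift hke hP).map (cylMap k'.1))
      ((Q₁.lift k'.2.hom hQ hw.2).map k'.2.hom) w =
      (x g₂ h₂).1 ((P₁.lift hke hP).map (cylMap l.1))
        ((Q₁.lift k'.2.hom hQ hw.2).map l.2.hom) w :=
    congrArg (fun α : Form (cyl V.1) V.2.obj k =>
      α.1 (P₁.lift hke hP) (Q₁.lift k'.2.hom hQ hw.2) w) e₂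
  have hc : SmoothMap.comp k'.1 g₁.1 = SmoothMap.comp l.1 g₂.1 := congrArg Prod.fst hkl
  have hd : k'.2.hom ≫ g₁.2.hom = l.2.hom ≫ g₂.2.hom := congrArg (fun h => h.2.hom) hkl
  have hP₂ : ((P₁.lift hke hP).map (cylMap l.1)).IsReparam P₂ a := by
    refine ⟨ha.smooth, ha.mapsTo, fun u hu => ?_⟩
    refine (cylMap_isOpenEmbedding ho.isOpenEmbedding).1 ((Eq.trans ?_
      (congrArg (cylMap g₁.1).toFun (MPlot.lift_spec hke P₁ hP hu))).trans (ha.eq u hu))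
    exact (congrArg (fun h => (cylMap h).toFun ((P₁.lift hke hP).φ u)) hc).symm
  have hQ₂ : ((Q₁.lift k'.2.hom hQ hw.2).map l.2.hom).IsReparam Q₂ b := by
    refine ⟨hb.holomorphic, hb.mapsTo, fun v hv => ?_⟩
    refine (cancel_mono g₂.2.hom).1 (Eq.trans ?_ (hb.eq v hv))
    have := XPlot.lift_spec k'.2.hom Q₁ hQ hw.2 hv
    rw [Category.assoc, ← hd, ← Category.assoc]
    exact congrArg (· ≫ g₁.2.hom) this
  exact (e₁.trans e₃).trans ((x g₂ h₂).2.2.2.2 _ _ _ _ _ _ hP₂ hQ₂ w hw)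

namespace SieveLift

variable {P : MPlot (cyl Z.1)} {Q : XPlot Z.2.obj} {z : Crd P.dim Q.dim}

/-- The value at `w` of the form glued from `x`, computed on a member of the sieve. -/
def val (D : SieveLift S P Q z) (x : FormFamily S k) (w : Crd P.dim Q.dim) :
    Crd P.dim Q.dim [⋀^Fin k.toNat]→L[ℝ] ℂ :=
  (x D.g D.mem).1 D.lift.mplot D.lift.xplot w

/-- The members of a compatible family have the local value `D.val x` in all coordinates. -/
theorem eq_val (hx : x.IsCompatible) (D : SieveLift S P Q z) {V₁ : Pairs} {g₁ : V₁ ⟶ Z} (h₁ : S g₁)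
    {P₁ : MPlot (cyl V₁.1)} {Q₁ : XPlot V₁.2.obj}
    {a : (Fin P₁.dim → ℝ) → (Fin P.dim → ℝ)} {b : (Fin Q₁.dim → ℂ) → (Fin Q.dim → ℂ)}
    (ha : (P₁.map (cylMap g₁.1)).IsReparam P a) (hb : (Q₁.map g₁.2.hom).IsReparam Q b)
    {w : Crd P₁.dim Q₁.dim} (hw : w ∈ dom P₁ Q₁)
    (hw' : Prod.map a b w ∈ dom D.lift.mplot D.lift.xplot) :
    (x g₁ h₁).1 P₁ Q₁ w = (D.val x (Prod.map a b w)).compContinuousLinearMap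
      (fderivWithin ℝ (Prod.map a b) (dom P₁ Q₁) w) := by
  -- Shrink the coordinate domain around `w` so that it is mapped to the domain of the local lift.
  obtain ⟨r, hr, hball⟩ := Metric.mem_nhdsWithin_iff.1
    ((ha.smooth.continuousOn w.1 hw.1).preimage_mem_nhdsWithin
      (Metric.isOpen_ball.mem_nhds hw'.1.2))
  have hVo : IsOpen {v | v ∈ Q₁.V ∧ ⊤ ≤ (Q₁.ψ v ≫ g₁.2.hom) ⁻¹ᵁ D.g.2.hom.opensRange} :=
    (Q₁.map g₁.2.hom).isOpen_preimage D.g.2.hom.opensRange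
  let P₀ : MPlot (cyl V₁.1) := P₁.restrict hw.1 hr
  let Q₀ : XPlot V₁.2.obj := Q₁.restrict hVo
  have hwV : w.2 ∈ {v | v ∈ Q₁.V ∧ ⊤ ≤ (Q₁.ψ v ≫ g₁.2.hom) ⁻¹ᵁ D.g.2.hom.opensRange} := by
    have e : Q₁.ψ w.2 ≫ g₁.2.hom = Q.ψ (b w.2) := hb.eq w.2 hw.2
    refine ⟨hw.2, ?_⟩
    rw [e]
    exact hw'.2.2.2
  have hw₀ : w ∈ dom P₀ Q₀ := ⟨⟨hw.1, Metric.mem_ball_self hr⟩, hw.2, hwV⟩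
  have hP₀ : P₀.IsReparam P₁ (fun u => u) := ⟨contDiffOn_id, fun _ h => h.1, fun _ _ => rfl⟩
  have hQ₀ : Q₀.IsReparam Q₁ (fun v => v) := ⟨analyticOnNhd_id, fun _ h => h.1, fun _ _ => rfl⟩
  have e₀ : (x g₁ h₁).1 P₀ Q₀ w = (x g₁ h₁).1 P₁ Q₁ w :=
    ((x g₁ h₁).2.2.2.2 _ _ _ _ _ _ hP₀ hQ₀ w hw₀).trans
      (comp_fderivWithin_id (uniqueDiffOn_dom P₀ Q₀ w hw₀) _)
  have ha' : (P₀.map (cylMap g₁.1)).IsReparam (D.lift.mplot.map (cylMap D.g.1)) a := by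
    have hm : MapsTo a P₀.U D.lift.mplot.U := fun u hu => ⟨ha.mapsTo hu.1, hball ⟨hu.2, hu.1⟩⟩
    exact ⟨ha.smooth.mono inter_subset_left, hm,
      fun u hu => (ha.eq u hu.1).trans (D.lift.mplot_isReparam.eq _ (hm hu)).symm⟩
  have hb' : (Q₀.map g₁.2.hom).IsReparam (D.lift.xplot.map D.g.2.hom) b := by
    have hm : MapsTo b Q₀.V D.lift.xplot.V := fun v hv => by
      have e : Q₁.ψ v ≫ g₁.2.hom = Q.ψ (b v) := hb.eq v hv.1
      have h2 := hv.2.2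
      rw [e] at h2
      exact ⟨hb.mapsTo hv.1, hb.mapsTo hv.1, h2⟩
    exact ⟨hb.holomorphic.mono inter_subset_left, hm,
      fun v hv => (hb.eq v hv.1).trans (D.lift.xplot_isReparam.eq _ (hm hv)).symm⟩
  have e₁ := hx.val_eq h₁ D.mem ha' hb' hw₀
  have e₂ : fderivWithin ℝ (Prod.map a b) (dom P₀ Q₀) w =
      fderivWithin ℝ (Prod.map a b) (dom P₁ Q₁) w := by
    have e : dom P₀ Q₀ = dom P₁ Q₁ ∩ (Metric.ball w.1 r ×ˢ
      {v | v ∈ Q₁.V ∧ ⊤ ≤ (Q₁.ψ v ≫ g₁.2.hom) ⁻¹ᵁ D.g.2.hom.opensRange}) := prod_inter_prod.symm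
    rw [e]
    exact fderivWithin_inter ((Metric.isOpen_ball.prod hVo).mem_nhds
      ⟨Metric.mem_ball_self hr, hwV⟩)
  exact e₀.symm.trans (e₁.trans (congrArg _ e₂))

/-- The local values are compatible with changes of coordinates. -/
theorem val_eq_val (hx : x.IsCompatible) {P' : MPlot (cyl Z.1)} {Q' : XPlot Z.2.obj}
    {z' : Crd P'.dim Q'.dim} (D' : SieveLift S P' Q' z') (D : SieveLift S P Q z)
    {a : (Fin P'.dim → ℝ) → (Fin P.dim → ℝ)} {b : (Fin Q'.dim → ℂ) → (Fin Q.dim → ℂ)}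
    (ha : P'.IsReparam P a) (hb : Q'.IsReparam Q b) {w : Crd P'.dim Q'.dim}
    (hw : w ∈ dom D'.lift.mplot D'.lift.xplot)
    (hw' : Prod.map a b w ∈ dom D.lift.mplot D.lift.xplot) :
    D'.val x w = (D.val x (Prod.map a b w)).compContinuousLinearMap
      (fderivWithin ℝ (Prod.map a b) (dom P' Q') w) := by
  have ha' : (D'.lift.mplot.map (cylMap D'.g.1)).IsReparam P a :=
    ⟨ha.smooth.mono inter_subset_left, fun u hu => ha.mapsTo hu.1,
      fun u hu => (D'.lift.mplot_isReparam.eq u hu).trans (ha.eq u hu.1)⟩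
  have hb' : (D'.lift.xplot.map D'.g.2.hom).IsReparam Q b :=
    ⟨hb.holomorphic.mono inter_subset_left, fun u hu => hb.mapsTo hu.1,
      fun u hu => (D'.lift.xplot_isReparam.eq u hu).trans (hb.eq u hu.1)⟩
  refine (D.eq_val hx D'.mem ha' hb' hw hw').trans (congrArg _ ?_)
  rw [D'.lift.dom_eq] at hw ⊢
  exact fderivWithin_inter (D'.lift.isOpen_nbhd.mem_nhds hw.2)

end SieveLift

open Classical in
/-- The family of forms in local coordinates glued from `x`, computed at each point by an arbitrary
choice of a local lift. -/
def glueRaw (hS : IsLocallyOpen S) (x : FormFamily S k) : RawForm (cyl Z.1) Z.2.obj k :=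
  fun _ _ z => if hz : z ∈ dom _ _ then (hS.nonempty_sieveLift hz).some.val x z else 0

/-- The glued form can be computed by any local lift, not just by the chosen one. -/
theorem glueRaw_eq (hS : IsLocallyOpen S) (hx : x.IsCompatible) {P : MPlot (cyl Z.1)}
    {Q : XPlot Z.2.obj} {z : Crd P.dim Q.dim} (D : SieveLift S P Q z) {w : Crd P.dim Q.dim}
    (hw : w ∈ dom D.lift.mplot D.lift.xplot) : glueRaw hS x P Q w = D.val x w := by
  have hw' : w ∈ dom P Q := by
    rw [D.lift.dom_eq] at hw
    exact hw.1
  refine (dif_pos hw').trans ?_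
  have h := SieveLift.val_eq_val hx (hS.nonempty_sieveLift hw').some D (a := fun u => u)
    (b := fun v => v) ⟨contDiffOn_id, fun _ h => h, fun _ _ => rfl⟩
    ⟨analyticOnNhd_id, fun _ h => h, fun _ _ => rfl⟩
    (hS.nonempty_sieveLift hw').some.lift.mem_dom hw
  exact h.trans (comp_fderivWithin_id (uniqueDiffOn_dom P Q w hw') _)

/-- The form glued from a compatible family. -/
def glue (hS : IsLocallyOpen S) (x : FormFamily S k) (hx : x.IsCompatible) :
    Form (cyl Z.1) Z.2.obj k :=
  ⟨glueRaw hS x, by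
    refine ⟨fun hk => ?_, fun P Q z hz => ?_, fun P Q z hz => dif_neg hz,
      fun P' P a Q' Q b ha hb z hz => ?_⟩
    · funext P Q z
      by_cases hz : z ∈ dom P Q
      · refine (dif_pos hz).trans ?_
        let D := (hS.nonempty_sieveLift hz).some
        exact congrFun (congrFun (congrFun ((x D.g D.mem).2.1 hk) D.lift.mplot) D.lift.xplot) z
      · exact dif_neg hz
    · obtain ⟨D⟩ := hS.nonempty_sieveLift hz
      have h : ContDiffWithinAt ℝ ∞ (D.val x) (dom D.lift.mplot D.lift.xplot) z :=
        (x D.g D.mem).2.2.1 D.lift.mplot D.lift.xplot z D.lift.mem_dom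
      have h' : ContDiffWithinAt ℝ ∞ (glueRaw hS x P Q) (dom D.lift.mplot D.lift.xplot) z :=
        h.congr (fun w hw => glueRaw_eq hS hx D hw) (glueRaw_eq hS hx D D.lift.mem_dom)
      have hm := D.lift.mem_dom
      rw [D.lift.dom_eq] at h' hm
      exact (contDiffWithinAt_inter (D.lift.isOpen_nbhd.mem_nhds hm.2)).1 h'
    · have hz' := mapsTo_prodMap ha hb hz
      obtain ⟨D'⟩ := hS.nonempty_sieveLift hz
      obtain ⟨D⟩ := hS.nonempty_sieveLift hz'
      rw [glueRaw_eq hS hx D' D'.lift.mem_dom, glueRaw_eq hS hx D D.lift.mem_dom]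
      exact SieveLift.val_eq_val hx D' D ha hb D'.lift.mem_dom D.lift.mem_dom⟩

theorem pull_glue (hS : IsLocallyOpen S) (hx : x.IsCompatible) {V : Pairs} (g : V ⟶ Z) (hg : S g) :
    Form.pull (cylMap g.1) g.2.hom k (glue hS x hx) = x g hg := by
  refine Form.ext fun P Q z hz => ?_
  obtain ⟨D⟩ := hS.nonempty_sieveLift (P := P.map (cylMap g.1)) (Q := Q.map g.2.hom) (z := z) hz
  have h := D.eq_val hx hg (P₁ := P) (Q₁ := Q) (a := fun u => u) (b := fun v => v) (w := z)
    ⟨contDiffOn_id, fun _ h => h, fun _ _ => rfl⟩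
    ⟨analyticOnNhd_id, fun _ h => h, fun _ _ => rfl⟩ hz D.lift.mem_dom
  exact (glueRaw_eq hS hx D D.lift.mem_dom).trans
    (h.trans (comp_fderivWithin_id (uniqueDiffOn_dom P Q z hz) _)).symm

theorem IsLocallyOpen.form_ext (hS : IsLocallyOpen S) {α β : Form (cyl Z.1) Z.2.obj k}
    (h : ∀ ⦃V : Pairs⦄ (g : V ⟶ Z), S g →
      Form.pull (cylMap g.1) g.2.hom k α = Form.pull (cylMap g.1) g.2.hom k β) : α = β := by
  refine Form.ext fun P Q z hz => ?_
  obtain ⟨D⟩ := hS.nonempty_sieveLift hz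
  rw [← D.lift.pull_val α D.lift.mem_dom, ← D.lift.pull_val β D.lift.mem_dom, h D.g D.mem]

theorem IsLocallyOpen.nonempty_liftAt (hS : IsLocallyOpen S) {P : MPlot Z.1} {Q : XPlot Z.2.obj}
    {z : Crd P.dim Q.dim} (hz : z ∈ dom P Q) : ∃ (V : Pairs) (g : V ⟶ Z) (_ : S g)
      (_ : IsOpenPair g), Nonempty (LiftAt (g.1 : SmoothMap V.1 Z.1) g.2.hom P Q z) := by
  let s : Spec (.of ℂ) := IsLocalRing.closedPoint ℂ
  obtain ⟨V, g, hg, ho, h1, h2⟩ := hS (P.φ z.1) (Q.ψ z.2 s)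
  exact ⟨V, g, hg, ho, Deligne.nonempty_liftAt ho.isOpenEmbedding g.2.hom hz h1
    ((top_le_preimage_iff _ _ s).2 h2)⟩

theorem IsLocallyOpen.mem_real (hS : IsLocallyOpen S) {p : ℕ} {β : Form Z.1 Z.2.obj k}
    (h : ∀ ⦃V : Pairs⦄ (g : V ⟶ Z), S g → Form.pull g.1 g.2.hom k β ∈ Form.real V.1 V.2.obj p k) :
    β ∈ Form.real Z.1 Z.2.obj p k := by
  intro P Q z
  by_cases hz : z ∈ dom P Q
  · obtain ⟨V, g, hg, _, ⟨D⟩⟩ := hS.nonempty_liftAt hz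
    rw [← D.pull_val β D.mem_dom]
    exact h g hg D.mplot D.xplot z
  · rw [β.2.2.2.1 P Q z hz]
    exact Submodule.zero_mem _

theorem IsLocallyOpen.mem_hodge (hS : IsLocallyOpen S) {p : ℕ} {β : Form Z.1 Z.2.obj k}
    (h : ∀ ⦃V : Pairs⦄ (g : V ⟶ Z), S g → Form.pull g.1 g.2.hom k β ∈ Form.hodge V.1 V.2.obj p k) :
    β ∈ Form.hodge Z.1 Z.2.obj p k := by
  intro P Q z
  by_cases hz : z ∈ dom P Q
  · obtain ⟨V, g, hg, _, ⟨D⟩⟩ := hS.nonempty_liftAt hz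
    rw [← D.pull_val β D.mem_dom]
    exact h g hg D.mplot D.xplot z
  · rw [β.2.2.2.1 P Q z hz]
    exact Submodule.zero_mem _

theorem IsLocallyOpen.mem_invariants (hS : IsLocallyOpen S) {α : Form (cyl Z.1) Z.2.obj k}
    (h : ∀ ⦃V : Pairs⦄ (g : V ⟶ Z), S g →
      Form.pull (cylMap g.1) g.2.hom k α ∈ Form.invariants (cyl V.1) V.2.obj k) :
    α ∈ Form.invariants (cyl Z.1) Z.2.obj k := by
  funext P Q z
  by_cases hz : z ∈ dom P Q
  · obtain ⟨D⟩ := hS.nonempty_sieveLift hz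
    have h₁ := congrFun (congrFun (congrFun
      (show galois (Form.pull (cylMap D.g.1) D.g.2.hom k α).1 = _ from h D.g D.mem)
      D.lift.mplot) D.lift.xplot) z
    refine Eq.trans ?_ (h₁.trans (D.lift.pull_val α D.lift.mem_dom))
    exact congrArg (fun η : Crd P.dim Q.dim [⋀^Fin k.toNat]→L[ℝ] ℂ =>
      (Complex.conjCLE : ℂ →L[ℝ] ℂ).compContinuousAlternatingMap (η.compContinuousLinearMap
        (conjCrd P.dim Q.dim : Crd P.dim Q.dim →L[ℝ] Crd P.dim Q.dim)))
      (D.lift.pull_val_conj α).symm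
  · have hz' : conjCrd _ _ z ∉ dom P Q.conj := by
      rw [dom_conj] at hz
      exact hz
    rw [α.2.2.2.1 P Q z hz]
    unfold galois
    rw [α.2.2.2.1 P Q.conj _ hz']
    ext v
    simp

end

/-! ### The sheaf property -/

/-- In every degree, the compatible families of elements of `F` on the sieve `S` have a unique
gluing. -/
def HasUniqueGluing (F : Pairsᵒᵖ ⥤ CochainComplex (ModuleCat.{0} ℝ) ℤ) {Z : Pairs} (S : Sieve Z) :
    Prop :=
  ∀ (n : ℤ) (x : ∀ ⦃V : Pairs⦄ (g : V ⟶ Z), S g → (F.obj (.op V)).X n),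
    (∀ ⦃V W : Pairs⦄ (g : V ⟶ Z) (h : W ⟶ V) (hg : S g),
      ((F.map h.op).f n).hom (x g hg) = x (h ≫ g) (S.downward_closed hg h)) →
    ∃! t : (F.obj (.op Z)).X n, ∀ ⦃V : Pairs⦄ (g : V ⟶ Z) (hg : S g),
      ((F.map g.op).f n).hom t = x g hg

/-- Unique gluing of elements implies unique gluing of morphisms of complexes: the maps obtained
by gluing values are linear and commute with the differentials by uniqueness. -/
theorem HasUniqueGluing.isSheafFor {F : Pairsᵒᵖ ⥤ CochainComplex (ModuleCat.{0} ℝ) ℤ} {Z : Pairs}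
    {S : Sieve Z} (h : HasUniqueGluing F S) (E : CochainComplex (ModuleCat.{0} ℝ) ℤ) :
    Presieve.IsSheafFor (F ⋙ coyoneda.obj (.op E)) S.arrows := by
  intro φ hφ
  rw [Presieve.compatible_iff_sieveCompatible] at hφ
  have hφ' : ∀ ⦃V W : Pairs⦄ (g : V ⟶ Z) (k : W ⟶ V) (hg : S g),
      (show E ⟶ F.obj (.op V) from φ g hg) ≫ F.map k.op =
        (show E ⟶ F.obj (.op W) from φ (k ≫ g) (S.downward_closed hg k)) :=
    fun V W g k hg => (hφ g k hg).symm
  let y : ∀ (n : ℤ) (e : E.X n) ⦃V : Pairs⦄ (g : V ⟶ Z), S g → (F.obj (.op V)).X n :=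
    fun n e V g hg => ((show E ⟶ F.obj (.op V) from φ g hg).f n).hom e
  have hy : ∀ (n : ℤ) (e : E.X n) ⦃V W : Pairs⦄ (g : V ⟶ Z) (k : W ⟶ V) (hg : S g),
      ((F.map k.op).f n).hom (y n e g hg) = y n e (k ≫ g) (S.downward_closed hg k) :=
    fun n e V W g k hg => congrArg (fun ψ : E ⟶ F.obj (.op W) => (ψ.f n).hom e) (hφ' g k hg)
  choose t ht hu using fun n (e : E.X n) => h n (y n e) (hy n e)
  have hext : ∀ n (s s' : (F.obj (.op Z)).X n), (∀ ⦃V : Pairs⦄ (g : V ⟶ Z), S g →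
      ((F.map g.op).f n).hom s = ((F.map g.op).f n).hom s') → s = s' := by
    intro n s s' hs
    refine (h n (fun V g _ => ((F.map g.op).f n).hom s') fun V W g k hg => ?_).unique hs
      fun V g hg => rfl
    exact congrArg (fun ψ : F.obj (.op Z) ⟶ F.obj (.op W) => (ψ.f n).hom s')
      (F.map_comp g.op k.op).symm
  let T : E ⟶ F.obj (.op Z) :=
    { f := fun n => ModuleCat.ofHom
        { toFun := t n
          map_add' := fun e e' => by
            refine hext n _ _ fun V g hg => ?_
            rw [map_add, ht n _ g hg, ht n _ g hg, ht n _ g hg]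
            exact map_add _ _ _
          map_smul' := fun c e => by
            refine hext n _ _ fun V g hg => ?_
            rw [RingHom.id_apply, map_smul, ht n _ g hg, ht n _ g hg]
            exact map_smul _ _ _ }
      comm' := fun i j _ => by
        refine ModuleCat.hom_ext (LinearMap.ext fun e => hext j _ _ fun V g hg => ?_)
        have h₁ := congrArg (fun ψ => ψ.hom (t i e)) ((F.map g.op).comm i j)
        have h₂ := congrArg (fun ψ => ψ.hom e)
          ((show E ⟶ F.obj (.op V) from φ g hg).comm i j)
        have h₃ : ((F.obj (.op V)).d i j).hom (((F.map g.op).f i).hom (t i e)) =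
            ((F.obj (.op V)).d i j).hom (y i e g hg) := congrArg _ (ht i e g hg)
        exact (h₁.symm.trans (h₃.trans h₂)).trans (ht j ((E.d i j).hom e) g hg).symm }
  refine ⟨T, fun V g hg => ?_, fun T' hT' => ?_⟩
  · exact HomologicalComplex.hom_ext _ _ fun n =>
      ModuleCat.hom_ext (LinearMap.ext fun e => ht n e g hg)
  · refine HomologicalComplex.hom_ext _ _ fun n =>
      ModuleCat.hom_ext (LinearMap.ext fun e => hu n e _ fun V g hg => ?_)
    exact congrArg (fun ψ : E ⟶ F.obj (.op V) => (ψ.f n).hom e) (hT' g hg)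

/-- Open covers pull back to open covers.  The pulled back sieve is generated by the fibre
products, which are open again. -/
theorem isLocallyOpen_pullback {Z Z' : Pairs} (f : Z' ⟶ Z) {R : Presieve Z}
    (hR : R ∈ openCovers Z) :
    IsLocallyOpen ((Sieve.generate R).pullback f) := by
  intro m x
  obtain ⟨W, g, hg, hm, hx⟩ := hR.2 (SmoothMap.toFun f.1 m) (f.2.hom x)
  obtain ⟨h₁, h₂⟩ := hR.1 g hg
  obtain ⟨V, k, l, hk, e, h₃, h₄⟩ := exists_fibreProduct f g ⟨h₁, h₂⟩
  exact ⟨V, k, ⟨W, l, g, hg, e.symm⟩, hk, h₃ m hm, h₄ x hx⟩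

theorem isSheaf_of_hasUniqueGluing {F : Pairsᵒᵖ ⥤ CochainComplex (ModuleCat.{0} ℝ) ℤ}
    (h : ∀ {Z : Pairs} (S : Sieve Z), IsLocallyOpen S → HasUniqueGluing F S) :
    Presheaf.IsSheaf site F := by
  intro E
  refine (Precoverage.isSheaf_toGrothendieck_iff _).2 fun R hR => ?_
  exact (h _ (isLocallyOpen_pullback _ hR)).isSheafFor E

theorem IsLocallyOpen.hasUniqueGluing_IDRp {Z : Pairs} {S : Sieve Z} (hS : IsLocallyOpen S)
    (p : ℕ) : HasUniqueGluing (IDRp p) S := by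
  intro n x hx
  let y : FormFamily S (n + 2 * p) := fun V g hg => IDRp.form (x g hg)
  have hy : y.IsCompatible := fun V W g h hg => congrArg IDRp.form (hx g h hg)
  have hglue : glue hS y hy ∈ idr p Z.1 Z.2.obj n := by
    have hm : ∀ ⦃V : Pairs⦄ (g : V ⟶ Z) (hg : S g),
        Form.pull (cylMap g.1) g.2.hom _ (glue hS y hy) ∈ idr p V.1 V.2.obj n := by
      intro V g hg
      rw [pull_glue hS hy g hg]
      exact (show idr p V.1 V.2.obj n from x g hg).2
    exact ⟨⟨hS.mem_real fun V g hg => (hm g hg).1.1, hS.mem_hodge fun V g hg => (hm g hg).1.2⟩,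
      hS.mem_invariants fun V g hg => (hm g hg).2⟩
  refine ⟨(⟨glue hS y hy, hglue⟩ : idr p Z.1 Z.2.obj n), fun V g hg => ?_, fun t ht => ?_⟩
  · exact Subtype.ext (pull_glue hS hy g hg)
  · refine Subtype.ext (hS.form_ext fun V g hg => ?_)
    exact (congrArg IDRp.form (ht g hg)).trans (pull_glue hS hy g hg).symm

theorem isSheaf_IDRp (p : ℕ) : Presheaf.IsSheaf site (IDRp p) :=
  isSheaf_of_hasUniqueGluing fun _ hS => hS.hasUniqueGluing_IDRp p

theorem IsLocallyOpen.hasUniqueGluing_IDR {Z : Pairs} {S : Sieve Z} (hS : IsLocallyOpen S) :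
    HasUniqueGluing IDR S := by
  intro n x hx
  choose t ht hu using fun p : ℕ => hS.hasUniqueGluing_IDRp p n
    (fun V g hg => (show ∀ p, ((IDRp p).obj (.op V)).X n from x g hg) p)
    fun V W g h hg => congrFun (hx g h hg) p
  refine ⟨t, fun V g hg => funext fun p => ht p g hg, fun s hs => funext fun p => ?_⟩
  exact hu p _ fun V g hg => congrFun (hs g hg) p

theorem isSheaf_IDR : Presheaf.IsSheaf site IDR :=
  isSheaf_of_hasUniqueGluing fun _ hS => hS.hasUniqueGluing_IDR

end Deligne

end

theorem mainTheorem6 :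
    (∀ p : ℕ, ∃ q : Deligne.IDRp p ⟶ Deligne.DRp p,
      (∀ (Z : Deligne.Pairsᵒᵖ) (n : ℤ) (x : ((Deligne.IDRp p).obj Z).X n),
        (Deligne.DRp.forms (((q.app Z).f n).hom x)).1 =
          Deligne.Form.restrict 0 _ (Deligne.IDRp.form x) ∧
        (Deligne.DRp.forms (((q.app Z).f n).hom x)).2.1 =
          Deligne.Form.restrict 1 _ (Deligne.IDRp.form x) ∧
        ∀ P Q, ∀ z ∈ Deligne.dom P Q, ∀ v,
          (Deligne.DRp.forms (((q.app Z).f n).hom x)).2.2.1 P Q z v =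
            - Deligne.fibreIntegral (Deligne.IDRp.form x) P Q z v) ∧
      ∀ Z, QuasiIso (q.app Z)) ∧
    (∀ p : ℕ, Presheaf.IsSheaf Deligne.site (Deligne.IDRp p)) ∧
    Presheaf.IsSheaf Deligne.site Deligne.IDR ∧
    ∃ 𝒜 : ∀ Z : Deligne.Pairsᵒᵖ, Deligne.BigradedCDGA fun p => (Deligne.IDRp p).obj Z,
      (∀ (Z W : Deligne.Pairsᵒᵖ) (f : Z ⟶ W),
        ((Deligne.IDR.map f).f 0).hom (𝒜 Z).one = (𝒜 W).one ∧
        ∀ n m k (h : n + m = k) (x : (Deligne.IDR.obj Z).X n) (y : (Deligne.IDR.obj Z).X m),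
          ((Deligne.IDR.map f).f k).hom ((𝒜 Z).mul n m k h x y) =
            (𝒜 W).mul n m k h (((Deligne.IDR.map f).f n).hom x)
              (((Deligne.IDR.map f).f m).hom y)) ∧
      (∀ Z P Q, ∀ z ∈ Deligne.dom P Q, ∀ v,
        (Deligne.IDR.form (Z := Z) (𝒜 Z).one 0).1 P Q z v = 1) ∧
      ∀ (Z : Deligne.Pairsᵒᵖ) n m k (h : n + m = k)
        (x : (Deligne.IDR.obj Z).X n) (y : (Deligne.IDR.obj Z).X m) (r : ℕ),
        ∀ P Q, ∀ z ∈ Deligne.dom P Q, ∀ v,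
          (Deligne.IDR.form (Z := Z) ((𝒜 Z).mul n m k h x y) r).1 P Q z v =
            ∑ pq ∈ Finset.HasAntidiagonal.antidiagonal r,
              Deligne.wedge ((Deligne.IDR.form x pq.1).1 P Q z)
                ((Deligne.IDR.form y pq.2).1 P Q z) v := by
  refine ⟨fun p => ⟨Deligne.qMap p, fun Z n x => ⟨rfl, rfl, fun P Q z hz v => ?_⟩,
      fun Z => Deligne.quasiIso_qMap p Z⟩, Deligne.isSheaf_IDRp, Deligne.isSheaf_IDR,
    Deligne.idrAlgebra, fun Z W f => ⟨Deligne.idrAlgebra_map_one f,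
      fun n m k h x y => Deligne.idrAlgebra_map_mul f n m k h x y⟩,
    fun Z P Q z hz v => Deligne.idrAlgebra_one_val Z hz v,
    fun Z n m k h x y r P Q z _ v => Deligne.idrAlgebra_mul_val Z n m k h x y r P Q z v⟩
  exact congrArg Neg.neg (Deligne.Form.fibre_eq_fibreIntegral _ _ P Q hz v)
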